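/- Let $N$ and $M$ be compact $n$-dimensional smooth manifolds without boundary, let $\nu$ be a smooth volume form on $N$, and let $M$ carry a smooth Riemannian metric $\langle\cdot,\cdot\rangle$ with Riemannian volume $\mu$, Levi-Civita connection $\nabla$, gradient and divergence. The density $\rho$ of a diffeomorphism $\eta\colon N\to M$ is the positive function on $M$ with $(\rho\circ\eta)\,\eta^*\mu=\nu$ (as densities, i.e. up to orientation). Let $\lambda\colon(0,\infty)\to(0,\infty)$ be smooth and put $$\varphi(\rho)=\tfrac12\big(\lambda(\rho)-\rho\lambda'(\rho)\big),\qquad p(\rho)=\frac{\rho^2\varphi(\rho)}{\lambda(\rho)^2},\qquad h'(\rho)=\frac{p'(\rho)}{\rho}.$$ Equip the space of pairs $(\eta,F)$, with $\eta\colon N\to M$ a diffeomorphism and $F\in C^\infty(N,\mathbb R)$, with the Riemannian metric $$\langle\!\langle (u\circ\eta,f\circ\eta),(w\circ\eta,k\circ\eta)\rangle\!\rangle_{(\eta,F)}=\int_M\big[\lambda(\rho)fk+\rho\langle u,w\rangle\big]\,d\mu=\int_N\Big[\tfrac{\lambda(\rho)}{\rho}fk+\langle u,w\rangle\Big]\circ\eta\;d\nu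 ,$$ where $\rho$ is the density of $\eta$. Geodesics are the critical points, on every compact time interval, of the energy of this metric among smooth variations with fixed end points. Let $\zeta(s,t)=(\overline\eta(s,t),\overline F(s,t))$, $|s|<S$, $|t|<T$, be a smooth family such that every $\overline\eta(s,t)$ is a diffeomorphism $N\to M$ and every curve $t\mapsto\zeta(s,t)$ is a geodesic. Let $\overline u(s,t)$ be the vector field on $M$ with $\partial_t\overline\eta=\overline u\circ\overline\eta$, let $\overline\rho(s,t)$ be the density of $\overline\eta(s,t)$, and suppose that the initial velocities lie in the barotropic distribution: $\partial_t\overline F=\frac{\overline\rho}{\lambda(\overline\rho)}\circ\overline\eta$ at $t=0$ for every $s$. Write $\eta,F,u,\rho$ for $\overline\eta,\overline F,\overline u,\overline\rho$ at $s=0$. Then $u$ and $\rho>0$ are smooth and solve the barotropic equations $u_t+\nabla_uu=-\frac1\rho\operatorname{grad}p(\rho)$ and $\rho_t+\operatorname{div}(\rho u)=0$. The Jacobi field $J(t)=\partial_s\zeta(0,t)$ has the form $J=(j\circ\eta,G)$ with a smooth time-dependent vector field $j$ on $M$ and a smooth function $G$ on $(-T,T)\times N$, and $\partial_tG=g\circ\eta$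 for a smooth time-dependent function $g$ on $M$. The derivatives $\sigma=\partial_s\overline\rho|_{s=0}$ and $v=\partial_s\overline u|_{s=0}$ exist and are smooth, and for all $|t|<T$, everywhere on $M$, the following hold: the linearized Lagrangian equations $$\sigma=-\operatorname{div}(\rho j),\qquad \frac{\partial j}{\partial t}+[u,j]=v,\qquad g=\frac{2\varphi(\rho)\,\sigma}{\lambda(\rho)^2}+j\Big(\frac{\rho}{\lambda(\rho)}\Big),$$ where $[u,j]=\nabla_uj-\nabla_ju$ and $j(f)=\langle\operatorname{grad}f,j\rangle$ denotes the derivative of the function $f$ along $j$; the linearized continuity equation $$\frac{\partial\sigma}{\partial t}+\operatorname{div}(\sigma u)+\operatorname{div}(\rho v)=0;$$ and the linearized Euler equation $$\frac{\partial v}{\partial t}+\nabla_uv+\nabla_vu+\operatorname{grad}\big(h'(\rho)\sigma\big)=0 .$$ -/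

import Mathlib

open Set MeasureTheory Manifold
open scoped ContDiff Manifold

noncomputable section

namespace BarotropicFlow

/-- The model space `ℝⁿ`. -/
abbrev Model (n : ℕ) : Type := EuclideanSpace ℝ (Fin n)

/-- The `i`-th standard basis vector of `ℝⁿ`. -/
def stdVec {n : ℕ} (i : Fin n) : Model n := EuclideanSpace.single i (1 : ℝ)

/-- The tangent space at `x`. Mathlib identifies it with `ℝⁿ` through the preferred chart
at `x`, so that `stdVec i` is the `i`-th coordinate vector of that chart at `x`. -/
abbrev Tan (n : ℕ) {M : Type*} [TopologicalSpace M] [ChartedSpace (Model n) M] (x : M) : Type :=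
  TangentSpace 𝓘(ℝ, Model n) x

/-- Smooth Riemannian metrics on `M`. -/
abbrev Metric (n : ℕ) (M : Type*) [TopologicalSpace M] [ChartedSpace (Model n) M]
    [IsManifold 𝓘(ℝ, Model n) ∞ M] :=
  Bundle.ContMDiffRiemannianMetric 𝓘(ℝ, Model n) ∞ (Model n) (fun x : M => Tan n x)

/-- The coordinate vector field of the chart at `x` with constant components `a`, at the point
with coordinates `y`. -/
def coordVec {n : ℕ} {M : Type*} [TopologicalSpace M] [ChartedSpace (Model n) M]
    (x : M) (y a : Model n) : Tan n ((extChartAt 𝓘(ℝ, Model n) x).symm y) :=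
  mfderiv 𝓘(ℝ, Model n) 𝓘(ℝ, Model n) (extChartAt 𝓘(ℝ, Model n) x).symm y a

/-- The components, in the chart at `x`, of the vector field `Y`, as a function of the
coordinates. -/
def coordRep {n : ℕ} {M : Type*} [TopologicalSpace M] [ChartedSpace (Model n) M]
    (x : M) (Y : ∀ z : M, Tan n z) (y : Model n) : Model n :=
  mfderiv 𝓘(ℝ, Model n) 𝓘(ℝ, Model n) (extChartAt 𝓘(ℝ, Model n) x)
    ((extChartAt 𝓘(ℝ, Model n) x).symm y) (Y ((extChartAt 𝓘(ℝ, Model n) x).symm y))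

section Riemannian

variable {n : ℕ} {M : Type*} [TopologicalSpace M] [ChartedSpace (Model n) M]
  [IsManifold 𝓘(ℝ, Model n) ∞ M]

/-- The Gram matrix of vectors `w₁, …, wₙ` at `x`. -/
def gram (g : Metric n M) (x : M) (w : Fin n → Tan n x) : Matrix (Fin n) (Fin n) ℝ :=
  Matrix.of fun i k => g.inner x (w i) (w k)

/-- The Riemannian volume `|μ|(w₁, …, wₙ)` of the parallelepiped spanned by `w₁, …, wₙ`. -/
def riemVol (g : Metric n M) (x : M) (w : Fin n → Tan n x) : ℝ :=
  √(gram g x w).det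

/-- The vector at `x` that the metric associates with the covector whose value on the `l`-th
coordinate vector is `α l`: its `k`-th component is `∑ₗ gᵏˡ αₗ`. -/
def raise (g : Metric n M) (x : M) (α : Fin n → ℝ) : Model n :=
  ∑ k, (∑ l, (gram g x (fun i => (stdVec i : Model n)))⁻¹ k l * α l) • (stdVec k : Model n)

/-- The Riemannian gradient. -/
def grad (g : Metric n M) (f : M → ℝ) (x : M) : Tan n x :=
  raise g x fun l => mfderiv 𝓘(ℝ, Model n) 𝓘(ℝ, ℝ) f x (stdVec l : Model n)

/-- The component `g(a, b)` of the metric in the chart at `x`, as a function of the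
coordinates. -/
def metricCoord (g : Metric n M) (x : M) (a b y : Model n) : ℝ :=
  g.inner ((extChartAt 𝓘(ℝ, Model n) x).symm y) (coordVec x y a) (coordVec x y b)

/-- The Christoffel symbols of the Levi-Civita connection in the chart at `x`, at the point `x`:
`Γᵏ(a, b) = ½ gᵏˡ (∂ₐ g(b, eₗ) + ∂_b g(a, eₗ) - ∂ₗ g(a, b))`. -/
def christoffel (g : Metric n M) (x : M) (a b : Model n) : Model n :=
  raise g x fun l => (1 / 2) *
    (fderiv ℝ (metricCoord g x b (stdVec l)) (extChartAt 𝓘(ℝ, Model n) x x) a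
      + fderiv ℝ (metricCoord g x a (stdVec l)) (extChartAt 𝓘(ℝ, Model n) x x) b
      - fderiv ℝ (metricCoord g x a b) (extChartAt 𝓘(ℝ, Model n) x x) (stdVec l))

/-- The Levi-Civita covariant derivative `∇ₐ Y` at `x`, where `a` is a tangent vector at `x`. -/
def nabla (g : Metric n M) (Y : ∀ z : M, Tan n z) (x : M) (a : Tan n x) : Tan n x :=
  fderiv ℝ (coordRep x Y) (extChartAt 𝓘(ℝ, Model n) x x) a + christoffel g x a (Y x)

/-- The divergence: the trace of `a ↦ ∇ₐ Y`. -/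
def div (g : Metric n M) (Y : ∀ z : M, Tan n z) (x : M) : ℝ :=
  ∑ i : Fin n, (EuclideanSpace.proj i : Model n →L[ℝ] ℝ) (nabla g Y x (stdVec i : Model n))

end Riemannian

/-- A smooth volume form on `N`. -/
structure VolumeForm (n : ℕ) (N : Type*) [TopologicalSpace N] [ChartedSpace (Model n) N] where
  toFun : ∀ p : N, Tan n p [⋀^Fin n]→ₗ[ℝ] ℝ
  ne_zero : ∀ p, toFun p ≠ 0
  smooth : ∀ x : N, ContDiffOn ℝ ∞
    (fun y => toFun ((extChartAt 𝓘(ℝ, Model n) x).symm y) fun i => coordVec x y (stdVec i))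
    (extChartAt 𝓘(ℝ, Model n) x).target

/-- The measure `|ν|` that the volume form induces on the domain of the chart at `x`. -/
def VolumeForm.chartMeasure {n : ℕ} {N : Type*} [TopologicalSpace N] [ChartedSpace (Model n) N]
    [MeasurableSpace N] (ν : VolumeForm n N) (x : N) : Measure N :=
  Measure.map (extChartAt 𝓘(ℝ, Model n) x).symm
    ((volume.restrict (extChartAt 𝓘(ℝ, Model n) x).target).withDensity fun y =>
      ENNReal.ofReal |ν.toFun ((extChartAt 𝓘(ℝ, Model n) x).symm y)
        fun i => coordVec x y (stdVec i)|)

/-- The measure `|ν|` on `N`. The chart measures agree on the overlaps of the charts, and `|ν|` is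
the measure that restricts to them, that is, the least measure above all of them. -/
def VolumeForm.measure {n : ℕ} {N : Type*} [TopologicalSpace N] [ChartedSpace (Model n) N]
    [MeasurableSpace N] (ν : VolumeForm n N) : Measure N :=
  ⨆ x : N, ν.chartMeasure x

/-- The velocity at time `t` of a curve in a manifold. -/
def velocity {n : ℕ} {M : Type*} [TopologicalSpace M] [ChartedSpace (Model n) M]
    (c : ℝ → M) (t : ℝ) : Tan n (c t) :=
  mfderiv 𝓘(ℝ, ℝ) 𝓘(ℝ, Model n) c t (1 : ℝ)

/-- `φ(ρ) = (λ(ρ) - ρ λ'(ρ)) / 2`. -/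
def phi (lam : ℝ → ℝ) (r : ℝ) : ℝ := (1 / 2) * (lam r - r * deriv lam r)

/-- The pressure `p(ρ) = ρ² φ(ρ) / λ(ρ)²`. -/
def pressure (lam : ℝ → ℝ) (r : ℝ) : ℝ := r ^ 2 * phi lam r / lam r ^ 2

section Configurations

variable {n : ℕ} {N M : Type*} [TopologicalSpace N] [ChartedSpace (Model n) N]
  [TopologicalSpace M] [ChartedSpace (Model n) M] [IsManifold 𝓘(ℝ, Model n) ∞ M]

/-- `ρ` is the density of the configuration `η : N → M`, that is, `(ρ ∘ η) η^*μ = ν`,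
where `μ` is the Riemannian volume of `M`. -/
def IsDensity (ν : VolumeForm n N) (g : Metric n M) (η : N → M) (ρ : M → ℝ) : Prop :=
  ∀ (p : N) (w : Fin n → Tan n p),
    ρ (η p) * riemVol g (η p)
      (fun i => mfderiv 𝓘(ℝ, Model n) 𝓘(ℝ, Model n) η p (w i)) = |ν.toFun p w|

/-- The density of the configuration `η` at the particle `p`, that is, `ρ ∘ η = 1 / Jac η`. -/
def particleDensity (ν : VolumeForm n N) (g : Metric n M) (η : N → M) (p : N) : ℝ :=
  |ν.toFun p fun i => (stdVec i : Model n)| /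
    riemVol g (η p) fun i =>
      mfderiv 𝓘(ℝ, Model n) 𝓘(ℝ, Model n) η p (stdVec i : Model n)

variable [MeasurableSpace N]

/-- The Riemannian metric of the configuration space at a point `(η, F)`, for tangent vectors
`(U, a) = (u ∘ η, f ∘ η)` and `(V, b) = (v ∘ η, k ∘ η)`. As `|ν| = (ρ ∘ η) |η^*μ|`, this is
`∫_M (λ(ρ) f k + ρ ⟨u, v⟩) dμ` if `η` is a diffeomorphism. -/
def configMetric (ν : VolumeForm n N) (g : Metric n M) (lam : ℝ → ℝ) (η : N → M)
    (U : ∀ p, Tan n (η p)) (a : N → ℝ) (V : ∀ p, Tan n (η p)) (b : N → ℝ) : ℝ :=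
  ∫ p, (lam (particleDensity ν g η p) / particleDensity ν g η p * (a p * b p)
    + g.inner (η p) (U p) (V p)) ∂ν.measure

/-- The energy of the curve `t ↦ (η t, F t)` between the times `a` and `b`. -/
def energy (ν : VolumeForm n N) (g : Metric n M) (lam : ℝ → ℝ) (a b : ℝ)
    (η : ℝ → N → M) (F : ℝ → N → ℝ) : ℝ :=
  (1 / 2) * ∫ t in a..b, configMetric ν g lam (η t)
    (fun p => velocity (fun τ => η τ p) t) (fun p => deriv (fun τ => F τ p) t)
    (fun p => velocity (fun τ => η τ p) t) (fun p => deriv (fun τ => F τ p) t)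

/-- The curve `t ↦ (η t, F t)`, for `-T < t < T`, is a geodesic of the configuration space: on
every compact time interval it is a critical point of the energy among the smooth variations
`(H r, K r)` with fixed end points. -/
def IsGeodesic (ν : VolumeForm n N) (g : Metric n M) (lam : ℝ → ℝ) (T : ℝ)
    (η : ℝ → N → M) (F : ℝ → N → ℝ) : Prop :=
  ∀ a b : ℝ, -T < a → a < b → b < T →
  ∀ ε : ℝ, 0 < ε →
  ∀ (H : ℝ → ℝ → N → M) (K : ℝ → ℝ → N → ℝ),
    ContMDiffOn (𝓘(ℝ, ℝ).prod (𝓘(ℝ, ℝ).prod 𝓘(ℝ, Model n))) 𝓘(ℝ, Model n) ∞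
      (fun z : ℝ × ℝ × N => H z.1 z.2.1 z.2.2) (Ioo (-ε) ε ×ˢ Ioo (-T) T ×ˢ univ) →
    ContMDiffOn (𝓘(ℝ, ℝ).prod (𝓘(ℝ, ℝ).prod 𝓘(ℝ, Model n))) 𝓘(ℝ, ℝ) ∞
      (fun z : ℝ × ℝ × N => K z.1 z.2.1 z.2.2) (Ioo (-ε) ε ×ˢ Ioo (-T) T ×ˢ univ) →
    (∀ t ∈ Ioo (-T) T, H 0 t = η t ∧ K 0 t = F t) →
    (∀ r ∈ Ioo (-ε) ε, H r a = η a ∧ K r a = F a ∧ H r b = η b ∧ K r b = F b) →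
    HasDerivAt (fun r => energy ν g lam a b (H r) (K r)) 0 0

end Configurations

section Eulerian

variable {n : ℕ} {M : Type*} [TopologicalSpace M] [ChartedSpace (Model n) M]

/-- `f` is a smooth time-dependent function on `M`, for `-T < t < T`. -/
def SmoothFun (n : ℕ) {M : Type*} [TopologicalSpace M] [ChartedSpace (Model n) M]
    (T : ℝ) (f : ℝ → M → ℝ) : Prop :=
  ContMDiffOn (𝓘(ℝ, ℝ).prod 𝓘(ℝ, Model n)) 𝓘(ℝ, ℝ) ∞
    (fun z : ℝ × M => f z.1 z.2) (Ioo (-T) T ×ˢ univ)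

/-- `X` is a smooth time-dependent vector field on `M`, for `-T < t < T`. -/
def SmoothField [IsManifold 𝓘(ℝ, Model n) ∞ M] (T : ℝ) (X : ℝ → ∀ x : M, Tan n x) : Prop :=
  ContMDiffOn (𝓘(ℝ, ℝ).prod 𝓘(ℝ, Model n)) 𝓘(ℝ, Model n).tangent ∞
    (fun z : ℝ × M => (⟨z.2, X z.1 z.2⟩ : TangentBundle 𝓘(ℝ, Model n) M))
    (Ioo (-T) T ×ˢ univ)

/-- The derivative `X(f)` of the function `f` at `x` along the tangent vector `X`. -/
def dirDeriv (f : M → ℝ) (x : M) (X : Tan n x) : ℝ :=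
  mfderiv 𝓘(ℝ, Model n) 𝓘(ℝ, ℝ) f x X

end Eulerian

end BarotropicFlow

end

open BarotropicFlow

/-!
The theorem has three ingredients: the smoothness of the Eulerian quantities, the equations of motion
of a single geodesic, and their differentiation with respect to the parameter `s` of the family.

*Smoothness.* The data are smooth in Lagrangian variables, as functions of `(s, t)` and the particle,
whereas velocity and density are functions of the position. The map `((s, t), p) ↦ ((s, t), η s t p)`
is a local diffeomorphism, because the density equation prevents the Jacobian from vanishing, so that
a function on `M` is smooth in `(s, t, x)` as soon as its composition with the family is
(`contDiffAt_of_comp_family`, `contDiffOn_euler`). From then on everything takes place in charts of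
`M`, and all mixed partial derivatives commute. Pointwise equations at `x` are read off at the centre
of the preferred chart at `x`, where tangent vectors coincide with their components.

*Conservation of mass.* The density in a chart, multiplied by the Jacobian of the family, depends only
on the particle. By Jacobi's formula, the density therefore satisfies a continuity equation in each
parameter direction, with the velocity field of the family in that direction
(`continuity_of_transport`, `FlowFamily.continuity_div`). For `t` this is the continuity equation of
the fluid, and for `s` it is the formula `σ = -div (ρ j)`.

*The geodesic equation.* It suffices to test criticality with perturbations supported in one chart
of `M`: the positions are moved by the shear `y ↦ y + r θ(t, y) a`, and `r b θ(t, y)` is added to the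
function component, where `θ` is a cutoff, `a` a constant vector, and `b` a constant. The change of
variables `y = η t p` turns the change of energy into an integral over the chart
(`integral_comp_eq`, `FlowCurve.energy_perturbed`). Differentiation under the integral gives a weak
balance law (`FlowCurve.integral_eq_zero`), and conservation of mass and the fundamental lemma of the
calculus of variations give its strong form (`strong_of_weak`, `FlowCurve.geodesic_equation`).

With `a = 0` it says that `λ(ρ) k / ρ`, where `k ∘ η = ∂ₜ F`, is constant along particle paths. The
value `1` of this charge characterizes the barotropic distribution, so that the velocity of a geodesic
stays in it (`FlowCurve.barotropic`). With `b = 0` and `k = ρ / λ(ρ)`, the dependence of `λ(ρ) / ρ` on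
the density yields exactly the pressure (`pressure_eq`), and the result is the Euler equation
(`FlowCurve.euler_coord`).

*Linearization.* These equations hold for every `s`, and their derivatives at `s = 0` are the
linearized equations (`FlowFamily.linearized_continuity`, `FlowFamily.linearized_euler`); for the latter
the pressure force is first written as the gradient of the enthalpy `h(ρ)`, which makes the equation
free of quotients. The symmetry of the second derivatives of `η` in `s` and `t` gives
`∂ₜ j + [u, j] = v` (`velocity_compat`, `FlowFamily.hasDerivAt_variation`), and that of `F`, together
with `∂ₜ F = (ρ / λ(ρ)) ∘ η`, gives the formula for `g`
(`FlowFamily.hasDerivAt_funVariation_time`).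
-/

open Filter Topology

set_option linter.unusedSectionVars false

namespace BarotropicFlow

/-! ### Determinants and traces -/

/-- Jacobi's formula for the derivative of a determinant. -/
lemma hasDerivAt_matrix_det {n : ℕ} {A : ℝ → Matrix (Fin n) (Fin n) ℝ}
    {A' : Matrix (Fin n) (Fin n) ℝ} {t : ℝ}
    (h : ∀ i j, HasDerivAt (fun τ => A τ i j) (A' i j) t) :
    HasDerivAt (fun τ => (A τ).det) (((A t).adjugate * A').trace) t := by
  have h1 : HasDerivAt (fun τ => (A τ).det)
      (∑ σ : Equiv.Perm (Fin n), ((Equiv.Perm.sign σ : ℤ) : ℝ) *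
        ∑ i, (∏ j ∈ Finset.univ.erase i, A t (σ j) j) • A' (σ i) i) t := by
    simp only [Matrix.det_apply']
    refine HasDerivAt.fun_sum fun σ _ => ?_
    refine HasDerivAt.const_mul _ ?_
    exact HasDerivAt.fun_finsetProd fun i _ => h (σ i) i
  convert h1 using 1
  have h2 : ((A t).adjugate * A').trace = ∑ i, ((A t).updateCol i fun k => A' k i).det := by
    simp only [Matrix.trace, Matrix.diag, Matrix.mul_apply]
    refine Finset.sum_congr rfl fun i _ => ?_
    rw [← Matrix.cramer_apply, Matrix.cramer_eq_adjugate_mulVec]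
    rfl
  rw [h2]
  simp only [Matrix.det_apply', Finset.mul_sum]
  rw [Finset.sum_comm]
  refine Finset.sum_congr rfl fun σ _ => Finset.sum_congr rfl fun i _ => ?_
  rw [← Finset.mul_prod_erase _ _ (Finset.mem_univ i)]
  simp only [Matrix.updateCol_self, smul_eq_mul]
  rw [mul_comm (A' _ _)]
  congr 2
  refine Finset.prod_congr rfl fun j hj => ?_
  rw [Matrix.updateCol_ne (Finset.ne_of_mem_erase hj)]

/-- The trace of an endomorphism of `ℝⁿ`, as a continuous linear map. -/
noncomputable def tr (n : ℕ) : (Model n →L[ℝ] Model n) →L[ℝ] ℝ :=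
  ∑ i, (EuclideanSpace.proj i : Model n →L[ℝ] ℝ).comp
    (ContinuousLinearMap.apply ℝ (Model n) (stdVec i : Model n))

lemma tr_apply {n : ℕ} (L : Model n →L[ℝ] Model n) :
    tr n L = ∑ i, (L (stdVec i)) i := by
  simp [tr]

lemma sum_smul_stdVec {n : ℕ} (v : Model n) : ∑ i, v i • (stdVec i : Model n) = v := by
  ext k
  simp [stdVec, Pi.single_apply]

/-- The matrix of an endomorphism of `ℝⁿ` in the standard basis. -/
noncomputable def stdMatrix {n : ℕ} (L : Model n →L[ℝ] Model n) : Matrix (Fin n) (Fin n) ℝ :=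
  Matrix.of fun i k => (L (stdVec k)) i

lemma stdMatrix_eq_toMatrix {n : ℕ} (L : Model n →L[ℝ] Model n) :
    stdMatrix L = LinearMap.toMatrix (EuclideanSpace.basisFun (Fin n) ℝ).toBasis
      (EuclideanSpace.basisFun (Fin n) ℝ).toBasis (L : Model n →ₗ[ℝ] Model n) := by
  ext i k
  simp [stdMatrix, LinearMap.toMatrix_apply, stdVec]

lemma det_eq_det_stdMatrix {n : ℕ} (L : Model n →L[ℝ] Model n) :
    L.det = (stdMatrix L).det := by
  rw [stdMatrix_eq_toMatrix, LinearMap.det_toMatrix, ContinuousLinearMap.det]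

lemma stdMatrix_comp {n : ℕ} (L L' : Model n →L[ℝ] Model n) :
    stdMatrix (L.comp L') = stdMatrix L * stdMatrix L' := by
  simp only [stdMatrix_eq_toMatrix]
  rw [← LinearMap.toMatrix_comp]
  rfl

lemma tr_eq_trace_stdMatrix {n : ℕ} (L : Model n →L[ℝ] Model n) :
    tr n L = (stdMatrix L).trace := by
  rw [tr_apply]; rfl

/-- Jacobi's formula for a curve of endomorphisms with `A' = B A`. -/
lemma hasDerivAt_det_of_comp {n : ℕ} {A : ℝ → Model n →L[ℝ] Model n}
    {B : Model n →L[ℝ] Model n} {t : ℝ} (h : HasDerivAt A (B.comp (A t)) t) :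
    HasDerivAt (fun τ => (A τ).det) (tr n B * (A t).det) t := by
  have h1 : ∀ i j, HasDerivAt (fun τ => stdMatrix (A τ) i j)
      ((stdMatrix B * stdMatrix (A t)) i j) t := by
    intro i j
    rw [← stdMatrix_comp]
    have := ((EuclideanSpace.proj i : Model n →L[ℝ] ℝ).comp
      (ContinuousLinearMap.apply ℝ (Model n) (stdVec j : Model n))).hasFDerivAt.comp_hasDerivAt t h
    exact this
  have h2 := hasDerivAt_matrix_det h1
  simp only [det_eq_det_stdMatrix]
  convert h2 using 1
  rw [tr_eq_trace_stdMatrix, Matrix.trace_mul_comm, Matrix.mul_assoc, Matrix.mul_adjugate,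
    Matrix.mul_smul, Matrix.trace_smul, Matrix.mul_one, smul_eq_mul, mul_comm]

lemma contDiff_det {n : ℕ} : ContDiff ℝ ∞ fun L : Model n →L[ℝ] Model n => L.det := by
  simp only [det_eq_det_stdMatrix, Matrix.det_apply']
  refine ContDiff.sum fun σ _ => contDiff_const.mul (contDiff_prod fun i _ => ?_)
  exact ((EuclideanSpace.proj (σ i) : Model n →L[ℝ] ℝ).comp
      (ContinuousLinearMap.apply ℝ (Model n) (stdVec i : Model n))).contDiff

/-! ### Smoothness in Eulerian variables -/

section Descent

variable {P E F : Type*} [NormedAddCommGroup P] [NormedSpace ℝ P] [CompleteSpace P]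
  [NormedAddCommGroup E] [NormedSpace ℝ E] [CompleteSpace E]
  [NormedAddCommGroup F] [NormedSpace ℝ F]

/-- A function that is smooth in Lagrangian variables is smooth in Eulerian variables: this is the
inverse function theorem with parameters. -/
lemma contDiffAt_of_comp_family {c : P × E → E} {z₀ : P × E} (hc : ContDiffAt ℝ ∞ c z₀)
    (A : E ≃L[ℝ] E) (hA : (fderiv ℝ c z₀).comp (.inr ℝ P E) = A) {f C : P × E → F}
    (hC : ContDiffAt ℝ ∞ C z₀) (hf : ∀ᶠ z in 𝓝 z₀, f (z.1, c z) = C z) :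
    ContDiffAt ℝ ∞ f (z₀.1, c z₀) := by
  have hn : (∞ : ℕ∞ω) ≠ 0 := by simp
  -- the inverse function theorem is applied to `Φ`, whose derivative is block triangular
  set Φ : P × E → P × E := fun z => (z.1, c z) with hΦ
  have hΦd : ContDiffAt ℝ ∞ Φ z₀ := contDiffAt_fst.prodMk hc
  have hcd := (hc.differentiableAt hn).hasFDerivAt
  have hΦ' : HasFDerivAt Φ ((ContinuousLinearMap.fst ℝ P E).prod (fderiv ℝ c z₀)) z₀ :=
    hasFDerivAt_fst.prodMk hcd
  have hsplit : ∀ p v, fderiv ℝ c z₀ (p, v) = fderiv ℝ c z₀ (p, 0) + A v := by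
    intro p v
    have : A v = fderiv ℝ c z₀ (0, v) := by
      have := congrArg (fun L : E →L[ℝ] E => L v) hA
      simpa using this.symm
    rw [this, ← map_add]; simp
  let inv : P × E →L[ℝ] P × E := (ContinuousLinearMap.fst ℝ P E).prod
    ((A.symm : E →L[ℝ] E).comp ((ContinuousLinearMap.snd ℝ P E) -
      (fderiv ℝ c z₀).comp ((ContinuousLinearMap.inl ℝ P E).comp (ContinuousLinearMap.fst ℝ P E))))
  let eq : (P × E) ≃L[ℝ] (P × E) := ContinuousLinearEquiv.equivOfInverse
    ((ContinuousLinearMap.fst ℝ P E).prod (fderiv ℝ c z₀)) inv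
    (by
      rintro ⟨p, v⟩
      simp [inv]
      rw [hsplit p v, ← map_sub A.symm]
      simp)
    (by
      rintro ⟨p, v⟩
      simp only [inv, ContinuousLinearMap.prod_apply, ContinuousLinearMap.coe_fst',
        ContinuousLinearMap.comp_apply, sub_apply,
        ContinuousLinearMap.coe_snd', ContinuousLinearMap.inl_apply, Prod.mk.injEq, true_and]
      rw [hsplit]
      simp)
  have hΦ'' : HasFDerivAt Φ (eq : (P × E) →L[ℝ] (P × E)) z₀ := hΦ'
  set κ := hΦd.localInverse hΦ'' hn with hκ
  have hκs : ContDiffAt ℝ ∞ κ (Φ z₀) := hΦd.to_localInverse hΦ'' hn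
  have hκ0 : κ (Φ z₀) = z₀ := hΦd.localInverse_apply_image hΦ'' hn
  have hst : HasStrictFDerivAt Φ (eq : (P × E) →L[ℝ] (P × E)) z₀ :=
    hΦd.hasStrictFDerivAt' hΦ'' hn
  have hright : ∀ᶠ w in 𝓝 (Φ z₀), Φ (κ w) = w := hst.eventually_right_inverse
  have hev : ∀ᶠ w in 𝓝 (Φ z₀), f (Φ (κ w)) = C (κ w) :=
    (by simpa [ContinuousAt, hκ0] using hκs.continuousAt : Tendsto κ (𝓝 (Φ z₀))
        (𝓝 z₀)).eventually hf
  have hcomp : ContDiffAt ℝ ∞ (C ∘ κ) (Φ z₀) :=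
    ContDiffAt.comp _ (by rw [hκ0]; exact hC) hκs
  refine hcomp.congr_of_eventuallyEq ?_
  filter_upwards [hright, hev] with w h1 h2
  rw [h1] at h2
  exact h2

end Descent

/-! ### Transport by a family of maps -/

section Transport

variable {P E F : Type*} [NormedAddCommGroup P] [NormedSpace ℝ P]
  [NormedAddCommGroup E] [NormedSpace ℝ E] [NormedAddCommGroup F] [NormedSpace ℝ F]

lemma two_le_infty : minSmoothness ℝ 2 ≤ (∞ : ℕ∞ω) := by
  rw [minSmoothness_of_isRCLikeNormedField]; norm_cast

lemma contDiffAt_fderiv_apply {G : Type*} [NormedAddCommGroup G] [NormedSpace ℝ G]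
    {f : G → F} {z : G} (hf : ContDiffAt ℝ ∞ f z) (v : G) :
    ContDiffAt ℝ ∞ (fun w => fderiv ℝ f w v) z :=
  (hf.fderiv_right (by simp)).clm_apply contDiffAt_const

lemma fderiv_fderiv_apply_comm {G : Type*} [NormedAddCommGroup G] [NormedSpace ℝ G]
    {f : G → F} {z : G} (hf : ContDiffAt ℝ ∞ f z) (v w : G) :
    fderiv ℝ (fun x => fderiv ℝ f x v) z w = fderiv ℝ (fun x => fderiv ℝ f x w) z v := by
  have hd : DifferentiableAt ℝ (fderiv ℝ f) z :=
    (hf.fderiv_right (m := 1) (by norm_cast)).differentiableAt (by simp)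
  have hs : IsSymmSndFDerivAt ℝ f z := hf.isSymmSndFDerivAt two_le_infty
  rw [fderiv_clm_apply hd (by fun_prop), fderiv_clm_apply hd (by fun_prop)]
  simp
  exact hs.eq w v

/-- The derivative of `z ↦ f (z.1, c z)`. -/
lemma fderiv_comp_family {c : P × E → E} {f : P × E → F} {z₀ : P × E}
    (hc : DifferentiableAt ℝ c z₀) (hf : DifferentiableAt ℝ f (z₀.1, c z₀)) (q : P × E) :
    fderiv ℝ (fun z => f (z.1, c z)) z₀ q = fderiv ℝ f (z₀.1, c z₀) (q.1, fderiv ℝ c z₀ q) := by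
  have := (hf.hasFDerivAt.comp z₀ (hasFDerivAt_fst.prodMk hc.hasFDerivAt)).fderiv
  have h2 : fderiv ℝ (fun z => f (z.1, c z)) z₀ = _ := this
  rw [h2]; simp

/-- The velocity fields `U`, `J` of a family of maps in two parameter directions `e`, `e'` satisfy
`∂_{e'} U + DU J = ∂_e J + DJ U`, because the second derivatives of the family are symmetric. -/
lemma velocity_compat {c : P × E → E} {U J : P × E → E} {z₀ : P × E} {e e' : P}
    (hc : ContDiffAt ℝ ∞ c z₀) (hU : ContDiffAt ℝ ∞ U (z₀.1, c z₀))
    (hJ : ContDiffAt ℝ ∞ J (z₀.1, c z₀))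
    (hUc : ∀ᶠ z in 𝓝 z₀, U (z.1, c z) = fderiv ℝ c z (e, 0))
    (hJc : ∀ᶠ z in 𝓝 z₀, J (z.1, c z) = fderiv ℝ c z (e', 0)) :
    fderiv ℝ U (z₀.1, c z₀) (e', J (z₀.1, c z₀)) = fderiv ℝ J (z₀.1, c z₀) (e, U (z₀.1, c z₀)) := by
  have hn : (∞ : ℕ∞ω) ≠ 0 := by simp
  have h1 := fderiv_comp_family (hc.differentiableAt hn) (hU.differentiableAt hn) (e', 0)
  have h2 := fderiv_comp_family (hc.differentiableAt hn) (hJ.differentiableAt hn) (e, 0)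
  rw [Filter.EventuallyEq.fderiv_eq hUc, ← hJc.self_of_nhds] at h1
  rw [Filter.EventuallyEq.fderiv_eq hJc, ← hUc.self_of_nhds] at h2
  rw [← h1, ← h2]
  exact fderiv_fderiv_apply_comm hc _ _

/-- The continuity equation: if `R` is the density of a family of maps `c` with velocity field `U`
in the parameter direction `e`, then `∂ₑ R + div (R U) = 0`. -/
lemma continuity_of_transport {n : ℕ} {c : P × Model n → Model n} {U : P × Model n → Model n}
    {R : P × Model n → ℝ} {m : Model n → ℝ} {z₀ : P × Model n} {e : P}
    (hc : ContDiffAt ℝ ∞ c z₀) (hU : ContDiffAt ℝ ∞ U (z₀.1, c z₀))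
    (hR : ContDiffAt ℝ ∞ R (z₀.1, c z₀))
    (hUc : ∀ᶠ z in 𝓝 z₀, U (z.1, c z) = fderiv ℝ c z (e, 0))
    (hdet : ((fderiv ℝ c z₀).comp (.inr ℝ P (Model n))).det ≠ 0)
    (hRc : ∀ᶠ z in 𝓝 z₀, R (z.1, c z) * |((fderiv ℝ c z).comp (.inr ℝ P (Model n))).det| = m z.2) :
    fderiv ℝ R (z₀.1, c z₀) (e, U (z₀.1, c z₀)) +
      R (z₀.1, c z₀) * tr n ((fderiv ℝ U (z₀.1, c z₀)).comp (.inr ℝ P (Model n))) = 0 := by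
  have hn : (∞ : ℕ∞ω) ≠ 0 := by simp
  set B := (fderiv ℝ U (z₀.1, c z₀)).comp (.inr ℝ P (Model n)) with hB
  set A : P × Model n → (Model n →L[ℝ] Model n) :=
    fun z => (fderiv ℝ c z).comp (.inr ℝ P (Model n)) with hAdef
  set γ : ℝ → P × Model n := fun τ => z₀ + τ • ((e, 0) : P × Model n) with hγ
  have hγ0 : γ 0 = z₀ := by simp [hγ]
  have hγd : HasDerivAt γ ((e, 0) : P × Model n) 0 := by
    have := ((hasDerivAt_id (0 : ℝ)).smul_const ((e, 0) : P × Model n)).const_add z₀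
    rw [one_smul] at this
    exact this
  have hγt : Tendsto γ (𝓝 0) (𝓝 z₀) := by
    have := hγd.continuousAt.tendsto
    rwa [hγ0] at this
  have hγ2 : ∀ τ, (γ τ).2 = z₀.2 := by intro τ; simp [hγ]
  have hdd : DifferentiableAt ℝ (fderiv ℝ c) z₀ :=
    (hc.fderiv_right (m := 1) (by norm_cast)).differentiableAt (by simp)
  have hAd : HasDerivAt (fun τ => A (γ τ)) (B.comp (A (γ 0))) 0 := by
    have h1 : HasDerivAt (fun τ => fderiv ℝ c (γ τ)) (fderiv ℝ (fderiv ℝ c) z₀ (e, 0)) 0 :=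
      HasFDerivAt.comp_hasDerivAt 0 (by rw [hγ0]; exact hdd.hasFDerivAt) hγd
    have h2 := h1.clm_comp (hasDerivAt_const 0 (ContinuousLinearMap.inr ℝ P (Model n)))
    convert h2 using 1
    rw [hγ0]
    ext1 v
    have hs : IsSymmSndFDerivAt ℝ c z₀ := hc.isSymmSndFDerivAt two_le_infty
    have h3 := fderiv_comp_family (hc.differentiableAt hn) (hU.differentiableAt hn) (0, v)
    rw [Filter.EventuallyEq.fderiv_eq hUc, fderiv_clm_apply hdd (by fun_prop)] at h3
    simp at h3
    simp [hB, hAdef]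
    rw [← h3]
    exact hs.eq _ _
  have hdetd := hasDerivAt_det_of_comp hAd
  have hRd : HasDerivAt (fun τ => R ((γ τ).1, c (γ τ)))
      (fderiv ℝ R (z₀.1, c z₀) (e, U (z₀.1, c z₀))) 0 := by
    have h1 : DifferentiableAt ℝ (fun z => R (z.1, c z)) z₀ :=
      (hR.differentiableAt hn).comp z₀ (differentiableAt_fst.prodMk (hc.differentiableAt hn))
    have h2 := fderiv_comp_family (hc.differentiableAt hn) (hR.differentiableAt hn) (e, 0)
    rw [← hUc.self_of_nhds] at h2
    simp only at h2
    rw [← h2]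
    exact HasFDerivAt.comp_hasDerivAt (l := fun z => R (z.1, c z)) 0
      (by rw [hγ0]; exact h1.hasFDerivAt) hγd
  -- the derivative of `R ∘ c · det` along `γ` vanishes, and equals the claimed expression times
  -- `det`
  have hprod := hRd.mul hdetd
  have hAcont : ContinuousAt (fun τ => (A (γ τ)).det) 0 := hdetd.continuousAt
  have hd0 : (A (γ 0)).det ≠ 0 := by rw [hγ0]; exact hdet
  -- near `z₀` the determinant keeps its sign, so that `R ∘ c · det` is constant along `γ`
  have hconst : ∀ᶠ τ in 𝓝 (0 : ℝ),
      R ((γ τ).1, c (γ τ)) * (A (γ τ)).det = SignType.sign (A (γ 0)).det * m z₀.2 := by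
    have hsg : ∀ᶠ τ in 𝓝 (0 : ℝ), SignType.sign (A (γ τ)).det = SignType.sign (A (γ 0)).det := by
      rcases lt_or_gt_of_ne hd0 with h | h
      · filter_upwards [hAcont.eventually_lt continuousAt_const h] with τ hτ
        rw [sign_neg h, sign_neg hτ]
      · filter_upwards [continuousAt_const.eventually_lt hAcont h] with τ hτ
        rw [sign_pos h, sign_pos hτ]
    filter_upwards [hsg, hγt.eventually hRc] with τ h1 h2
    rw [hγ2] at h2
    rw [← h2, ← h1]
    conv_lhs => rw [← sign_mul_abs (A (γ τ)).det]
    ring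
  have hzero := (hprod.congr_of_eventuallyEq (f₁ := fun _ => SignType.sign (A (γ 0)).det * m z₀.2)
    (by filter_upwards [hconst] with τ hτ; exact hτ.symm)).unique (hasDerivAt_const _ _)
  rw [hγ0] at hzero
  have : (fderiv ℝ R (z₀.1, c z₀) (e, U (z₀.1, c z₀)) + R (z₀.1, c z₀) * tr n B) * (A z₀).det =
      0 := by
    linear_combination hzero
  exact (mul_eq_zero.mp this).resolve_right hdet

end Transport

/-! ### Integrals of functions with compact support -/

section Compact

variable {Z : Type*} [NormedAddCommGroup Z] [NormedSpace ℝ Z] [MeasurableSpace Z] [BorelSpace Z]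
  [FiniteDimensional ℝ Z] {μ : Measure Z}

lemma integrable_of_continuousOn_of_eq_zero [IsFiniteMeasureOnCompacts μ] {f : Z → ℝ} {K : Set Z}
    (hK : IsCompact K) (hf : ContinuousOn f K) (h0 : ∀ z ∉ K, f z = 0) : Integrable f μ := by
  have h1 : IntegrableOn f K μ := hf.integrableOn_compact hK
  have h2 : f = K.indicator f := by
    ext z
    by_cases hz : z ∈ K
    · simp [hz]
    · simp [hz, h0 z hz]
  rw [h2]
  exact h1.integrable_indicator hK.measurableSet

/-- Differentiation under the integral sign for a smooth integrand with a fixed compact support. -/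
lemma hasDerivAt_integral_of_compact [IsFiniteMeasureOnCompacts μ] {f : ℝ → Z → ℝ}
    {W : Set (ℝ × Z)} {K : Set Z}
    (hW : IsOpen W) (hK : IsCompact K) (hKW : ∀ z ∈ K, ((0 : ℝ), z) ∈ W)
    (hf : ContDiffOn ℝ ∞ (fun q : ℝ × Z => f q.1 q.2) W) (h0 : ∀ r, ∀ z ∉ K, f r z = 0) :
    HasDerivAt (fun r => ∫ z, f r z ∂μ) (∫ z, deriv (fun r => f r z) 0 ∂μ) 0 := by
  obtain ⟨u, v, hu, -, h0u, hKv, huv⟩ :=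
    generalized_tube_lemma (isCompact_singleton (x := (0 : ℝ))) hK hW
      (by rintro ⟨r, z⟩ ⟨hr, hz⟩; obtain rfl : r = 0 := hr; exact hKW z hz)
  obtain ⟨δ, hδ, hball⟩ := Metric.isOpen_iff.mp hu 0 (h0u rfl)
  have hin : ∀ r ∈ Metric.closedBall (0 : ℝ) (δ / 2), ∀ z ∈ K, (r, z) ∈ W := by
    intro r hr z hz
    exact huv ⟨hball (Metric.closedBall_subset_ball (by linarith) hr), hKv hz⟩
  have hdiff : ∀ r ∈ Metric.closedBall (0 : ℝ) (δ / 2), ∀ z ∈ K,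
      HasDerivAt (fun r => f r z) (fderiv ℝ (fun q : ℝ × Z => f q.1 q.2) (r, z) (1, 0)) r := by
    intro r hr z hz
    have h1 := ((hf.contDiffAt (hW.mem_nhds (hin r hr z hz))).differentiableAt
      (by simp)).hasFDerivAt
    have h2 : HasDerivAt (fun r : ℝ => (r, z)) (1, 0) r :=
      (hasDerivAt_id r).prodMk (hasDerivAt_const r z)
    exact h1.comp_hasDerivAt r h2
  have hcont : ContinuousOn (fun q : ℝ × Z => fderiv ℝ (fun q : ℝ × Z => f q.1 q.2) q (1, 0))
      (Metric.closedBall (0 : ℝ) (δ / 2) ×ˢ K) := by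
    intro q hq
    exact (contDiffAt_fderiv_apply (hf.contDiffAt (hW.mem_nhds (hin q.1 hq.1 q.2 hq.2)))
      (1, 0)).continuousAt.continuousWithinAt
  obtain ⟨C, hC⟩ := (((isCompact_closedBall (0 : ℝ) (δ / 2)).prod hK).exists_bound_of_continuousOn
    hcont)
  have hcontr : ∀ r ∈ Metric.closedBall (0 : ℝ) (δ / 2), ContinuousOn (f r) K := by
    intro r hr z hz
    have := (hf.contDiffAt (hW.mem_nhds (hin r hr z hz))).continuousAt
    exact (this.comp (f := fun z : Z => (r, z)) (by fun_prop)).continuousWithinAt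
  have hnhds : Metric.closedBall (0 : ℝ) (δ / 2) ∈ 𝓝 (0 : ℝ) :=
    Metric.closedBall_mem_nhds _ (by linarith)
  have h0mem : (0 : ℝ) ∈ Metric.closedBall (0 : ℝ) (δ / 2) := mem_of_mem_nhds hnhds
  have hzero : ∀ z ∉ K, ∀ r, HasDerivAt (fun r => f r z) 0 r := by
    intro z hz r
    have : (fun r => f r z) = fun _ => 0 := by ext r; exact h0 r z hz
    rw [this]; exact hasDerivAt_const _ _
  have hderiv0 : ∀ z ∉ K, ∀ r, deriv (fun r => f r z) r = 0 := fun z hz r => (hzero z hz r).deriv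
  refine (hasDerivAt_integral_of_dominated_loc_of_deriv_le (F := f)
    (F' := fun r z => deriv (fun r => f r z) r) (s := Metric.closedBall (0 : ℝ) (δ / 2))
    (bound := K.indicator fun _ => C) hnhds ?_ ?_ ?_ ?_ ?_ ?_).2
  · filter_upwards [hnhds] with r hr
    exact (integrable_of_continuousOn_of_eq_zero hK (hcontr r hr) (h0 r)).aestronglyMeasurable
  · exact integrable_of_continuousOn_of_eq_zero hK (hcontr 0 h0mem) (h0 0)
  · refine (integrable_of_continuousOn_of_eq_zero hK ?_
      (fun z hz => hderiv0 z hz 0)).aestronglyMeasurable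
    have h3 : ContinuousOn (fun z => fderiv ℝ (fun q : ℝ × Z => f q.1 q.2) (0, z) (1, 0)) K :=
      hcont.comp (f := fun z : Z => ((0 : ℝ), z)) (by fun_prop) fun z hz => ⟨h0mem, hz⟩
    exact h3.congr fun z hz => (hdiff 0 h0mem z hz).deriv
  · refine ae_of_all _ fun z r hr => ?_
    by_cases hz : z ∈ K
    · rw [(hdiff r hr z hz).deriv]
      simpa [hz] using hC (r, z) ⟨hr, hz⟩
    · simp [hderiv0 z hz, hz]
  · exact (integrableOn_const (hs := hK.measure_lt_top.ne)).integrable_indicator hK.measurableSet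
  · refine ae_of_all _ fun z r hr => ?_
    by_cases hz : z ∈ K
    · exact (hdiff r hr z hz).differentiableAt.hasDerivAt
    · exact (hzero z hz r).differentiableAt.hasDerivAt

/-- The integral of a derivative of a function with compact support vanishes. -/
lemma integral_fderiv_eq_zero [μ.IsAddHaarMeasure] {f : Z → ℝ} (hf : ContDiff ℝ ∞ f)
    (hc : HasCompactSupport f) (v : Z) : ∫ z, fderiv ℝ f z v ∂μ = 0 := by
  have hcd : Continuous fun z => fderiv ℝ f z v :=
    (hf.continuous_fderiv (by simp)).clm_apply continuous_const
  have h1 : Integrable (fun z => fderiv ℝ f z v) μ :=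
    hcd.integrable_of_hasCompactSupport (hc.fderiv_apply ℝ v)
  have h2 : Integrable f μ := hf.continuous.integrable_of_hasCompactSupport hc
  have := integral_mul_fderiv_eq_neg_fderiv_mul_of_integrable (μ := μ) (f := f)
    (g := fun _ => (1 : ℝ)) (v := v) (by simpa using h1) (by simp) (by simpa using h2)
    (fun z _ => hf.differentiable (by simp) z) (fun z _ => by fun_prop)
  simpa using this

/-- The product of a smooth cutoff and a function that is smooth near its support. -/
lemma contDiff_cutoff_mul {U : Set Z} (hU : IsOpen U) {θ f : Z → ℝ} (hθ : ContDiff ℝ ∞ θ)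
    (hθU : tsupport θ ⊆ U) (hf : ContDiffOn ℝ ∞ f U) : ContDiff ℝ ∞ fun z => θ z * f z := by
  rw [contDiff_iff_contDiffAt]
  intro z
  by_cases hz : z ∈ U
  · exact hθ.contDiffAt.mul (hf.contDiffAt (hU.mem_nhds hz))
  · have h1 : θ =ᶠ[𝓝 z] 0 := notMem_tsupport_iff_eventuallyEq.mp fun h => hz (hθU h)
    refine contDiffAt_const (c := (0 : ℝ)) |>.congr_of_eventuallyEq ?_
    filter_upwards [h1] with w hw
    simp [hw]

end Compact

/-! ### Weak conservation laws -/

section Weak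

variable {n : ℕ}

lemma fderiv_mul_apply' {Z : Type*} [NormedAddCommGroup Z] [NormedSpace ℝ Z] {f g : Z → ℝ} {z : Z}
    (hf : DifferentiableAt ℝ f z) (hg : DifferentiableAt ℝ g z) (v : Z) :
    fderiv ℝ (fun w => f w * g w) z v = f z * fderiv ℝ g z v + fderiv ℝ f z v * g z := by
  rw [fderiv_fun_mul hf hg]
  simp [mul_comm]

/-- The coordinate form of the divergence of `w V`, for a function `w` and a vector field `V`. -/
lemma sum_fderiv_mul_coord {w : ℝ × Model n → ℝ} {V : ℝ × Model n → Model n} {z : ℝ × Model n}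
    (hw : DifferentiableAt ℝ w z) (hV : DifferentiableAt ℝ V z) :
    ∑ i, fderiv ℝ (fun q => w q * V q i) z (0, stdVec i) =
      fderiv ℝ w z (0, V z) + w z * tr n ((fderiv ℝ V z).comp (.inr ℝ ℝ (Model n))) := by
  have hVi : ∀ i, HasFDerivAt (fun q => V q i)
      ((EuclideanSpace.proj i : Model n →L[ℝ] ℝ).comp (fderiv ℝ V z)) z := fun i =>
    (EuclideanSpace.proj i : Model n →L[ℝ] ℝ).hasFDerivAt.comp z hV.hasFDerivAt
  have h1 : ∀ i, fderiv ℝ (fun q => w q * V q i) z (0, stdVec i) =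
      w z * (fderiv ℝ V z (0, stdVec i)) i + V z i * fderiv ℝ w z (0, stdVec i) := by
    intro i
    rw [fderiv_mul_apply' hw (hVi i).differentiableAt, (hVi i).fderiv]
    simp [mul_comm]
  simp only [h1, Finset.sum_add_distrib, tr_apply, Finset.mul_sum]
  rw [add_comm]
  congr 1
  have h2 : fderiv ℝ w z (0, V z) = ((fderiv ℝ w z).comp (.inr ℝ ℝ (Model n))) (V z) := by simp
  rw [h2]
  conv_rhs => rw [← sum_smul_stdVec (V z)]
  rw [map_sum]
  simp

/-- From the weak to the strong form of a balance law, by partial integration: if `R` is transported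
by the flow of `V`, then the weak form of `R (∂ₜ + V · ∇) m = k - s ∂ₐ p` implies the strong one. -/
lemma strong_of_weak {U : Set (ℝ × Model n)} (hU : IsOpen U) {p s m R k : ℝ × Model n → ℝ}
    {V : ℝ × Model n → Model n} {a : Model n}
    (hp : ContDiffOn ℝ ∞ p U) (hs : ContDiffOn ℝ ∞ s U) (hm : ContDiffOn ℝ ∞ m U)
    (hR : ContDiffOn ℝ ∞ R U) (hk : ContDiffOn ℝ ∞ k U) (hV : ContDiffOn ℝ ∞ V U)
    (hcont : ∀ z ∈ U, fderiv ℝ R z (1, V z) +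
      R z * tr n ((fderiv ℝ V z).comp (.inr ℝ ℝ (Model n))) = 0)
    (hweak : ∀ θ : ℝ × Model n → ℝ, ContDiff ℝ ∞ θ → HasCompactSupport θ → tsupport θ ⊆ U →
      ∫ z, (p z * fderiv ℝ (fun w => s w * θ w) z (0, a) + R z * m z * fderiv ℝ θ z (1, V z)
        + θ z * k z) = 0) :
    ∀ z ∈ U, R z * fderiv ℝ m z (1, V z) = k z - s z * fderiv ℝ p z (0, a) := by
  have hn : (∞ : ℕ∞ω) ≠ 0 := by simp
  set Q : ℝ × Model n → ℝ := fun z =>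
    k z - s z * fderiv ℝ p z (0, a) - R z * fderiv ℝ m z (1, V z) with hQ
  have hfd : ∀ {f : ℝ × Model n → ℝ} {W : ℝ × Model n → ℝ × Model n}, ContDiffOn ℝ ∞ f U →
      ContDiffOn ℝ ∞ W U → ContinuousOn (fun z => fderiv ℝ f z (W z)) U := by
    intro f W hf hW
    exact (hf.continuousOn_fderiv_of_isOpen hU (by simp)).clm_apply hW.continuousOn
  have hQc : ContinuousOn Q U := by
    refine (hk.continuousOn.sub (hs.continuousOn.mul (hfd hp contDiffOn_const))).sub
      (hR.continuousOn.mul (hfd hm (contDiffOn_const.prodMk hV)))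
  have hint : ∀ θ : ℝ × Model n → ℝ, ContDiff ℝ ∞ θ → HasCompactSupport θ → tsupport θ ⊆ U →
      ∫ z, θ z • Q z = 0 := by
    intro θ hθ hθc hθU
    rw [← hweak θ hθ hθc hθU]
    -- the two integrands differ by a sum of derivatives of functions of compact support
    set f₁ : ℝ × Model n → ℝ := fun z => θ z * (p z * s z) with hf₁
    set f₂ : ℝ × Model n → ℝ := fun z => θ z * (R z * m z) with hf₂
    set f₃ : Fin n → ℝ × Model n → ℝ := fun i z => θ z * (R z * m z * V z i) with hf₃
    have hVi : ∀ i, ContDiffOn ℝ ∞ (fun z => V z i) U := fun i =>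
      (EuclideanSpace.proj i : Model n →L[ℝ] ℝ).contDiff.comp_contDiffOn hV
    have c₁ : ContDiff ℝ ∞ f₁ := contDiff_cutoff_mul hU hθ hθU (hp.mul hs)
    have c₂ : ContDiff ℝ ∞ f₂ := contDiff_cutoff_mul hU hθ hθU (hR.mul hm)
    have c₃ : ∀ i, ContDiff ℝ ∞ (f₃ i) := fun i =>
      contDiff_cutoff_mul hU hθ hθU ((hR.mul hm).mul (hVi i))
    have k₁ : HasCompactSupport f₁ := hθc.mul_right
    have k₂ : HasCompactSupport f₂ := hθc.mul_right
    have k₃ : ∀ i, HasCompactSupport (f₃ i) := fun i => hθc.mul_right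
    have : (volume : Measure (ℝ × Model n)).IsAddHaarMeasure := by
      rw [Measure.volume_eq_prod]; infer_instance
    have i₁ := integral_fderiv_eq_zero (μ := volume) c₁ k₁ (0, a)
    have i₂ := integral_fderiv_eq_zero (μ := volume) c₂ k₂ (1, 0)
    have i₃ := fun i => integral_fderiv_eq_zero (μ := volume) (c₃ i) (k₃ i) (0, stdVec i)
    have hint : ∀ {f : ℝ × Model n → ℝ}, ContDiff ℝ ∞ f → HasCompactSupport f → ∀ v,
        Integrable fun z => fderiv ℝ f z v := fun {f} cf kf v =>
      ((cf.continuous_fderiv (by simp)).clm_apply continuous_const).integrable_of_hasCompactSupport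
        (kf.fderiv_apply ℝ v)
    have hkey : ∀ z, p z * fderiv ℝ (fun w => s w * θ w) z (0, a)
        + R z * m z * fderiv ℝ θ z (1, V z) + θ z * k z =
        θ z • Q z + (fderiv ℝ f₁ z (0, a) + (fderiv ℝ f₂ z (1, 0)
          + ∑ i, fderiv ℝ (f₃ i) z (0, stdVec i))) := by
      intro z
      by_cases hz : z ∈ U
      · have d : ∀ {f : ℝ × Model n → ℝ}, ContDiffOn ℝ ∞ f U → DifferentiableAt ℝ f z :=
          fun hf => (hf.contDiffAt (hU.mem_nhds hz)).differentiableAt hn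
        have dθ : DifferentiableAt ℝ θ z := hθ.differentiable hn z
        have dV : DifferentiableAt ℝ V z := (hV.contDiffAt (hU.mem_nhds hz)).differentiableAt hn
        have e₃ : ∑ i, fderiv ℝ (f₃ i) z (0, stdVec i) =
            fderiv ℝ (fun q => θ q * (R q * m q)) z (0, V z) + θ z * (R z * m z) *
              tr n ((fderiv ℝ V z).comp (.inr ℝ ℝ (Model n))) := by
          rw [← sum_fderiv_mul_coord (dθ.fun_mul ((d hR).fun_mul (d hm))) dV]
          refine Finset.sum_congr rfl fun i _ => ?_
          simp only [hf₃, mul_assoc]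
        have hsplit : ∀ {f : ℝ × Model n → ℝ}, fderiv ℝ f z (1, V z) =
            fderiv ℝ f z (1, 0) + fderiv ℝ f z (0, V z) := by
          intro f; rw [← map_add]; simp
        have hc := hcont z hz
        rw [e₃]
        simp only [hf₁, hf₂, hQ, smul_eq_mul]
        rw [fderiv_mul_apply' (d hs) dθ, fderiv_mul_apply' dθ ((d hp).fun_mul (d hs)),
          fderiv_mul_apply' (d hp) (d hs), fderiv_mul_apply' dθ ((d hR).fun_mul (d hm)),
          fderiv_mul_apply' (d hR) (d hm), fderiv_mul_apply' dθ ((d hR).fun_mul (d hm)),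
          fderiv_mul_apply' (d hR) (d hm)]
        simp only [hsplit] at hc ⊢
        linear_combination (-θ z * m z) * hc
      · have hzt : z ∉ tsupport θ := fun h => hz (hθU h)
        have h1 : θ =ᶠ[𝓝 z] 0 := notMem_tsupport_iff_eventuallyEq.mp hzt
        have hz0 : θ z = 0 := h1.self_of_nhds
        have z' : ∀ {f : ℝ × Model n → ℝ}, f =ᶠ[𝓝 z] 0 → fderiv ℝ f z = 0 := by
          intro f hf
          rw [hf.fderiv_eq]
          simp
        rw [z' h1, z' (f := fun w => s w * θ w) (by filter_upwards [h1] with w hw; simp [hw]),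
          z' (f := f₁) (by filter_upwards [h1] with w hw; simp [hf₁, hw]),
          z' (f := f₂) (by filter_upwards [h1] with w hw; simp [hf₂, hw])]
        have : ∀ i, fderiv ℝ (f₃ i) z = 0 := fun i =>
          z' (by filter_upwards [h1] with w hw; simp [hf₃, hw])
        simp [this, hz0]
    simp only [hkey]
    have hQi : Integrable fun z => θ z • Q z := by
      refine integrable_of_continuousOn_of_eq_zero hθc.isCompact ?_ ?_
      · exact hθ.continuous.continuousOn.smul (hQc.mono hθU)
      · intro z hz
        rw [image_eq_zero_of_notMem_tsupport hz, zero_smul]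
    have i₃' : Integrable fun z => ∑ i, fderiv ℝ (f₃ i) z (0, stdVec i) :=
      integrable_finsetSum _ fun i _ => hint (c₃ i) (k₃ i) _
    have i₂₃ : Integrable fun z => fderiv ℝ f₂ z (1, 0) + ∑ i, fderiv ℝ (f₃ i) z (0, stdVec i) :=
      (hint c₂ k₂ _).add i₃'
    have i₁₂₃ : Integrable fun z => fderiv ℝ f₁ z (0, a) + (fderiv ℝ f₂ z (1, 0)
        + ∑ i, fderiv ℝ (f₃ i) z (0, stdVec i)) := (hint c₁ k₁ _).add i₂₃
    rw [integral_add hQi i₁₂₃, integral_add (hint c₁ k₁ _) i₂₃, integral_add (hint c₂ k₂ _) i₃',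
      integral_finsetSum _ fun i _ => hint (c₃ i) (k₃ i) _, i₁, i₂]
    simp [i₃]
  have hae := hU.ae_eq_zero_of_integral_contDiff_smul_eq_zero (μ := volume)
    (hQc.locallyIntegrableOn hU.measurableSet) hint
  have hae' : Q =ᵐ[volume.restrict U] 0 := (ae_restrict_iff' hU.measurableSet).mpr hae
  have heq : EqOn Q 0 U :=
    Measure.eqOn_open_of_ae_eq hae' hU hQc continuousOn_const
  intro z hz
  have := heq hz
  simp only [hQ, Pi.zero_apply] at this
  linarith

end Weak

/-! ### Change of variables -/

section ChangeOfVariables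

/-- Change of variables for measures with densities. -/
lemma map_withDensity_of_openPartialHomeomorph {E : Type*} [NormedAddCommGroup E] [NormedSpace ℝ E]
    [FiniteDimensional ℝ E] [MeasurableSpace E] [BorelSpace E] {μ : Measure E}
    [μ.IsAddHaarMeasure] (e : OpenPartialHomeomorph E E)
    (he : ∀ x ∈ e.source, DifferentiableAt ℝ e x) {w w' : E → ENNReal}
    (hw : ∀ x ∈ e.source, w x = ENNReal.ofReal |(fderiv ℝ e x).det| * w' (e x)) {A : Set E}
    (hA : MeasurableSet A) (hAt : A ⊆ e.target) :
    ∫⁻ x in e.symm '' A, w x ∂μ = ∫⁻ y in A, w' y ∂μ := by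
  have hsub : e.symm '' A ⊆ e.source := by
    rintro _ ⟨y, hy, rfl⟩
    exact e.map_target (hAt hy)
  have himg : e '' (e.symm '' A) = A := by
    ext y
    constructor
    · rintro ⟨_, ⟨z, hz, rfl⟩, rfl⟩
      rwa [e.right_inv (hAt hz)]
    · intro hy
      exact ⟨e.symm y, ⟨y, hy, rfl⟩, e.right_inv (hAt hy)⟩
  have heq : e.symm '' A = e.source ∩ e ⁻¹' A := by
    ext x
    constructor
    · rintro ⟨y, hy, rfl⟩
      exact ⟨e.map_target (hAt hy), by simpa [e.right_inv (hAt hy)] using hy⟩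
    · rintro ⟨hx, hxA⟩
      exact ⟨e x, hxA, e.left_inv hx⟩
  have hmeas : MeasurableSet (e.symm '' A) := by
    have h1 : Measurable fun x : e.source => e x :=
      (continuousOn_iff_continuous_domRestrict.mp e.continuousOn).measurable
    have h2 := e.open_source.measurableSet.subtype_image (h1 hA)
    convert h2 using 1
    rw [heq]
    ext x
    simp [and_comm]
  conv_rhs => rw [← himg]
  rw [lintegral_image_eq_lintegral_abs_det_fderiv_mul μ hmeas
    (fun x hx => (he x (hsub hx)).hasFDerivAt.hasFDerivWithinAt) (e.injOn.mono hsub)]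
  exact setLIntegral_congr_fun hmeas fun x hx => hw x (hsub hx)

end ChangeOfVariables

/-! ### Charts and coordinate frames -/

section Charts

variable {n : ℕ} {M : Type*} [TopologicalSpace M] [ChartedSpace (Model n) M]

local notation "𝓔" => 𝓘(ℝ, Model n)
local notation "chart" => extChartAt 𝓘(ℝ, Model n)

lemma isOpen_chart_target (x : M) : IsOpen (chart x).target := isOpen_extChartAt_target x

lemma isOpen_chart_source (x : M) : IsOpen (chart x).source := isOpen_extChartAt_source x

lemma chart_mem_target (x : M) : chart x x ∈ (chart x).target := mem_extChartAt_target x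

variable [IsManifold 𝓘(ℝ, Model n) ∞ M]

lemma mdifferentiableAt_chart {x z : M} (hz : z ∈ (chart x).source) :
    MDifferentiableAt 𝓔 𝓔 (chart x) z :=
  mdifferentiableAt_extChartAt (by rwa [extChartAt_source] at hz)

lemma contMDiffAt_chart_symm {x : M} {y : Model n} (hy : y ∈ (chart x).target) :
    ContMDiffAt 𝓔 𝓔 ∞ (chart x).symm y :=
  (contMDiffOn_extChartAt_symm x).contMDiffAt ((isOpen_chart_target x).mem_nhds hy)

lemma contMDiffAt_chart {x z : M} (hz : z ∈ (chart x).source) :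
    ContMDiffAt 𝓔 𝓔 ∞ (chart x) z :=
  contMDiffAt_extChartAt' (by rwa [extChartAt_source] at hz)

lemma mdifferentiableAt_chart_symm {x : M} {y : Model n} (hy : y ∈ (chart x).target) :
    MDifferentiableAt 𝓔 𝓔 (chart x).symm y :=
  (contMDiffAt_chart_symm hy).mdifferentiableAt (by simp)

lemma mfderiv_chart_coordVec {x : M} {y : Model n} (hy : y ∈ (chart x).target) (a : Model n) :
    mfderiv 𝓔 𝓔 (chart x) ((chart x).symm y) (coordVec x y a) = a := by
  have h := mfderiv_extChartAt_comp_mfderivWithin_extChartAt_symm (I := 𝓔) hy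
  rw [ModelWithCorners.range_eq_univ, mfderivWithin_univ] at h
  exact congrArg (fun L : Model n →L[ℝ] Model n => L a) h

lemma coordVec_mfderiv_chart {x : M} {y : Model n} (hy : y ∈ (chart x).target)
    (v : Tan n ((chart x).symm y)) :
    coordVec x y (mfderiv 𝓔 𝓔 (chart x) ((chart x).symm y) v) = v := by
  have h := mfderivWithin_extChartAt_symm_comp_mfderiv_extChartAt (I := 𝓔) hy
  rw [ModelWithCorners.range_eq_univ, mfderivWithin_univ] at h
  exact congrArg (fun L : Model n →L[ℝ] Model n => L v) h

lemma coordVec_coordRep {x : M} {y : Model n} (hy : y ∈ (chart x).target) (Y : ∀ z : M, Tan n z) :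
    coordVec x y (coordRep x Y y) = Y ((chart x).symm y) :=
  coordVec_mfderiv_chart hy _

lemma mfderiv_chart_self (x : M) (v : Tan n x) : mfderiv 𝓔 𝓔 (chart x) x v = v := by
  rw [mfderiv_extChartAt_self]; rfl

lemma coordRep_self (x : M) (Y : ∀ z : M, Tan n z) : coordRep x Y (chart x x) = Y x := by
  unfold coordRep
  rw [extChartAt_to_inv]
  exact mfderiv_chart_self x _

lemma coordVec_self (x : M) (a : Model n) : (coordVec x (chart x x) a : Model n) = a := by
  have h := mfderiv_chart_coordVec (chart_mem_target x) a
  rw [extChartAt_to_inv] at h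
  exact (mfderiv_chart_self x _).symm.trans h

/-- The coordinate frame `a ↦ coordVec x y a` as a linear map. -/
noncomputable def coordFrame (x : M) (y : Model n) : Model n →L[ℝ] Tan n ((chart x).symm y) :=
  mfderiv 𝓔 𝓔 (chart x).symm y

lemma coordVec_injective {x : M} {y : Model n} (hy : y ∈ (chart x).target) :
    Function.Injective (coordVec x y : Model n → _) := fun a b hab => by
  rw [← mfderiv_chart_coordVec hy a, hab, mfderiv_chart_coordVec hy b]

end Charts

/-! ### The metric in coordinates -/

section MetricCoord

variable {n : ℕ} {M : Type*} [TopologicalSpace M] [ChartedSpace (Model n) M]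
  [IsManifold 𝓘(ℝ, Model n) ∞ M]

local notation "𝓔" => 𝓘(ℝ, Model n)
local notation "chart" => extChartAt 𝓘(ℝ, Model n)

/-- The trivialization of the tangent bundle at `x` is the differential of the chart at `x`. This
connects the smoothness of sections of the tangent bundle with that of their components. -/
lemma trivializationAt_snd {x z : M} (hz : z ∈ (chart x).source) (v : Tan n z) :
    (trivializationAt (Model n) (TangentSpace 𝓔) x (⟨z, v⟩ : TangentBundle 𝓔 M)).2 =
      mfderiv 𝓔 𝓔 (chart x) z v := by
  have hs : z ∈ (chartAt (Model n) x).source := by rwa [extChartAt_source] at hz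
  have h := TangentBundle.continuousLinearMapAt_trivializationAt (I := 𝓔) hs
  exact ((trivializationAt (Model n) (TangentSpace 𝓔) x).continuousLinearMapAt_apply_of_mem
    (R := ℝ) (by rwa [TangentBundle.trivializationAt_baseSet]) v).symm.trans
    (congrArg (fun L : Model n →L[ℝ] Model n => L v) h)

lemma contMDiffAt_coordVec {x : M} {y : Model n} (hy : y ∈ (chart x).target) (a : Model n) :
    ContMDiffAt 𝓔 (𝓔).tangent ∞
      (fun y => (⟨(chart x).symm y, coordVec x y a⟩ : TangentBundle 𝓔 M)) y := by
  have hs : (chart x).symm y ∈ (chartAt (Model n) x).source := by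
    have := (chart x).map_target hy
    rwa [extChartAt_source] at this
  rw [show (𝓔).tangent = (𝓔).prod 𝓘(ℝ, Model n) from rfl,
    (trivializationAt (Model n) (TangentSpace 𝓔) x).contMDiffAt_iff (by
      rw [TangentBundle.trivializationAt_source]; exact hs)]
  refine ⟨contMDiffAt_chart_symm hy, contMDiffAt_const (c := a) |>.congr_of_eventuallyEq ?_⟩
  filter_upwards [(isOpen_chart_target x).mem_nhds hy] with z hz
  rw [trivializationAt_snd ((chart x).map_target hz)]
  exact mfderiv_chart_coordVec hz a

lemma contDiffOn_metricCoord (g : Metric n M) (x : M) (a b : Model n) :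
    ContDiffOn ℝ ∞ (metricCoord g x a b) (chart x).target := by
  intro y hy
  refine ContDiffAt.contDiffWithinAt ?_
  rw [← contMDiffAt_iff_contDiffAt]
  have h1 := (g.contMDiff ((chart x).symm y)).comp y (contMDiffAt_chart_symm hy)
  have h2 := ContMDiffAt.clm_bundle_apply₂ (F₁ := Model n) (F₂ := Model n) (F₃ := ℝ)
    (E₁ := fun x : M => Tan n x) (E₂ := fun x : M => Tan n x) (E₃ := Bundle.Trivial M ℝ)
    (b := (chart x).symm)
    (ψ := fun y => g.inner ((chart x).symm y)) h1
    (contMDiffAt_coordVec hy a) (contMDiffAt_coordVec hy b)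
  rw [Bundle.contMDiffAt_totalSpace] at h2
  exact h2.2

lemma metricCoord_comm (g : Metric n M) (x : M) (a b : Model n) :
    metricCoord g x a b = metricCoord g x b a := by
  ext y
  exact g.symm _ _ _

lemma bilin_expand (B : Model n →L[ℝ] Model n →L[ℝ] ℝ) (v w : Model n) :
    B v w = ∑ a, ∑ b, v a * (w b * B (stdVec a) (stdVec b)) := by
  conv_lhs => rw [← sum_smul_stdVec v, ← sum_smul_stdVec w]
  simp only [map_sum, map_smul, sum_apply, smul_apply, smul_eq_mul,
    Finset.mul_sum]
  rw [Finset.sum_comm]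
  refine Finset.sum_congr rfl fun a _ => Finset.sum_congr rfl fun b _ => ?_
  ring

/-- The bilinear form of the metric at `z`, pulled back by a linear map `A : ℝⁿ → T_z M`. -/
noncomputable def pullbackForm (g : Metric n M) (z : M) (A : Model n →L[ℝ] Tan n z) :
    Model n →L[ℝ] Model n →L[ℝ] ℝ :=
  ((ContinuousLinearMap.compL ℝ (Model n) (Model n) ℝ).flip
    (show Model n →L[ℝ] Model n from A)).comp
      ((show Model n →L[ℝ] Model n →L[ℝ] ℝ from g.inner z).comp (show Model n →L[ℝ] Model n from A))

lemma metricCoord_eq_pullbackForm (g : Metric n M) (x : M) (a b y : Model n) :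
    metricCoord g x a b y = pullbackForm g _ (coordFrame x y) a b := rfl

lemma metricCoord_expand (g : Metric n M) (x : M) (v w y : Model n) :
    metricCoord g x v w y = ∑ a, ∑ b, v a * (w b * metricCoord g x (stdVec a) (stdVec b) y) := by
  simp only [metricCoord_eq_pullbackForm]
  exact bilin_expand _ _ _

lemma gram_comp (g : Metric n M) (z : M) (A : Model n →L[ℝ] Tan n z) (L : Model n →L[ℝ] Model n) :
    gram g z (fun i => A (L (stdVec i))) =
      (stdMatrix L).transpose * gram g z (fun i => A (stdVec i)) * stdMatrix L := by
  ext i k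
  have h : g.inner z (A (L (stdVec i))) (A (L (stdVec k))) = ∑ a, ∑ b, (L (stdVec i)) a *
      ((L (stdVec k)) b * g.inner z (A (stdVec a)) (A (stdVec b))) :=
    bilin_expand (pullbackForm g z A) (L (stdVec i)) (L (stdVec k))
  simp only [gram, Matrix.of_apply, h, Matrix.mul_apply, Finset.sum_mul, Matrix.transpose_apply,
    stdMatrix]
  rw [Finset.sum_comm]
  refine Finset.sum_congr rfl fun a _ => Finset.sum_congr rfl fun b _ => ?_
  ring

lemma riemVol_comp (g : Metric n M) (z : M) (A : Model n →L[ℝ] Tan n z)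
    (L : Model n →L[ℝ] Model n) :
    riemVol g z (fun i => A (L (stdVec i))) = riemVol g z (fun i => A (stdVec i)) * |L.det| := by
  have h : (gram g z (fun i => A (L (stdVec i)))).det =
      (gram g z (fun i => A (stdVec i))).det * L.det ^ 2 := by
    rw [gram_comp, Matrix.det_mul, Matrix.det_mul, Matrix.det_transpose, det_eq_det_stdMatrix]
    ring
  rw [riemVol, riemVol, h, Real.sqrt_mul' _ (sq_nonneg _), Real.sqrt_sq_eq_abs]

lemma gram_isSymm (g : Metric n M) (z : M) (w : Fin n → Tan n z) (i k : Fin n) :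
    gram g z w i k = gram g z w k i := g.symm _ _ _

lemma gram_det_pos (g : Metric n M) (z : M) (A : Model n →L[ℝ] Tan n z)
    (hA : Function.Injective A) : 0 < (gram g z (fun i => A (stdVec i))).det := by
  refine Matrix.PosDef.det_pos (Matrix.PosDef.of_dotProduct_mulVec_pos ?_ ?_)
  · ext i k
    simp [gram_isSymm g z _ i k]
  · intro v hv
    have hv' : (WithLp.toLp 2 v : Model n) ≠ 0 := by
      intro h; apply hv; simpa using congrArg WithLp.ofLp h
    have h := bilin_expand (pullbackForm g z A) (WithLp.toLp 2 v) (WithLp.toLp 2 v)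
    have hpos : 0 < pullbackForm g z A (WithLp.toLp 2 v) (WithLp.toLp 2 v) :=
      g.pos _ _ fun h0 => hv' (hA (h0.trans (map_zero A).symm))
    rw [h] at hpos
    refine hpos.trans_eq ?_
    simp only [dotProduct, Matrix.mulVec, Finset.mul_sum, Pi.star_apply, star_trivial]
    refine Finset.sum_congr rfl fun a _ => Finset.sum_congr rfl fun b _ => ?_
    show _ = v a * (g.inner z (A (stdVec a)) (A (stdVec b)) * v b)
    rw [mul_comm _ (v b)]
    rfl

/-- The Riemannian volume density `√det g` in the chart at `x`. -/
noncomputable def volCoord (g : Metric n M) (x : M) (y : Model n) : ℝ :=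
  riemVol g ((chart x).symm y) fun i => coordVec x y (stdVec i)

/-- The Gram matrix of the coordinate frame of the chart at `x`. -/
noncomputable def gramCoord (g : Metric n M) (x : M) (y : Model n) : Matrix (Fin n) (Fin n) ℝ :=
  gram g ((chart x).symm y) fun i => coordVec x y (stdVec i)

lemma volCoord_eq (g : Metric n M) (x : M) (y : Model n) :
    volCoord g x y = √(gramCoord g x y).det := rfl

lemma gramCoord_det_pos (g : Metric n M) {x : M} {y : Model n} (hy : y ∈ (chart x).target) :
    0 < (gramCoord g x y).det :=
  gram_det_pos g _ (coordFrame x y) (coordVec_injective hy)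

lemma volCoord_pos (g : Metric n M) {x : M} {y : Model n} (hy : y ∈ (chart x).target) :
    0 < volCoord g x y := Real.sqrt_pos.mpr (gramCoord_det_pos g hy)

lemma contDiffOn_volCoord (g : Metric n M) (x : M) :
    ContDiffOn ℝ ∞ (volCoord g x) (chart x).target := by
  refine ContDiffOn.sqrt ?_ fun y hy => (gramCoord_det_pos g hy).ne'
  have : (fun y => (gramCoord g x y).det) = fun y => ∑ σ : Equiv.Perm (Fin n),
      ((Equiv.Perm.sign σ : ℤ) : ℝ) * ∏ i, metricCoord g x (stdVec (σ i)) (stdVec i) y := by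
    ext y; rw [Matrix.det_apply']; rfl
  show ContDiffOn ℝ ∞ (fun y => (gramCoord g x y).det) _
  rw [this]
  exact ContDiffOn.sum fun σ _ => contDiffOn_const.mul
    (contDiffOn_prod fun i _ => contDiffOn_metricCoord g x _ _)

lemma gram_self (g : Metric n M) (x : M) :
    gram g x (fun i => (stdVec i : Model n)) = gramCoord g x (chart x x) := by
  ext i k
  simp only [gramCoord, gram, Matrix.of_apply]
  have h1 := coordVec_self x (stdVec i : Model n)
  have h2 := coordVec_self x (stdVec k : Model n)
  have h3 : (chart x).symm (chart x x) = x := extChartAt_to_inv x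
  have key : ∀ z : M, z = x → ∀ v w v' w' : Model n, v' = v → w' = w →
      g.inner x (show Tan n x from v) (show Tan n x from w) =
        g.inner z (show Tan n z from v') (show Tan n z from w') := by
    rintro z rfl v w v' w' rfl rfl; rfl
  exact key _ h3 _ _ _ _ h1 h2

lemma inner_eq_metricCoord_self (g : Metric n M) (x : M) (v w : Tan n x) :
    g.inner x v w = metricCoord g x v w (chart x x) := by
  have h1 := coordVec_self x (v : Model n)
  have h2 := coordVec_self x (w : Model n)
  have h3 : (chart x).symm (chart x x) = x := extChartAt_to_inv x
  have key : ∀ z : M, z = x → ∀ v w v' w' : Model n, v' = v → w' = w →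
      g.inner x (show Tan n x from v) (show Tan n x from w) =
        g.inner z (show Tan n z from v') (show Tan n z from w') := by
    rintro z rfl v w v' w' rfl rfl; rfl
  exact key _ h3 _ _ _ _ h1 h2

/-- Jacobi's formula for the volume density: `∂ᵥ √det g = √det g · ½ tr (g⁻¹ ∂ᵥ g)`. -/
lemma fderiv_volCoord (g : Metric n M) {x : M} {y : Model n} (hy : y ∈ (chart x).target)
    (v : Model n) :
    fderiv ℝ (volCoord g x) y v = volCoord g x y * (1 / 2 * ∑ k, ∑ l,
      (gramCoord g x y)⁻¹ k l * fderiv ℝ (metricCoord g x (stdVec l) (stdVec k)) y v) := by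
  have hn : (∞ : ℕ∞ω) ≠ 0 := by simp
  have hopen : IsOpen (chart x).target := isOpen_chart_target x
  have hγ : HasDerivAt (fun τ : ℝ => y + τ • v) v 0 := by
    have := ((hasDerivAt_id (0 : ℝ)).smul_const v).const_add y
    rw [one_smul] at this
    exact this
  have hγ0 : y + (0 : ℝ) • v = y := by simp
  have hdet : HasDerivAt (fun τ : ℝ => (gramCoord g x (y + τ • v)).det)
      (((gramCoord g x (y + (0 : ℝ) • v)).adjugate * Matrix.of fun i k =>
        fderiv ℝ (metricCoord g x (stdVec i) (stdVec k)) y v).trace) 0 := by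
    refine hasDerivAt_matrix_det fun i k => ?_
    have h := ((contDiffOn_metricCoord g x (stdVec i) (stdVec k)).contDiffAt
      (hopen.mem_nhds hy)).differentiableAt hn
    exact HasFDerivAt.comp_hasDerivAt (l := metricCoord g x (stdVec i) (stdVec k)) 0
      (by rw [hγ0]; exact h.hasFDerivAt) hγ
  have hpos := gramCoord_det_pos g hy
  have hsq := hdet.sqrt (by rw [hγ0]; exact hpos.ne')
  have hvol : HasDerivAt (fun τ : ℝ => volCoord g x (y + τ • v))
      (fderiv ℝ (volCoord g x) y v) 0 :=
    HasFDerivAt.comp_hasDerivAt (l := volCoord g x) 0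
      (by rw [hγ0]; exact (((contDiffOn_volCoord g x).contDiffAt
        (hopen.mem_nhds hy)).differentiableAt hn).hasFDerivAt) hγ
  rw [hvol.unique hsq, hγ0]
  have hadj : (gramCoord g x y).adjugate = (gramCoord g x y).det • (gramCoord g x y)⁻¹ := by
    rw [Matrix.inv_def, smul_smul, Ring.inverse_eq_inv', mul_inv_cancel₀ hpos.ne', one_smul]
  have htr : ((gramCoord g x y)⁻¹ * Matrix.of fun i k =>
        fderiv ℝ (metricCoord g x (stdVec i) (stdVec k)) y v).trace =
      ∑ k, ∑ l, (gramCoord g x y)⁻¹ k l *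
        fderiv ℝ (metricCoord g x (stdVec l) (stdVec k)) y v := by
    simp [Matrix.trace, Matrix.mul_apply]
  rw [hadj, Matrix.smul_mul, Matrix.trace_smul, htr, volCoord_eq, smul_eq_mul]
  have h2 := Real.mul_self_sqrt hpos.le
  have h3 := (Real.sqrt_pos.mpr hpos).ne'
  field_simp
  rw [Real.sq_sqrt hpos.le]
  ring

lemma raise_apply (g : Metric n M) (x : M) (α : Fin n → ℝ) (k : Fin n) :
    raise g x α k = ∑ l, (gramCoord g x (chart x x))⁻¹ k l * α l := by
  rw [raise, gram_self]
  have := congrArg (fun v : Model n => v k) (sum_smul_stdVec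
    (WithLp.toLp 2 (fun k => ∑ l, (gramCoord g x (chart x x))⁻¹ k l * α l) : Model n))
  simpa using this

/-- A tangent vector is recovered from its inner products with the coordinate vectors. -/
lemma eq_raise_of_inner (g : Metric n M) (x : M) (v : Model n) (α : Fin n → ℝ)
    (h : ∀ l, g.inner x (v : Model n) (stdVec l : Model n) = α l) : v = raise g x α := by
  have hpos := gramCoord_det_pos g (chart_mem_target x)
  have hinv : (gramCoord g x (chart x x))⁻¹ * gramCoord g x (chart x x) = 1 :=
    Matrix.nonsing_inv_mul _ (isUnit_iff_ne_zero.mpr hpos.ne')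
  have hv : ∀ l, α l = ∑ b, gramCoord g x (chart x x) l b * (v : Model n) b := by
    intro l
    have e : α l = pullbackForm g _ (coordFrame x (chart x x)) (stdVec l) v :=
      (h l).symm.trans ((g.symm x _ _).trans (inner_eq_metricCoord_self g x _ _))
    rw [e]
    conv_lhs => rw [← sum_smul_stdVec v]
    rw [map_sum]
    refine Finset.sum_congr rfl fun b _ => ?_
    rw [map_smul, smul_eq_mul, mul_comm]
    rfl
  have hvec : α = (gramCoord g x (chart x x)).mulVec (v : Model n).ofLp := by
    ext l; exact hv l
  refine PiLp.ext fun k => ?_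
  have h1 : ((gramCoord g x (chart x x))⁻¹.mulVec α) k = (v : Model n) k := by
    rw [hvec, Matrix.mulVec_mulVec, hinv, Matrix.one_mulVec]
  exact h1.symm.trans (raise_apply g x α k).symm

lemma raise_add (g : Metric n M) (x : M) (α β : Fin n → ℝ) :
    raise g x (fun l => α l + β l) = raise g x α + raise g x β := by
  ext k
  simp [raise_apply, mul_add, Finset.sum_add_distrib]

lemma raise_smul (g : Metric n M) (x : M) (c : ℝ) (α : Fin n → ℝ) :
    raise g x (fun l => c * α l) = c • raise g x α := by
  ext k
  simp only [raise_apply, PiLp.smul_apply, smul_eq_mul, Finset.mul_sum]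
  exact Finset.sum_congr rfl fun l _ => by ring

/-- The trace of the Christoffel symbols is the logarithmic derivative of `√det g`. -/
lemma sum_christoffel (g : Metric n M) (x : M) (a : Model n) :
    ∑ i, (christoffel g x (stdVec i) a) i =
      fderiv ℝ (volCoord g x) (chart x x) a / volCoord g x (chart x x) := by
  set y := chart x x
  have hy : y ∈ (chart x).target := chart_mem_target x
  have hvol := (volCoord_pos g hy).ne'
  rw [fderiv_volCoord g hy, mul_div_cancel_left₀ _ hvol]
  simp only [christoffel, raise_apply]
  set G := (gramCoord g x y)⁻¹ with hG
  have hsymm : ∀ i l, G i l = G l i := by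
    intro i l
    have : G.transpose = G := by
      rw [hG, Matrix.transpose_nonsing_inv]
      congr 1
      ext a b
      exact g.symm _ _ _
    exact congrFun (congrFun this l) i
  set T : Fin n → Fin n → ℝ := fun i l => fderiv ℝ (metricCoord g x a (stdVec l)) y (stdVec i)
  have h2 : ∑ i, ∑ l, G i l * T i l = ∑ i, ∑ l, G i l * T l i := by
    rw [Finset.sum_comm]
    exact Finset.sum_congr rfl fun i _ => Finset.sum_congr rfl fun l _ => by rw [hsymm]
  have h3 : ∀ i l : Fin n, G i l * (1 / 2 * (T i l
      + fderiv ℝ (metricCoord g x (stdVec i) (stdVec l)) y a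
      - fderiv ℝ (metricCoord g x (stdVec i) a) y (stdVec l))) =
      1 / 2 * (G i l * T i l) - 1 / 2 * (G i l * T l i)
        + 1 / 2 * (G i l * fderiv ℝ (metricCoord g x (stdVec l) (stdVec i)) y a) := by
    intro i l
    rw [metricCoord_comm g x (stdVec i) a, metricCoord_comm g x (stdVec i) (stdVec l)]
    ring
  refine (Finset.sum_congr rfl fun i _ => Finset.sum_congr rfl fun l _ => h3 i l).trans ?_
  simp only [Finset.sum_add_distrib, Finset.sum_sub_distrib, ← Finset.mul_sum, h2, sub_self,
    zero_add]

/-- The divergence in coordinates: `div Y = ∂ᵢ Yⁱ + Y (log √det g)`. -/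
lemma div_eq (g : Metric n M) (x : M) (Y : ∀ z : M, Tan n z) :
    div g Y x = tr n (fderiv ℝ (coordRep x Y) (chart x x)) +
      fderiv ℝ (volCoord g x) (chart x x) (Y x) / volCoord g x (chart x x) := by
  refine Eq.trans ?_ (congrArg _ (sum_christoffel g x (Y x)))
  rw [tr_apply, ← Finset.sum_add_distrib]
  rfl

end MetricCoord

/-! ### Volume forms and densities in coordinates -/

section VolumeForm

variable {n : ℕ} {M : Type*} [TopologicalSpace M] [ChartedSpace (Model n) M]
  [IsManifold 𝓘(ℝ, Model n) ∞ M]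

local notation "𝓔" => 𝓘(ℝ, Model n)
local notation "chart" => extChartAt 𝓘(ℝ, Model n)

/-- The inner product in terms of the components in a fixed chart. -/
lemma inner_eq_metricCoord (g : Metric n M) {x₀ x : M} (hx : x ∈ (chart x₀).source)
    (v w : Tan n x) : g.inner x v w = metricCoord g x₀ (mfderiv 𝓔 𝓔 (chart x₀) x v)
      (mfderiv 𝓔 𝓔 (chart x₀) x w) (chart x₀ x) := by
  obtain ⟨y, hy, rfl⟩ : ∃ y ∈ (chart x₀).target, (chart x₀).symm y = x :=
    ⟨chart x₀ x, (chart x₀).map_source hx, (chart x₀).left_inv hx⟩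
  rw [(chart x₀).right_inv hy]
  have h1 := coordVec_mfderiv_chart hy v
  have h2 := coordVec_mfderiv_chart hy w
  exact (congrArg₂ (fun a b => g.inner _ a b) h1 h2).symm

/-- The volume of a parallelepiped in terms of the components in a fixed chart. -/
lemma riemVol_eq_volCoord (g : Metric n M) {x₀ x : M} (hx : x ∈ (chart x₀).source)
    (w : Fin n → Tan n x) (L : Model n →L[ℝ] Model n)
    (hL : ∀ i, mfderiv 𝓔 𝓔 (chart x₀) x (w i) = L (stdVec i)) :
    riemVol g x w = volCoord g x₀ (chart x₀ x) * |L.det| := by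
  obtain ⟨y, hy, rfl⟩ : ∃ y ∈ (chart x₀).target, (chart x₀).symm y = x :=
    ⟨chart x₀ x, (chart x₀).map_source hx, (chart x₀).left_inv hx⟩
  rw [(chart x₀).right_inv hy]
  have h1 : w = fun i => coordFrame x₀ y (L (stdVec i)) := by
    ext1 i
    have h2 := coordVec_mfderiv_chart hy (w i)
    rw [hL] at h2
    exact h2.symm
  rw [h1, riemVol_comp]
  rfl

variable {N : Type*} [TopologicalSpace N] [ChartedSpace (Model n) N]

/-- An alternating form of top degree scales by the determinant. -/
lemma volumeForm_comp (ν : VolumeForm n N) (p : N) (A : Model n →L[ℝ] Tan n p)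
    (L : Model n →L[ℝ] Model n) : ν.toFun p (fun i => A (L (stdVec i))) =
      L.det * ν.toFun p (fun i => A (stdVec i)) := by
  set e := (EuclideanSpace.basisFun (Fin n) ℝ).toBasis
  have he : ∀ i, e i = stdVec i := fun i => by simp [e, stdVec]
  set f : (Model n) [⋀^Fin n]→ₗ[ℝ] ℝ := (ν.toFun p).compLinearMap (A : Model n →ₗ[ℝ] Tan n p)
  have h1 : f (fun i => L (stdVec i)) = f (fun i => stdVec i) * e.det (fun i => L (stdVec i)) := by
    have := f.eq_smul_basis_det e
    conv_lhs => rw [this]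
    simp only [AlternatingMap.smul_apply, smul_eq_mul]
    congr 2
    ext1 i
    exact he i
  have h2 : e.det (fun i => L (stdVec i)) = L.det := by
    have h3 := e.det_comp (L : Model n →ₗ[ℝ] Model n) e
    rw [e.det_self, mul_one] at h3
    rw [ContinuousLinearMap.det, ← h3]
    congr 1
    ext1 i
    exact congrArg L (he i).symm
  rw [h2, mul_comm] at h1
  exact h1

/-- The density `|ν|` in the chart at `x`. -/
noncomputable def nuCoord (ν : VolumeForm n N) (x : N) (y : Model n) : ℝ :=
  |ν.toFun ((chart x).symm y) fun i => coordVec x y (stdVec i)|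

lemma volumeForm_ne_zero (ν : VolumeForm n N) (p : N) (A : Model n →L[ℝ] Tan n p)
    (hA : Function.Surjective A) : ν.toFun p (fun i => A (stdVec i)) ≠ 0 := by
  set e := (EuclideanSpace.basisFun (Fin n) ℝ).toBasis
  have he : ∀ i, e i = stdVec i := fun i => by simp [e, stdVec]
  set f : (Model n) [⋀^Fin n]→ₗ[ℝ] ℝ := (ν.toFun p).compLinearMap (A : Model n →ₗ[ℝ] Tan n p)
  have h1 : f e ≠ 0 := by
    rw [AlternatingMap.map_basis_ne_zero_iff]
    intro hf
    apply ν.ne_zero p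
    ext w
    choose w' hw' using fun i => hA (w i)
    have : f w' = 0 := by rw [hf]; rfl
    rw [AlternatingMap.zero_apply, ← this]
    exact congrArg (ν.toFun p) (funext fun i => (hw' i).symm)
  intro h0
  apply h1
  rw [show (e : Fin n → Model n) = fun i => stdVec i from funext he]
  exact h0

variable [IsManifold 𝓘(ℝ, Model n) ∞ N]

lemma coordFrame_surjective {x : N} {y : Model n} (hy : y ∈ (chart x).target) :
    Function.Surjective (coordFrame x y : Model n → Tan n ((chart x).symm y)) := fun v =>
  ⟨_, coordVec_mfderiv_chart hy v⟩

lemma nuCoord_pos (ν : VolumeForm n N) {x : N} {y : Model n} (hy : y ∈ (chart x).target) :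
    0 < nuCoord ν x y :=
  abs_pos.mpr (volumeForm_ne_zero ν _ (coordFrame x y) (coordFrame_surjective hy))

lemma contDiffOn_nuCoord (ν : VolumeForm n N) (x : N) :
    ContDiffOn ℝ ∞ (nuCoord ν x) (chart x).target := by
  intro y hy
  have h := (ν.smooth x).contDiffAt ((isOpen_chart_target x).mem_nhds hy)
  refine ContDiffAt.contDiffWithinAt ?_
  have hne := volumeForm_ne_zero ν _ (coordFrame x y) (coordFrame_surjective hy)
  exact (contDiffAt_abs hne).comp y h

/-- The density `|ν|` in terms of the components in a fixed chart. -/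
lemma abs_volumeForm_eq_nuCoord (ν : VolumeForm n N) {p₀ p : N} (hp : p ∈ (chart p₀).source)
    (w : Fin n → Tan n p) (L : Model n →L[ℝ] Model n)
    (hL : ∀ i, mfderiv 𝓔 𝓔 (chart p₀) p (w i) = L (stdVec i)) :
    |ν.toFun p w| = |L.det| * nuCoord ν p₀ (chart p₀ p) := by
  obtain ⟨y, hy, rfl⟩ : ∃ y ∈ (chart p₀).target, (chart p₀).symm y = p :=
    ⟨chart p₀ p, (chart p₀).map_source hp, (chart p₀).left_inv hp⟩
  rw [(chart p₀).right_inv hy]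
  have h1 : w = fun i => coordFrame p₀ y (L (stdVec i)) := by
    ext1 i
    have h2 := coordVec_mfderiv_chart hy (w i)
    rw [hL] at h2
    exact h2.symm
  rw [h1, volumeForm_comp, abs_mul]
  rfl

variable {ν : VolumeForm n N} {g : Metric n M} {η : N → M} {ρ : M → ℝ}

lemma riemVol_nonneg (g : Metric n M) (x : M) (w : Fin n → Tan n x) : 0 ≤ riemVol g x w :=
  Real.sqrt_nonneg _

lemma volumeForm_std_ne_zero (ν : VolumeForm n N) (p : N) :
    ν.toFun p (fun i => (stdVec i : Model n)) ≠ 0 :=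
  volumeForm_ne_zero ν p (ContinuousLinearMap.id ℝ (Model n)) Function.surjective_id

lemma IsDensity.pos_apply (h : IsDensity ν g η ρ) (p : N) : 0 < ρ (η p) := by
  have h1 := h p fun i => (stdVec i : Model n)
  have h2 := abs_pos.mpr (volumeForm_std_ne_zero ν p)
  rw [← h1] at h2
  exact pos_of_mul_pos_left h2 (riemVol_nonneg _ _ _)

lemma IsDensity.riemVol_pos (h : IsDensity ν g η ρ) (p : N) :
    0 < riemVol g (η p) fun i => mfderiv 𝓔 𝓔 η p (stdVec i : Model n) := by
  have h1 := h p fun i => (stdVec i : Model n)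
  have h2 := abs_pos.mpr (volumeForm_std_ne_zero ν p)
  rw [← h1] at h2
  exact pos_of_mul_pos_right h2 (h.pos_apply p).le

lemma IsDensity.particleDensity_eq (h : IsDensity ν g η ρ) (p : N) :
    particleDensity ν g η p = ρ (η p) := by
  rw [particleDensity, ← h p fun i => (stdVec i : Model n),
    mul_div_assoc, div_self (h.riemVol_pos p).ne', mul_one]

/-- The density equation in charts at `p₀` and `x₀`. -/
lemma IsDensity.coord (h : IsDensity ν g η ρ) {p₀ : N} {x₀ : M} {y : Model n}
    (hy : y ∈ (chart p₀).target) (hx : η ((chart p₀).symm y) ∈ (chart x₀).source)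
    (hη : MDifferentiableAt 𝓔 𝓔 η ((chart p₀).symm y)) :
    ρ (η ((chart p₀).symm y)) * volCoord g x₀ (chart x₀ (η ((chart p₀).symm y))) *
      |(fderiv ℝ (fun y => chart x₀ (η ((chart p₀).symm y))) y).det| = nuCoord ν p₀ y := by
  set p := (chart p₀).symm y with hp
  have h1 := h p fun i => coordVec p₀ y (stdVec i)
  have hc : ∀ v, mfderiv 𝓔 𝓔 (chart x₀) (η p) (mfderiv 𝓔 𝓔 η p (coordVec p₀ y v)) =
      fderiv ℝ (fun y => chart x₀ (η ((chart p₀).symm y))) y v := by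
    intro v
    have e1 := mfderiv_comp y hη (mdifferentiableAt_chart_symm hy)
    have e2 := mfderiv_comp y (mdifferentiableAt_chart hx)
      (hη.comp y (mdifferentiableAt_chart_symm hy))
    rw [← mfderiv_eq_fderiv]
    have e3 := congrArg (fun L : Model n →L[ℝ] Model n => L v) e2
    have e4 := congrArg (fun L : Model n →L[ℝ] Model n => L v) e1
    refine Eq.trans ?_ e3.symm
    exact congrArg (fun z : Model n => mfderiv 𝓔 𝓔 (chart x₀) (η p) z) e4.symm
  rw [riemVol_eq_volCoord g hx _ _ fun i => hc (stdVec i)] at h1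
  rw [mul_assoc, h1]
  rfl

end VolumeForm

/-! ### The measure of a volume form -/

section Measure

lemma measurableSet_inter_preimage_of_continuousOn {X Y : Type*} [TopologicalSpace X]
    [MeasurableSpace X] [BorelSpace X] [TopologicalSpace Y] [MeasurableSpace Y] [BorelSpace Y]
    {s : Set X} (hs : IsOpen s) {f : X → Y} (hf : ContinuousOn f s) {B : Set Y}
    (hB : MeasurableSet B) : MeasurableSet (s ∩ f ⁻¹' B) := by
  have h1 : Measurable fun x : s => f x :=
    (continuousOn_iff_continuous_domRestrict.mp hf).measurable
  have h2 := hs.measurableSet.subtype_image (h1 hB)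
  convert h2 using 1
  ext x
  simp [and_comm]

variable {n : ℕ} {N : Type*} [TopologicalSpace N] [ChartedSpace (Model n) N]
  [MeasurableSpace N] [BorelSpace N]

local notation "𝓔" => 𝓘(ℝ, Model n)
local notation "chart" => extChartAt 𝓘(ℝ, Model n)

/-- The chart measure has the density `nuCoord` with respect to the Lebesgue measure of the chart.
-/
lemma chartMeasure_apply (ν : VolumeForm n N) (x : N) {B : Set N} (hB : MeasurableSet B) :
    ν.chartMeasure x B = ∫⁻ y in (chart x).target ∩ (chart x).symm ⁻¹' B,
      ENNReal.ofReal (nuCoord ν x y) := by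
  have hc : ContinuousOn (chart x).symm (chart x).target := continuousOn_extChartAt_symm x
  have hm := measurableSet_inter_preimage_of_continuousOn (isOpen_extChartAt_target x) hc hB
  have hae : AEMeasurable (chart x).symm ((volume.restrict (chart x).target).withDensity fun y =>
      ENNReal.ofReal |ν.toFun ((chart x).symm y) fun i => coordVec x y (stdVec i)|) :=
    (hc.aemeasurable (isOpen_extChartAt_target x).measurableSet).mono_ac
      (withDensity_absolutelyContinuous _ _)
  rw [VolumeForm.chartMeasure, Measure.map_apply_of_aemeasurable hae hB, withDensity_apply',
    Measure.restrict_restrict' (isOpen_extChartAt_target x).measurableSet, inter_comm]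
  rfl

variable [IsManifold 𝓘(ℝ, Model n) ∞ N]
variable {M : Type*} [TopologicalSpace M] [ChartedSpace (Model n) M]
  [MeasurableSpace M] [BorelSpace M]

/-- Change of variables from the chart of `N` at `p` to the chart of `M` at `x`, along a
homeomorphism from `N` to `M`. -/
lemma chartMeasure_eq_lintegral (ν : VolumeForm n N) (Φ : N ≃ₜ M) (p : N) (x : M)
    {R : Model n → ENNReal}
    (hd : ∀ y ∈ (chart p).target, Φ ((chart p).symm y) ∈ (chart x).source →
      DifferentiableAt ℝ (fun y => chart x (Φ ((chart p).symm y))) y)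
    (hR : ∀ y ∈ (chart p).target, Φ ((chart p).symm y) ∈ (chart x).source →
      ENNReal.ofReal (nuCoord ν p y) =
        ENNReal.ofReal |(fderiv ℝ (fun y => chart x (Φ ((chart p).symm y))) y).det| *
          R (chart x (Φ ((chart p).symm y))))
    {A : Set (Model n)} (hA : MeasurableSet A) (hAx : A ⊆ (chart x).target)
    (hAp : ∀ y ∈ A, Φ.symm ((chart x).symm y) ∈ (chart p).source) :
    ν.chartMeasure p (Φ ⁻¹' ((chart x).source ∩ chart x ⁻¹' A)) = ∫⁻ y in A, R y := by
  set e : OpenPartialHomeomorph (Model n) (Model n) :=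
    ((chartAt (Model n) p).symm.trans Φ.toOpenPartialHomeomorph).trans (chartAt (Model n) x) with he
  have hes : ∀ y, y ∈ e.source ↔ y ∈ (chart p).target ∧ Φ ((chart p).symm y) ∈ (chart x).source :=
      by
    intro y; simp [he]
  have het : ∀ y, y ∈ e.target ↔
      y ∈ (chart x).target ∧ Φ.symm ((chart x).symm y) ∈ (chart p).source := by
    intro y; simp [he]
  have hfun : ⇑e = fun y => chart x (Φ ((chart p).symm y)) := by
    ext1 y; simp [he]
  have hsymm : ∀ y, e.symm y = chart p (Φ.symm ((chart x).symm y)) := by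
    intro y; simp [he]
  have hAt : A ⊆ e.target := fun y hy => (het y).mpr ⟨hAx hy, hAp y hy⟩
  have hmain := map_withDensity_of_openPartialHomeomorph (μ := volume) e
    (fun y hy => by rw [hfun]; exact hd y ((hes y).mp hy).1 ((hes y).mp hy).2)
    (w := fun y => ENNReal.ofReal (nuCoord ν p y)) (w' := R)
    (fun y hy => by rw [hfun]; exact hR y ((hes y).mp hy).1 ((hes y).mp hy).2) hA hAt
  have hBm : MeasurableSet (Φ ⁻¹' ((chart x).source ∩ chart x ⁻¹' A)) :=
    Φ.continuous.measurable (measurableSet_inter_preimage_of_continuousOn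
      (isOpen_extChartAt_source x) (continuousOn_extChartAt x) hA)
  rw [chartMeasure_apply ν p hBm, ← hmain]
  congr 2
  ext y
  constructor
  · rintro ⟨hy, hy1, hy2⟩
    refine ⟨_, hy2, ?_⟩
    rw [hsymm, (chart x).left_inv hy1, Homeomorph.symm_apply_apply, (chart p).right_inv hy]
  · rintro ⟨z, hz, rfl⟩
    have hzt := e.map_target (hAt hz)
    have hzi : chart x (Φ ((chart p).symm (e.symm z))) = z :=
      (congrFun hfun _).symm.trans (e.right_inv (hAt hz))
    obtain ⟨h1, h2⟩ := (hes _).mp hzt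
    refine ⟨h1, h2, ?_⟩
    show chart x (Φ ((chart p).symm (e.symm z))) ∈ A
    rw [hzi]; exact hz

/-- The chart measures agree on overlaps. -/
lemma chartMeasure_overlap (ν : VolumeForm n N) (p q : N) {B : Set N} (hB : MeasurableSet B)
    (hBp : B ⊆ (chart p).source) (hBq : B ⊆ (chart q).source) :
    ν.chartMeasure p B = ν.chartMeasure q B := by
  have hcq : ContinuousOn (chart q).symm (chart q).target := continuousOn_extChartAt_symm q
  set A := (chart q).target ∩ (chart q).symm ⁻¹' B with hAdef
  have hA : MeasurableSet A :=
    measurableSet_inter_preimage_of_continuousOn (isOpen_extChartAt_target q) hcq hB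
  have hBA : (chart q).source ∩ chart q ⁻¹' A = B := by
    ext z
    constructor
    · rintro ⟨h1, h2, h3⟩
      rwa [mem_preimage, (chart q).left_inv h1] at h3
    · intro hz
      refine ⟨hBq hz, (chart q).map_source (hBq hz), ?_⟩
      rwa [mem_preimage, (chart q).left_inv (hBq hz)]
  have hd : ∀ y ∈ (chart p).target, (chart p).symm y ∈ (chart q).source →
      MDifferentiableAt 𝓔 𝓔 (chart q) ((chart p).symm y) ∧
      MDifferentiableAt 𝓔 𝓔 (chart p).symm y := fun y hy hyq =>
    ⟨mdifferentiableAt_chart hyq, mdifferentiableAt_chart_symm hy⟩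
  have h1 := chartMeasure_eq_lintegral ν (Homeomorph.refl N) p q
    (R := fun y => ENNReal.ofReal (nuCoord ν q y))
    (fun y hy hyq => (mdifferentiableAt_iff_differentiableAt.mp
      ((hd y hy hyq).1.comp y (hd y hy hyq).2)))
    (fun y hy hyq => by
      have e2 := mfderiv_comp y (hd y hy hyq).1 (hd y hy hyq).2
      rw [← ENNReal.ofReal_mul (abs_nonneg _)]
      congr 1
      refine abs_volumeForm_eq_nuCoord ν hyq _ _ fun i => ?_
      rw [← mfderiv_eq_fderiv]
      exact (congrArg (fun L : Model n →L[ℝ] Model n => L (stdVec i)) e2).symm)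
    hA inter_subset_left (fun y hy => hBp hy.2)
  have h2 : (Homeomorph.refl N) ⁻¹' ((chart q).source ∩ chart q ⁻¹' A) = B := hBA
  rw [h2] at h1
  rw [h1, chartMeasure_apply ν q hB]

lemma chartMeasure_inter_source (ν : VolumeForm n N) (p : N) {B : Set N} (hB : MeasurableSet B) :
    ν.chartMeasure p B = ν.chartMeasure p (B ∩ (chart p).source) := by
  rw [chartMeasure_apply ν p hB,
    chartMeasure_apply ν p (hB.inter (isOpen_extChartAt_source p).measurableSet)]
  congr 2
  ext y
  constructor
  · rintro ⟨h1, h2⟩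
    exact ⟨h1, h2, (chart p).map_target h1⟩
  · rintro ⟨h1, h2, -⟩
    exact ⟨h1, h2⟩

/-- The measure `|ν|` restricts to the chart measures. -/
lemma measure_eq_chartMeasure (ν : VolumeForm n N) (p : N) {B : Set N} (hB : MeasurableSet B)
    (hBp : B ⊆ (chart p).source) : ν.measure B = ν.chartMeasure p B := by
  have hs : MeasurableSet (chart p).source := (isOpen_extChartAt_source p).measurableSet
  refine le_antisymm ?_ (le_iSup (fun x => ν.chartMeasure x) p B)
  -- the right-hand side below dominates each chart measure, hence the supremum that defines `|ν|`
  have hle : ν.measure ≤ ν.chartMeasure p + ν.measure.restrict (chart p).sourceᶜ := by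
    refine iSup_le fun x => ?_
    rw [Measure.le_iff]
    intro C hC
    rw [← measure_inter_add_sdiff C hs, Measure.add_apply, Measure.restrict_apply hC, ← sdiff_eq]
    refine add_le_add ?_ (le_iSup (fun x => ν.chartMeasure x) x _)
    rw [chartMeasure_inter_source ν x (hC.inter hs),
      chartMeasure_overlap ν x p ((hC.inter hs).inter
        (isOpen_extChartAt_source x).measurableSet) inter_subset_right
        (fun z hz => hz.1.2)]
    exact measure_mono fun z hz => hz.1.1
  calc ν.measure B ≤ (ν.chartMeasure p + ν.measure.restrict (chart p).sourceᶜ) B := hle B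
    _ = ν.chartMeasure p B := by
      rw [Measure.add_apply, Measure.restrict_apply hB,
        (disjoint_compl_right_iff_subset.mpr hBp).inter_eq, measure_empty, add_zero]

/-- The measure `|ν|` is finite: by compactness it suffices that it is locally finite, and on the
preimage of a closed ball in a chart it has a bounded density. -/
lemma isFiniteMeasure_measure [CompactSpace N] (ν : VolumeForm n N) :
    IsFiniteMeasure ν.measure := by
  have : IsLocallyFiniteMeasure ν.measure := by
    refine ⟨fun p => ?_⟩
    obtain ⟨δ, hδ, hball⟩ := Metric.nhds_basis_closedBall.mem_iff.mp
      ((isOpen_extChartAt_target (I := 𝓔) p).mem_nhds (mem_extChartAt_target p))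
    have hc : ContinuousOn (chart p) (chart p).source := continuousOn_extChartAt p
    have hBm := measurableSet_inter_preimage_of_continuousOn
        (isOpen_extChartAt_source (I := 𝓔) p) hc
      (Metric.isClosed_closedBall (x := chart p p) (ε := δ)).measurableSet
    refine ⟨(chart p).source ∩ chart p ⁻¹' Metric.closedBall (chart p p) δ, ?_, ?_⟩
    · exact Filter.inter_mem (extChartAt_source_mem_nhds p)
        ((continuousAt_extChartAt p).preimage_mem_nhds (Metric.closedBall_mem_nhds _ hδ))
    · rw [measure_eq_chartMeasure ν p hBm inter_subset_left, chartMeasure_apply ν p hBm]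
      have hsub : (chart p).target ∩ (chart p).symm ⁻¹' ((chart p).source ∩
          chart p ⁻¹' Metric.closedBall (chart p p) δ) ⊆ Metric.closedBall (chart p p) δ := by
        rintro y ⟨h1, -, h2⟩
        rwa [mem_preimage, (chart p).right_inv h1] at h2
      refine (lintegral_mono_set hsub).trans_lt ?_
      have hint : IntegrableOn (nuCoord ν p) (Metric.closedBall (chart p p) δ) :=
        ((contDiffOn_nuCoord ν p).continuousOn.mono hball).integrableOn_compact
          (isCompact_closedBall _ _)
      exact hint.lintegral_lt_top
  infer_instance

variable [CompactSpace N] [IsManifold 𝓘(ℝ, Model n) ∞ M]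

/-- The pushforward of `|ν|` to `M` in a chart of `M`. -/
lemma map_measure_eq (ν : VolumeForm n N) (g : Metric n M)
    (Φ : Diffeomorph 𝓘(ℝ, Model n) 𝓘(ℝ, Model n) N M ∞) {ρ : M → ℝ} (hρ : IsDensity ν g Φ ρ)
    (x : M) :
    (ν.measure.restrict (Φ ⁻¹' (chart x).source)).map (fun p => chart x (Φ p)) =
      (volume.restrict (chart x).target).withDensity
        (fun y => ENNReal.ofReal (ρ ((chart x).symm y) * volCoord g x y)) := by
  have hΦ : ∀ p, MDifferentiableAt 𝓔 𝓔 Φ p := fun p => Φ.contMDiff.mdifferentiable (by simp) p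
  have hsrc : MeasurableSet (Φ ⁻¹' (chart x).source) :=
    ((isOpen_extChartAt_source x).preimage Φ.contMDiff.continuous).measurableSet
  have hcont : ContinuousOn (fun p => chart x (Φ p)) (Φ ⁻¹' (chart x).source) :=
    (continuousOn_extChartAt x).comp Φ.contMDiff.continuous.continuousOn fun p hp => hp
  obtain ⟨s, hs⟩ := isCompact_univ.elim_nhds_subcover (fun p : N => (chart p).source)
    fun p _ => extChartAt_source_mem_nhds p
  -- it suffices to compare the measures over each of finitely many charts of `N`
  have hcs : ContinuousOn (fun y => Φ.symm ((chart x).symm y)) (chart x).target :=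
    Φ.symm.contMDiff.continuous.comp_continuousOn (continuousOn_extChartAt_symm x)
  let U : Option s → Set (Model n) := fun i => i.elim (chart x).targetᶜ
    (fun p => (chart x).target ∩ (fun y => Φ.symm ((chart x).symm y)) ⁻¹' (chart p.1).source)
  have hUm : ∀ i, MeasurableSet (U i) := by
    rintro (_ | p)
    · exact (isOpen_extChartAt_target x).measurableSet.compl
    · exact measurableSet_inter_preimage_of_continuousOn (isOpen_extChartAt_target x) hcs
        (isOpen_extChartAt_source p.1).measurableSet
  refine Measure.ext_of_iUnion_eq_univ (s := U) ?_ ?_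
  · rw [eq_univ_iff_forall]
    intro y
    by_cases hy : y ∈ (chart x).target
    · obtain ⟨p, hp, hpy⟩ := mem_iUnion₂.mp (hs.2 (mem_univ (Φ.symm ((chart x).symm y))))
      exact mem_iUnion.mpr ⟨some ⟨p, hp⟩, hy, hpy⟩
    · exact mem_iUnion.mpr ⟨none, hy⟩
  · intro i
    ext A hA
    rw [Measure.restrict_apply hA, Measure.restrict_apply hA,
      Measure.map_apply_of_aemeasurable (hcont.aemeasurable hsrc) (hA.inter (hUm i)),
      Measure.restrict_apply' hsrc, withDensity_apply _ (hA.inter (hUm i)),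
      Measure.restrict_restrict (hA.inter (hUm i))]
    rcases i with _ | p
    · have h1 : (A ∩ U none) ∩ (chart x).target = ∅ := by
        ext y; constructor
        · rintro ⟨⟨-, h1⟩, h2⟩; exact h1 h2
        · rintro ⟨⟩
      have h2 : (fun p => chart x (Φ p)) ⁻¹' (A ∩ U none) ∩ Φ ⁻¹' (chart x).source = ∅ := by
        ext q; constructor
        · rintro ⟨⟨-, h1⟩, h2⟩; exact h1 ((chart x).map_source h2)
        · rintro ⟨⟩
      rw [h1, h2]; simp
    · have hsub : A ∩ U (some p) ⊆ (chart x).target := fun y hy => hy.2.1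
      rw [inter_eq_left.mpr hsub]
      have hset : (fun p => chart x (Φ p)) ⁻¹' (A ∩ U (some p)) ∩ Φ ⁻¹' (chart x).source =
          Φ ⁻¹' ((chart x).source ∩ chart x ⁻¹' (A ∩ U (some p))) := by
        ext q; simp only [mem_inter_iff, mem_preimage]; tauto
      have hBm : MeasurableSet (Φ ⁻¹' ((chart x).source ∩ chart x ⁻¹' (A ∩ U (some p)))) :=
        Φ.contMDiff.continuous.measurable (measurableSet_inter_preimage_of_continuousOn
          (isOpen_extChartAt_source x) (continuousOn_extChartAt x) (hA.inter (hUm _)))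
      have hBp : Φ ⁻¹' ((chart x).source ∩ chart x ⁻¹' (A ∩ U (some p))) ⊆ (chart p.1).source := by
        rintro q ⟨h1, -, -, h2⟩
        rw [mem_preimage, (chart x).left_inv h1, Φ.symm_apply_apply] at h2
        exact h2
      rw [hset, measure_eq_chartMeasure ν p.1 hBm hBp]
      refine chartMeasure_eq_lintegral ν Φ.toHomeomorph p.1 x ?_ ?_ (hA.inter (hUm _)) hsub
        (fun y hy => hy.2.2)
      · intro y hy hyx
        exact mdifferentiableAt_iff_differentiableAt.mp
          ((mdifferentiableAt_chart hyx).comp y ((hΦ _).comp y (mdifferentiableAt_chart_symm hy)))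
      · intro y hy hyx
        have h1 := hρ.coord hy hyx (hΦ _)
        rw [← ENNReal.ofReal_mul (abs_nonneg _), ← h1, mul_comm]
        congr 1
        have h2 : (chart x).symm (chart x (Φ ((chart p.1).symm y))) = Φ ((chart p.1).symm y) :=
          (chart x).left_inv hyx
        simp only [Diffeomorph.coe_toHomeomorph]
        rw [h2]

/-- Integrals over `N` of functions that are carried by a chart of `M`. -/
lemma integral_comp_eq (ν : VolumeForm n N) (g : Metric n M)
    (Φ : Diffeomorph 𝓘(ℝ, Model n) 𝓘(ℝ, Model n) N M ∞) {ρ : M → ℝ} (hρ : IsDensity ν g Φ ρ)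
    (x : M) {f : Model n → ℝ} {F : N → ℝ} (hf : Measurable f)
    (hfm : AEMeasurable (fun y => ρ ((chart x).symm y) * volCoord g x y)
      (volume.restrict (chart x).target))
    (hf0 : ∀ y ∉ (chart x).target, f y = 0)
    (hF : ∀ p, Φ p ∈ (chart x).source → F p = f (chart x (Φ p)))
    (hF0 : ∀ p, Φ p ∉ (chart x).source → F p = 0) :
    ∫ p, F p ∂ν.measure = ∫ y, f y * (ρ ((chart x).symm y) * volCoord g x y) := by
  have hsrc : MeasurableSet (Φ ⁻¹' (chart x).source) :=
    ((isOpen_extChartAt_source x).preimage Φ.contMDiff.continuous).measurableSet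
  have htgt : MeasurableSet (chart x).target := (isOpen_extChartAt_target x).measurableSet
  have hcont : ContinuousOn (fun p => chart x (Φ p)) (Φ ⁻¹' (chart x).source) :=
    (continuousOn_extChartAt x).comp Φ.contMDiff.continuous.continuousOn fun p hp => hp
  have hpos : ∀ᵐ y ∂(volume.restrict (chart x).target),
      0 ≤ ρ ((chart x).symm y) * volCoord g x y := by
    filter_upwards [ae_restrict_mem htgt] with y hy
    have := hρ.pos_apply (Φ.symm ((chart x).symm y))
    rw [Φ.apply_symm_apply] at this
    exact (mul_pos this (volCoord_pos g hy)).le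
  calc ∫ p, F p ∂ν.measure = ∫ p in Φ ⁻¹' (chart x).source, F p ∂ν.measure :=
        (setIntegral_eq_integral_of_forall_compl_eq_zero fun p hp => hF0 p hp).symm
    _ = ∫ p in Φ ⁻¹' (chart x).source, f (chart x (Φ p)) ∂ν.measure :=
        setIntegral_congr_fun hsrc fun p hp => hF p hp
    _ = ∫ y, f y ∂((ν.measure.restrict (Φ ⁻¹' (chart x).source)).map
          (fun p => chart x (Φ p))) :=
        (integral_map (hcont.aemeasurable hsrc) hf.aestronglyMeasurable).symm
    _ = ∫ y in (chart x).target, f y * (ρ ((chart x).symm y) * volCoord g x y) := by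
        rw [map_measure_eq ν g Φ hρ x]
        have h1 := integral_withDensity_eq_integral_toReal_smul₀
          (μ := volume.restrict (chart x).target)
          (f := fun y => ENNReal.ofReal (ρ ((chart x).symm y) * volCoord g x y))
          hfm.ennreal_ofReal (by simp) f
        rw [h1]
        refine integral_congr_ae ?_
        filter_upwards [hpos] with y hy
        rw [ENNReal.toReal_ofReal hy, smul_eq_mul, mul_comm]
    _ = ∫ y, f y * (ρ ((chart x).symm y) * volCoord g x y) :=
        setIntegral_eq_integral_of_forall_compl_eq_zero fun y hy => by rw [hf0 y hy, zero_mul]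

end Measure

/-! ### Families of diffeomorphisms in Lagrangian and Eulerian coordinates -/

section Family

variable {n : ℕ} {N M : Type*} [TopologicalSpace N] [ChartedSpace (Model n) N]
  [TopologicalSpace M] [ChartedSpace (Model n) M]

local notation "𝓔" => 𝓘(ℝ, Model n)
local notation "chart" => extChartAt 𝓘(ℝ, Model n)

/-- The family of maps `η` in the charts of `N` at `p` and of `M` at `x`, as a function of
`((s, t), y)`. -/
noncomputable def lagrCoord (η : ℝ → ℝ → N → M) (p : N) (x : M) (z : (ℝ × ℝ) × Model n) : Model n :=
  chart x (η z.1.1 z.1.2 ((chart p).symm z.2))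

/-- The domain on which the coordinate expression `lagrCoord` is meaningful. -/
def lagrDomain (S T : ℝ) (η : ℝ → ℝ → N → M) (p : N) (x : M) : Set ((ℝ × ℝ) × Model n) :=
  {z | (z.1.1 ∈ Ioo (-S) S ∧ z.1.2 ∈ Ioo (-T) T) ∧ z.2 ∈ (chart p).target ∧
    η z.1.1 z.1.2 ((chart p).symm z.2) ∈ (chart x).source}

/-- The parameters `((s, t), y)` for which `y` lies in the chart of `M` at `x`. -/
def eulerDomain (n : ℕ) [ChartedSpace (Model n) M] (S T : ℝ) (x : M) :
    Set ((ℝ × ℝ) × Model n) :=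
  (Ioo (-S) S ×ˢ Ioo (-T) T) ×ˢ (extChartAt 𝓘(ℝ, Model n) x).target

/-- The components in the chart at `x` of a two-parameter family of vector fields. -/
noncomputable def fieldCoord (x : M) (X : ℝ → ℝ → ∀ x : M, Tan n x) (z : (ℝ × ℝ) × Model n) :
    Model n :=
  coordRep x (X z.1.1 z.1.2) z.2

/-- A two-parameter family of functions in the chart at `x`. -/
noncomputable def funCoord (n : ℕ) [ChartedSpace (Model n) M] (x : M) (f : ℝ → ℝ → M → ℝ)
    (z : (ℝ × ℝ) × Model n) : ℝ :=
  f z.1.1 z.1.2 ((extChartAt 𝓘(ℝ, Model n) x).symm z.2)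

lemma isOpen_eulerDomain (S T : ℝ) (x : M) : IsOpen (eulerDomain n S T x) :=
  (isOpen_Ioo.prod isOpen_Ioo).prod (isOpen_chart_target x)

variable [IsManifold 𝓘(ℝ, Model n) ∞ N] [IsManifold 𝓘(ℝ, Model n) ∞ M]

lemma coordRep_chart {x₀ x : M} (hx : x ∈ (chart x₀).source) (Y : ∀ z : M, Tan n z) :
    coordRep x₀ Y (chart x₀ x) = mfderiv 𝓔 𝓔 (chart x₀) x (Y x) := by
  unfold coordRep
  rw [(chart x₀).left_inv hx]

lemma hasDerivAt_chart_comp {x₀ : M} {c : ℝ → M} {t : ℝ} (hx : c t ∈ (chart x₀).source)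
    (hc : MDifferentiableAt 𝓘(ℝ, ℝ) 𝓔 c t) :
    HasDerivAt (fun τ => chart x₀ (c τ)) (mfderiv 𝓔 𝓔 (chart x₀) (c t) (velocity c t)) t := by
  have hd : DifferentiableAt ℝ (fun τ => chart x₀ (c τ)) t :=
    mdifferentiableAt_iff_differentiableAt.mp ((mdifferentiableAt_chart hx).comp t hc)
  have h1 := mfderiv_comp t (mdifferentiableAt_chart hx) hc
  have h2 : deriv (fun τ => chart x₀ (c τ)) t =
      mfderiv 𝓔 𝓔 (chart x₀) (c t) (velocity c t) := by
    rw [← fderiv_apply_one_eq_deriv, ← mfderiv_eq_fderiv]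
    exact congrArg (fun L : ℝ →L[ℝ] Model n => L 1) h1
  exact h2 ▸ hd.hasDerivAt

variable {S T : ℝ} {η : ℝ → ℝ → N → M}

/-- The joint smoothness of the family, as a property of functions of `((s, t), p)`. -/
def SmoothFamily (n : ℕ) [ChartedSpace (Model n) N] [ChartedSpace (Model n) M] (S T : ℝ)
    (η : ℝ → ℝ → N → M) : Prop :=
  ∀ s, s ∈ Ioo (-S) S → ∀ t, t ∈ Ioo (-T) T → ∀ p : N,
    ContMDiffAt (𝓘(ℝ, ℝ).prod (𝓘(ℝ, ℝ).prod 𝓘(ℝ, Model n))) 𝓘(ℝ, Model n) ∞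
      (fun z : ℝ × ℝ × N => η z.1 z.2.1 z.2.2) (s, t, p)

lemma smoothFamily_of_contMDiffOn
    (hη : ContMDiffOn (𝓘(ℝ, ℝ).prod (𝓘(ℝ, ℝ).prod 𝓘(ℝ, Model n))) 𝓘(ℝ, Model n) ∞
      (fun z : ℝ × ℝ × N => η z.1 z.2.1 z.2.2) (Ioo (-S) S ×ˢ Ioo (-T) T ×ˢ univ)) :
    SmoothFamily n S T η := fun _ hs _ ht _ =>
  hη.contMDiffAt ((isOpen_Ioo.prod (isOpen_Ioo.prod isOpen_univ)).mem_nhds ⟨hs, ht, trivial⟩)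

/-- The passage from `((s, t), y)` to `(s, t, p)`, where `y` are the coordinates of `p`. -/
lemma contMDiffAt_param {p : N} {z : (ℝ × ℝ) × Model n} (hz : z.2 ∈ (chart p).target) :
    ContMDiffAt 𝓘(ℝ, (ℝ × ℝ) × Model n) (𝓘(ℝ, ℝ).prod (𝓘(ℝ, ℝ).prod 𝓔)) ∞
      (fun z : (ℝ × ℝ) × Model n => ((z.1.1, z.1.2, (chart p).symm z.2) : ℝ × ℝ × N)) z := by
  have h1 : ContMDiffAt 𝓘(ℝ, (ℝ × ℝ) × Model n) 𝓘(ℝ, ℝ) ∞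
      (fun z : (ℝ × ℝ) × Model n => z.1.1) z := by
    rw [contMDiffAt_iff_contDiffAt]; fun_prop
  have h2 : ContMDiffAt 𝓘(ℝ, (ℝ × ℝ) × Model n) 𝓘(ℝ, ℝ) ∞
      (fun z : (ℝ × ℝ) × Model n => z.1.2) z := by
    rw [contMDiffAt_iff_contDiffAt]; fun_prop
  have h3 : ContMDiffAt 𝓘(ℝ, (ℝ × ℝ) × Model n) 𝓔 ∞ (fun z : (ℝ × ℝ) × Model n => z.2) z := by
    rw [contMDiffAt_iff_contDiffAt]; fun_prop
  exact h1.prodMk (h2.prodMk ((contMDiffAt_chart_symm hz).comp z h3))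

lemma contDiffAt_param_comp {F : ℝ → ℝ → N → ℝ}
    (hF : ContMDiffOn (𝓘(ℝ, ℝ).prod (𝓘(ℝ, ℝ).prod 𝓘(ℝ, Model n))) 𝓘(ℝ, ℝ) ∞
      (fun z : ℝ × ℝ × N => F z.1 z.2.1 z.2.2) (Ioo (-S) S ×ˢ Ioo (-T) T ×ˢ univ))
    {p : N} {z : (ℝ × ℝ) × Model n} (hs : z.1.1 ∈ Ioo (-S) S) (ht : z.1.2 ∈ Ioo (-T) T)
    (hz : z.2 ∈ (chart p).target) :
    ContDiffAt ℝ ∞ (fun z : (ℝ × ℝ) × Model n => F z.1.1 z.1.2 ((chart p).symm z.2)) z := by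
  rw [← contMDiffAt_iff_contDiffAt]
  have h := hF.contMDiffAt ((isOpen_Ioo.prod (isOpen_Ioo.prod isOpen_univ)).mem_nhds
    (show ((z.1.1, z.1.2, (chart p).symm z.2) : ℝ × ℝ × N) ∈
      Ioo (-S) S ×ˢ Ioo (-T) T ×ˢ univ from ⟨hs, ht, trivial⟩))
  exact h.comp z (contMDiffAt_param hz)

lemma contDiffAt_lagrCoord (hη : SmoothFamily n S T η) {p : N} {x : M} {z : (ℝ × ℝ) × Model n}
    (hz : z ∈ lagrDomain S T η p x) : ContDiffAt ℝ ∞ (lagrCoord η p x) z := by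
  rw [← contMDiffAt_iff_contDiffAt]
  obtain ⟨⟨hs, ht⟩, hy, hx⟩ := hz
  have h1 := (hη _ hs _ ht ((chart p).symm z.2)).comp z (contMDiffAt_param hy)
  exact (contMDiffAt_chart hx).comp z h1

lemma lagrDomain_mem_nhds (hη : SmoothFamily n S T η) {p : N} {x : M} {z : (ℝ × ℝ) × Model n}
    (hz : z ∈ lagrDomain S T η p x) : lagrDomain S T η p x ∈ 𝓝 z := by
  obtain ⟨⟨hs, ht⟩, hy, hx⟩ := hz
  have h1 := ((hη _ hs _ ht ((chart p).symm z.2)).comp z (contMDiffAt_param hy)).continuousAt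
  have e1 : ∀ᶠ w : (ℝ × ℝ) × Model n in 𝓝 z, w.1.1 ∈ Ioo (-S) S :=
    (by fun_prop : Continuous fun w : (ℝ × ℝ) × Model n => w.1.1).continuousAt.eventually
      (isOpen_Ioo.mem_nhds hs)
  have e2 : ∀ᶠ w : (ℝ × ℝ) × Model n in 𝓝 z, w.1.2 ∈ Ioo (-T) T :=
    (by fun_prop : Continuous fun w : (ℝ × ℝ) × Model n => w.1.2).continuousAt.eventually
      (isOpen_Ioo.mem_nhds ht)
  have e3 : ∀ᶠ w : (ℝ × ℝ) × Model n in 𝓝 z, w.2 ∈ (chart p).target :=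
    continuous_snd.continuousAt.eventually ((isOpen_chart_target p).mem_nhds hy)
  have e4 := h1.eventually ((isOpen_chart_source x).mem_nhds hx)
  filter_upwards [e1, e2, e3, e4] with w h1 h2 h3 h4
  exact ⟨⟨h1, h2⟩, h3, h4⟩

lemma SmoothFamily.mdiff (hη : SmoothFamily n S T η) {s t : ℝ} (hs : s ∈ Ioo (-S) S)
    (ht : t ∈ Ioo (-T) T) (p : N) :
    MDifferentiableAt 𝓔 𝓔 (η s t) p ∧ MDifferentiableAt 𝓘(ℝ, ℝ) 𝓔 (fun τ => η s τ p) t ∧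
      MDifferentiableAt 𝓘(ℝ, ℝ) 𝓔 (fun σ => η σ t p) s := by
  have h := (hη s hs t ht p).mdifferentiableAt (by simp)
  refine ⟨?_, ?_, ?_⟩
  · exact MDifferentiableAt.comp (f := fun p : N => ((s, t, p) : ℝ × ℝ × N)) p h
        ((mdifferentiableAt_const (c := s)).prodMk
      ((mdifferentiableAt_const (c := t)).prodMk mdifferentiableAt_id))
  · exact MDifferentiableAt.comp (f := fun t : ℝ => ((s, t, p) : ℝ × ℝ × N)) t h
        ((mdifferentiableAt_const (c := s)).prodMk
      (mdifferentiableAt_id.prodMk (mdifferentiableAt_const (c := p))))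
  · exact MDifferentiableAt.comp (f := fun s : ℝ => ((s, t, p) : ℝ × ℝ × N)) s h
        (mdifferentiableAt_id.prodMk
      ((mdifferentiableAt_const (c := t)).prodMk (mdifferentiableAt_const (c := p))))

lemma fderiv_param_t {G : Type*} [NormedAddCommGroup G] [NormedSpace ℝ G]
    {f : (ℝ × ℝ) × Model n → G} {z : (ℝ × ℝ) × Model n} (hf : DifferentiableAt ℝ f z) :
    HasDerivAt (fun τ => f ((z.1.1, τ), z.2)) (fderiv ℝ f z ((0, 1), 0)) z.1.2 :=
  HasFDerivAt.comp_hasDerivAt (l := f) _ hf.hasFDerivAt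
    (((hasDerivAt_const _ _).prodMk (hasDerivAt_id _)).prodMk (hasDerivAt_const _ _))

lemma fderiv_param_s {G : Type*} [NormedAddCommGroup G] [NormedSpace ℝ G]
    {f : (ℝ × ℝ) × Model n → G} {z : (ℝ × ℝ) × Model n} (hf : DifferentiableAt ℝ f z) :
    HasDerivAt (fun σ => f ((σ, z.1.2), z.2)) (fderiv ℝ f z ((1, 0), 0)) z.1.1 :=
  HasFDerivAt.comp_hasDerivAt (l := f) _ hf.hasFDerivAt
    (((hasDerivAt_id _).prodMk (hasDerivAt_const _ _)).prodMk (hasDerivAt_const _ _))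

lemma fderiv_param_y {G : Type*} [NormedAddCommGroup G] [NormedSpace ℝ G]
    {f : (ℝ × ℝ) × Model n → G} {z : (ℝ × ℝ) × Model n} (hf : DifferentiableAt ℝ f z) :
    HasFDerivAt (fun y => f (z.1, y)) ((fderiv ℝ f z).comp (.inr ℝ (ℝ × ℝ) (Model n))) z.2 :=
  hf.hasFDerivAt.comp z.2 (hasFDerivAt_prodMk_right z.1 z.2)

/-- The components of the Eulerian velocity along the family are the velocity of the coordinates. -/
lemma fieldCoord_t_lagrCoord (hη : SmoothFamily n S T η) {u : ℝ → ℝ → ∀ x : M, Tan n x}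
    (hu : ∀ s ∈ Ioo (-S) S, ∀ t ∈ Ioo (-T) T, ∀ p,
      velocity (fun τ => η s τ p) t = u s t (η s t p)) {p : N} {x : M} {z : (ℝ × ℝ) × Model n}
    (hz : z ∈ lagrDomain S T η p x) :
    fieldCoord x u (z.1, lagrCoord η p x z) = fderiv ℝ (lagrCoord η p x) z ((0, 1), 0) := by
  obtain ⟨⟨hs, ht⟩, hy, hx⟩ := hz
  have h1 := fderiv_param_t ((contDiffAt_lagrCoord hη ⟨⟨hs, ht⟩, hy, hx⟩).differentiableAt
      (by simp))
  have h2 := hasDerivAt_chart_comp hx (hη.mdiff hs ht _).2.1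
  rw [← h2.unique h1, hu _ hs _ ht]
  exact coordRep_chart hx _

lemma fieldCoord_s_lagrCoord (hη : SmoothFamily n S T η) {j : ℝ → ℝ → ∀ x : M, Tan n x}
    (hj : ∀ s ∈ Ioo (-S) S, ∀ t ∈ Ioo (-T) T, ∀ p,
      velocity (fun σ => η σ t p) s = j s t (η s t p)) {p : N} {x : M} {z : (ℝ × ℝ) × Model n}
    (hz : z ∈ lagrDomain S T η p x) :
    fieldCoord x j (z.1, lagrCoord η p x z) = fderiv ℝ (lagrCoord η p x) z ((1, 0), 0) := by
  obtain ⟨⟨hs, ht⟩, hy, hx⟩ := hz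
  have h1 := fderiv_param_s ((contDiffAt_lagrCoord hη ⟨⟨hs, ht⟩, hy, hx⟩).differentiableAt
      (by simp))
  have h2 := hasDerivAt_chart_comp hx (hη.mdiff hs ht _).2.2
  rw [← h2.unique h1, hj _ hs _ ht]
  exact coordRep_chart hx _

variable {ν : VolumeForm n N} {g : Metric n M} {ρ : ℝ → ℝ → M → ℝ}

lemma funCoord_lagrCoord {f : ℝ → ℝ → M → ℝ} {p : N} {x : M} {z : (ℝ × ℝ) × Model n}
    (hz : z ∈ lagrDomain S T η p x) :
    funCoord n x f (z.1, lagrCoord η p x z) =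
      f z.1.1 z.1.2 (η z.1.1 z.1.2 ((chart p).symm z.2)) := by
  unfold funCoord lagrCoord
  rw [(chart x).left_inv hz.2.2]

/-- The density equation in the charts at `p` and `x`: the density in `x`, multiplied by the
Jacobian of the family, is the density of `ν`, which does not depend on the parameters. -/
lemma density_lagrCoord (hη : SmoothFamily n S T η)
    (hρ : ∀ s ∈ Ioo (-S) S, ∀ t ∈ Ioo (-T) T, IsDensity ν g (η s t) (ρ s t))
    {p : N} {x : M} {z : (ℝ × ℝ) × Model n} (hz : z ∈ lagrDomain S T η p x) :
    funCoord n x ρ (z.1, lagrCoord η p x z) * volCoord g x (lagrCoord η p x z) *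
      |((fderiv ℝ (lagrCoord η p x) z).comp (.inr ℝ (ℝ × ℝ) (Model n))).det| = nuCoord ν p z.2 := by
  have h1 := fderiv_param_y ((contDiffAt_lagrCoord hη hz).differentiableAt (by simp))
  rw [funCoord_lagrCoord hz]
  obtain ⟨⟨hs, ht⟩, hy, hx⟩ := hz
  rw [← (hρ _ hs _ ht).coord hy hx (hη.mdiff hs ht _).1, ← h1.fderiv]
  rfl

/-- The density equation makes the spatial derivative of the family invertible, as `ν` has no zeros.
-/
lemma det_lagrCoord_ne_zero (hη : SmoothFamily n S T η)
    (hρ : ∀ s ∈ Ioo (-S) S, ∀ t ∈ Ioo (-T) T, IsDensity ν g (η s t) (ρ s t))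
    {p : N} {x : M} {z : (ℝ × ℝ) × Model n} (hz : z ∈ lagrDomain S T η p x) :
    ((fderiv ℝ (lagrCoord η p x) z).comp (.inr ℝ (ℝ × ℝ) (Model n))).det ≠ 0 := by
  intro h0
  have h1 := density_lagrCoord hη hρ hz
  rw [h0, abs_zero, mul_zero] at h1
  exact (nuCoord_pos ν hz.2.1).ne h1

/-- Every Eulerian point `(s, t, y)` is the position of a particle. -/
lemma exists_lagrCoord (hsurj : ∀ s ∈ Ioo (-S) S, ∀ t ∈ Ioo (-T) T, Function.Surjective (η s t))
    {x : M} {w : (ℝ × ℝ) × Model n} (hw : w ∈ eulerDomain n S T x) :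
    ∃ p : N, ∃ z ∈ lagrDomain (n := n) S T η p x, (z.1, lagrCoord η p x z) = w := by
  obtain ⟨⟨hs, ht⟩, hy⟩ := hw
  obtain ⟨p, hp⟩ := hsurj _ hs _ ht ((chart x).symm w.2)
  refine ⟨p, (w.1, chart p p), ⟨⟨hs, ht⟩, mem_extChartAt_target p, ?_⟩, ?_⟩
  · rw [extChartAt_to_inv, hp]
    exact (chart x).map_target hy
  · unfold lagrCoord
    rw [extChartAt_to_inv, hp, (chart x).right_inv hy]

/-- Criterion for the smoothness of an Eulerian quantity `f`: it suffices that along the family, as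
a function `C p` of the coordinates of the particle near `p`, it is smooth. -/
lemma contDiffOn_euler (hη : SmoothFamily n S T η)
    (hρ : ∀ s ∈ Ioo (-S) S, ∀ t ∈ Ioo (-T) T, IsDensity ν g (η s t) (ρ s t))
    (hsurj : ∀ s ∈ Ioo (-S) S, ∀ t ∈ Ioo (-T) T, Function.Surjective (η s t))
    {G : Type*} [NormedAddCommGroup G] [NormedSpace ℝ G] {f : (ℝ × ℝ) × Model n → G} {x : M}
    (C : N → (ℝ × ℝ) × Model n → G)
    (hC : ∀ p, ∀ z ∈ lagrDomain S T η p x, ContDiffAt ℝ ∞ (C p) z ∧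
      f (z.1, lagrCoord η p x z) = C p z) : ContDiffOn ℝ ∞ f (eulerDomain n S T x) := by
  intro w hw
  obtain ⟨p, z, hz, rfl⟩ := exists_lagrCoord hsurj hw
  refine ContDiffAt.contDiffWithinAt ?_
  have hdet := det_lagrCoord_ne_zero hη hρ hz
  refine contDiffAt_of_comp_family (contDiffAt_lagrCoord hη hz)
    (ContinuousLinearMap.toContinuousLinearEquivOfDetNeZero _ hdet) ?_ (hC p z hz).1 ?_
  · exact (ContinuousLinearMap.coe_toContinuousLinearEquivOfDetNeZero _ hdet).symm
  · filter_upwards [lagrDomain_mem_nhds hη hz] with w hw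
    exact (hC p w hw).2

variable (hη : SmoothFamily n S T η)
    (hρ : ∀ s ∈ Ioo (-S) S, ∀ t ∈ Ioo (-T) T, IsDensity ν g (η s t) (ρ s t))
    (hsurj : ∀ s ∈ Ioo (-S) S, ∀ t ∈ Ioo (-T) T, Function.Surjective (η s t))

include hη hρ hsurj

lemma contDiffOn_fieldCoord_t {u : ℝ → ℝ → ∀ x : M, Tan n x}
    (hu : ∀ s ∈ Ioo (-S) S, ∀ t ∈ Ioo (-T) T, ∀ p,
      velocity (fun τ => η s τ p) t = u s t (η s t p)) (x : M) :
    ContDiffOn ℝ ∞ (fieldCoord x u) (eulerDomain n S T x) :=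
  contDiffOn_euler hη hρ hsurj (fun p z => fderiv ℝ (lagrCoord η p x) z ((0, 1), 0)) fun _ _ hz =>
    ⟨contDiffAt_fderiv_apply (contDiffAt_lagrCoord hη hz) _, fieldCoord_t_lagrCoord hη hu hz⟩

lemma contDiffOn_fieldCoord_s {j : ℝ → ℝ → ∀ x : M, Tan n x}
    (hj : ∀ s ∈ Ioo (-S) S, ∀ t ∈ Ioo (-T) T, ∀ p,
      velocity (fun σ => η σ t p) s = j s t (η s t p)) (x : M) :
    ContDiffOn ℝ ∞ (fieldCoord x j) (eulerDomain n S T x) :=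
  contDiffOn_euler hη hρ hsurj (fun p z => fderiv ℝ (lagrCoord η p x) z ((1, 0), 0)) fun _ _ hz =>
    ⟨contDiffAt_fderiv_apply (contDiffAt_lagrCoord hη hz) _, fieldCoord_s_lagrCoord hη hj hz⟩

/-- The density is smooth: along the family it is the quotient of the density of `ν` by the
Jacobian, which does not vanish. -/
lemma contDiffOn_funCoord_density (x : M) :
    ContDiffOn ℝ ∞ (funCoord n x ρ) (eulerDomain n S T x) := by
  refine contDiffOn_euler hη hρ hsurj (fun p z => nuCoord ν p z.2 /
    (volCoord g x (lagrCoord η p x z) *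
      |((fderiv ℝ (lagrCoord η p x) z).comp (.inr ℝ (ℝ × ℝ) (Model n))).det|)) fun p z hz => ?_
  have hdet := det_lagrCoord_ne_zero hη hρ hz
  have hl := contDiffAt_lagrCoord hη hz
  have hvol : 0 < volCoord g x (lagrCoord η p x z) := volCoord_pos g ((chart x).map_source hz.2.2)
  refine ⟨?_, ?_⟩
  · refine ContDiffAt.div ?_ ?_ (mul_pos hvol (abs_pos.mpr hdet)).ne'
    · exact ((contDiffOn_nuCoord ν p).contDiffAt ((isOpen_chart_target p).mem_nhds hz.2.1)).comp z
        contDiffAt_snd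
    · refine ContDiffAt.mul ?_ ?_
      · exact ContDiffAt.comp (g := volCoord g x) (f := lagrCoord η p x) z
          ((contDiffOn_volCoord g x).contDiffAt ((isOpen_chart_target x).mem_nhds
            ((chart x).map_source hz.2.2))) hl
      · refine ContDiffAt.abs ?_ hdet
        exact contDiff_det.contDiffAt.comp z
          ((hl.fderiv_right (m := ∞) (by simp)).clm_comp contDiffAt_const)
  · rw [← density_lagrCoord hη hρ hz, mul_assoc]
    rw [mul_div_cancel_right₀ _ (mul_pos hvol (abs_pos.mpr hdet)).ne']

lemma contDiffOn_funCoord_deriv {F : ℝ → ℝ → N → ℝ}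
    (hF : ContMDiffOn (𝓘(ℝ, ℝ).prod (𝓘(ℝ, ℝ).prod 𝓘(ℝ, Model n))) 𝓘(ℝ, ℝ) ∞
      (fun z : ℝ × ℝ × N => F z.1 z.2.1 z.2.2) (Ioo (-S) S ×ˢ Ioo (-T) T ×ˢ univ))
    {k : ℝ → ℝ → M → ℝ} (hk : ∀ s ∈ Ioo (-S) S, ∀ t ∈ Ioo (-T) T, ∀ p,
      deriv (fun τ => F s τ p) t = k s t (η s t p)) (x : M) :
    ContDiffOn ℝ ∞ (funCoord n x k) (eulerDomain n S T x) := by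
  refine contDiffOn_euler hη hρ hsurj (fun p z => fderiv ℝ
    (fun z : (ℝ × ℝ) × Model n => F z.1.1 z.1.2 ((chart p).symm z.2)) z
        ((0, 1), 0)) fun p z hz => ?_
  have hFc := contDiffAt_param_comp hF hz.1.1 hz.1.2 hz.2.1
  refine ⟨contDiffAt_fderiv_apply hFc _, ?_⟩
  rw [funCoord_lagrCoord hz, ← hk _ hz.1.1 _ hz.1.2]
  exact (fderiv_param_t (hFc.differentiableAt (by simp))).deriv

/-- The continuity equation for the density of the family, in a chart, in the parameter direction
`e` in which the family has the velocity field `V`. -/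
lemma continuity_coord {x : M} {e : ℝ × ℝ} {V : (ℝ × ℝ) × Model n → Model n}
    (hV : ContDiffOn ℝ ∞ V (eulerDomain n S T x))
    (hVc : ∀ p, ∀ z ∈ lagrDomain S T η p x,
      V (z.1, lagrCoord η p x z) = fderiv ℝ (lagrCoord η p x) z (e, 0))
    {w : (ℝ × ℝ) × Model n} (hw : w ∈ eulerDomain n S T x) :
    fderiv ℝ (fun w => funCoord n x ρ w * volCoord g x w.2) w (e, V w) +
      funCoord n x ρ w * volCoord g x w.2 *
        tr n ((fderiv ℝ V w).comp (.inr ℝ (ℝ × ℝ) (Model n))) = 0 := by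
  have hopen := isOpen_eulerDomain (n := n) S T x
  have hR : ContDiffAt ℝ ∞ (fun w => funCoord n x ρ w * volCoord g x w.2) w :=
    ((contDiffOn_funCoord_density hη hρ hsurj x).contDiffAt (hopen.mem_nhds hw)).mul
      (((contDiffOn_volCoord g x).contDiffAt ((isOpen_chart_target x).mem_nhds hw.2)).comp w
        contDiffAt_snd)
  have hVw := hV.contDiffAt (hopen.mem_nhds hw)
  obtain ⟨p, z, hz, rfl⟩ := exists_lagrCoord hsurj hw
  have hnear := lagrDomain_mem_nhds hη hz
  exact continuity_of_transport (R := fun w => funCoord n x ρ w * volCoord g x w.2)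
    (m := nuCoord ν p) (contDiffAt_lagrCoord hη hz) hVw hR
    (by filter_upwards [hnear] with w hw using hVc p w hw) (det_lagrCoord_ne_zero hη hρ hz)
    (by filter_upwards [hnear] with w hw using density_lagrCoord hη hρ hw)

/-- The compatibility of the velocity fields in two parameter directions, in a chart. -/
lemma velocity_compat_coord {x : M} {e e' : ℝ × ℝ} {V J : (ℝ × ℝ) × Model n → Model n}
    (hV : ContDiffOn ℝ ∞ V (eulerDomain n S T x)) (hJ : ContDiffOn ℝ ∞ J (eulerDomain n S T x))
    (hVc : ∀ p, ∀ z ∈ lagrDomain S T η p x,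
      V (z.1, lagrCoord η p x z) = fderiv ℝ (lagrCoord η p x) z (e, 0))
    (hJc : ∀ p, ∀ z ∈ lagrDomain S T η p x,
      J (z.1, lagrCoord η p x z) = fderiv ℝ (lagrCoord η p x) z (e', 0))
    {w : (ℝ × ℝ) × Model n} (hw : w ∈ eulerDomain n S T x) :
    fderiv ℝ V w (e', J w) = fderiv ℝ J w (e, V w) := by
  have hopen := isOpen_eulerDomain (n := n) S T x
  have hVw := hV.contDiffAt (hopen.mem_nhds hw)
  have hJw := hJ.contDiffAt (hopen.mem_nhds hw)
  obtain ⟨p, z, hz, rfl⟩ := exists_lagrCoord hsurj hw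
  have hnear := lagrDomain_mem_nhds hη hz
  exact velocity_compat (contDiffAt_lagrCoord hη hz) hVw hJw
    (by filter_upwards [hnear] with w hw using hVc p w hw)
    (by filter_upwards [hnear] with w hw using hJc p w hw)

end Family

/-! ### Shears of a chart -/

section Shear

variable {n : ℕ}

/-- The determinant of a rank one perturbation of the identity. -/
lemma det_id_add_smulRight (f : Model n →L[ℝ] ℝ) (a : Model n) :
    (ContinuousLinearMap.id ℝ (Model n) + f.smulRight a).det = 1 + f a := by
  have h := LinearMap.transvection.det (f : Model n →ₗ[ℝ] ℝ) a
  rw [ContinuousLinearMap.det]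
  rw [show ((f : Model n →ₗ[ℝ] ℝ) a) = f a from rfl] at h
  rw [← h]
  congr 1

/-- The shear that displaces the point with coordinates `y` at time `t` by `r θ(t, y) a`. -/
noncomputable def shear (θ : ℝ × Model n → ℝ) (a : Model n) (r : ℝ) (z : ℝ × Model n) : Model n :=
  z.2 + (r * θ z) • a

lemma hasFDerivAt_shear {θ : ℝ × Model n → ℝ} {z : ℝ × Model n} (hθ : DifferentiableAt ℝ θ z)
    (a : Model n) (r : ℝ) : HasFDerivAt (shear θ a r)
      (ContinuousLinearMap.snd ℝ ℝ (Model n) + (r • fderiv ℝ θ z).smulRight a) z :=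
  hasFDerivAt_snd.add ((hθ.hasFDerivAt.const_mul r).smul_const a)

lemma fderiv_shear_apply {θ : ℝ × Model n → ℝ} {z : ℝ × Model n} (hθ : DifferentiableAt ℝ θ z)
    (a : Model n) (r : ℝ) (v : ℝ × Model n) :
    fderiv ℝ (shear θ a r) z v = v.2 + (r * fderiv ℝ θ z v) • a := by
  rw [(hasFDerivAt_shear hθ a r).fderiv]
  simp

lemma det_fderiv_shear {θ : ℝ × Model n → ℝ} {z : ℝ × Model n} (hθ : DifferentiableAt ℝ θ z)
    (a : Model n) (r : ℝ) : ((fderiv ℝ (shear θ a r) z).comp (.inr ℝ ℝ (Model n))).det =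
      1 + r * fderiv ℝ θ z (0, a) := by
  have h : (fderiv ℝ (shear θ a r) z).comp (.inr ℝ ℝ (Model n)) =
      ContinuousLinearMap.id ℝ (Model n) +
        ((r • fderiv ℝ θ z).comp (.inr ℝ ℝ (Model n))).smulRight a := by
    ext1 v
    rw [(hasFDerivAt_shear hθ a r).fderiv]
    simp
  rw [h, det_id_add_smulRight]
  simp

end Shear

/-! ### Extension from a chart to the manifold -/

section ChartExtension

variable {n : ℕ} {M : Type*} [TopologicalSpace M] [ChartedSpace (Model n) M]

local notation "𝓔" => 𝓘(ℝ, Model n)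
local notation "chart" => extChartAt 𝓘(ℝ, Model n)

open Classical in
/-- The time-dependent function on `M` that is `f` in the chart at `x` and zero elsewhere. -/
noncomputable def chartExt (x : M) (f : ℝ × Model n → ℝ) (z : ℝ × M) : ℝ :=
  if z.2 ∈ (chart x).source then f (z.1, chart x z.2) else 0

lemma chartExt_of_mem {x : M} {f : ℝ × Model n → ℝ} {z : ℝ × M} (hz : z.2 ∈ (chart x).source) :
    chartExt x f z = f (z.1, chart x z.2) := if_pos hz

lemma chartExt_of_notMem {x : M} {f : ℝ × Model n → ℝ} {z : ℝ × M}
    (hz : z.2 ∉ (chart x).source) : chartExt x f z = 0 := if_neg hz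

/-- The set of points `(t, x)` whose coordinates lie in `K`. -/
def chartPreimage (x : M) (K : Set (ℝ × Model n)) : Set (ℝ × M) :=
  {z | z.2 ∈ (chart x).source ∧ (z.1, chart x z.2) ∈ K}

lemma isClosed_chartPreimage [T2Space M] (x : M) {K : Set (ℝ × Model n)} (hK : IsCompact K)
    (hKt : ∀ z ∈ K, z.2 ∈ (chart x).target) : IsClosed (chartPreimage x K) := by
  have h1 : chartPreimage x K = (fun z : ℝ × Model n => (z.1, (chart x).symm z.2)) '' K := by
    ext ⟨t, q⟩
    constructor
    · rintro ⟨h1, h2⟩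
      exact ⟨_, h2, Prod.ext rfl ((chart x).left_inv h1)⟩
    · rintro ⟨z, hz, h⟩
      obtain ⟨rfl, rfl⟩ := Prod.ext_iff.mp h
      refine ⟨(chart x).map_target (hKt z hz), ?_⟩
      show (z.1, chart x ((chart x).symm z.2)) ∈ K
      rw [(chart x).right_inv (hKt z hz)]
      exact hz
  rw [h1]
  refine (hK.image_of_continuousOn ?_).isClosed
  exact continuousOn_fst.prodMk ((continuousOn_extChartAt_symm x).comp continuousOn_snd hKt)

lemma chartExt_eventuallyEq_zero [T2Space M] (x : M) {K : Set (ℝ × Model n)} (hK : IsCompact K)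
    (hKt : ∀ z ∈ K, z.2 ∈ (chart x).target) {f : ℝ × Model n → ℝ} (hf : ∀ z ∉ K, f z = 0)
    {z : ℝ × M} (hz : z ∉ chartPreimage x K) : chartExt x f =ᶠ[𝓝 z] 0 := by
  filter_upwards [(isClosed_chartPreimage x hK hKt).isOpen_compl.mem_nhds hz] with w hw
  by_cases hs : w.2 ∈ (chart x).source
  · rw [chartExt_of_mem hs]
    exact hf _ fun h => hw ⟨hs, h⟩
  · exact chartExt_of_notMem hs

lemma isOpen_snd_chart_source (x : M) : IsOpen {z : ℝ × M | z.2 ∈ (chart x).source} :=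
  (isOpen_chart_source x).preimage continuous_snd

lemma continuous_chartExt [T2Space M] (x : M) {K : Set (ℝ × Model n)} (hK : IsCompact K)
    (hKt : ∀ z ∈ K, z.2 ∈ (chart x).target) {f : ℝ × Model n → ℝ} (hf : ∀ z ∉ K, f z = 0)
    (hfc : Continuous f) : Continuous (chartExt x f) := by
  rw [continuous_iff_continuousAt]
  intro z
  by_cases hz : z ∈ chartPreimage x K
  · have hs := (isOpen_snd_chart_source (n := n) x).mem_nhds hz.1
    have h1 : ContinuousAt (fun w : ℝ × M => f (w.1, chart x w.2)) z := by
      refine hfc.continuousAt.comp (continuousAt_fst.prodMk ?_)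
      exact ContinuousAt.comp (g := chart x) (f := Prod.snd)
          (continuousAt_extChartAt' hz.1) continuousAt_snd
    refine h1.congr ?_
    filter_upwards [hs] with w hw
    exact (chartExt_of_mem hw).symm
  · exact (continuousAt_const (y := (0 : ℝ))).congr
      (chartExt_eventuallyEq_zero x hK hKt hf hz).symm

variable [IsManifold 𝓘(ℝ, Model n) ∞ M]

lemma contMDiff_chartExt [T2Space M] (x : M) {K : Set (ℝ × Model n)} (hK : IsCompact K)
    (hKt : ∀ z ∈ K, z.2 ∈ (chart x).target) {f : ℝ × Model n → ℝ} (hf : ∀ z ∉ K, f z = 0)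
    (hfc : ContDiff ℝ ∞ f) : ContMDiff (𝓘(ℝ, ℝ).prod 𝓔) 𝓘(ℝ, ℝ) ∞ (chartExt x f) := by
  intro z
  by_cases hz : z ∈ chartPreimage x K
  · have hs := (isOpen_snd_chart_source (n := n) x).mem_nhds hz.1
    have h1 : ContMDiffAt (𝓘(ℝ, ℝ).prod 𝓔) 𝓘(ℝ, ℝ) ∞
        (fun w : ℝ × M => f (w.1, chart x w.2)) z := by
      refine ContMDiffAt.comp (g := f) (f := fun w : ℝ × M => (w.1, chart x w.2))
        (I' := 𝓘(ℝ, ℝ × Model n)) z hfc.contDiffAt.contMDiffAt ?_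
      refine ContMDiffAt.prodMk_space contMDiffAt_fst ?_
      exact ContMDiffAt.comp (g := chart x) (f := Prod.snd) z
          (contMDiffAt_chart hz.1) contMDiffAt_snd
    refine h1.congr_of_eventuallyEq ?_
    filter_upwards [hs] with w hw
    exact chartExt_of_mem hw
  · exact (contMDiffAt_const (c := (0 : ℝ))).congr_of_eventuallyEq
      (chartExt_eventuallyEq_zero x hK hKt hf hz)

open Classical in
/-- The map of `M` that is the shear `shear θ a r` in the chart at `x` and the identity elsewhere.
-/
noncomputable def shearMap (x : M) (θ : ℝ × Model n → ℝ) (a : Model n) (r t : ℝ) (q : M) : M :=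
  if q ∈ (chart x).source then (chart x).symm (shear θ a r (t, chart x q)) else q

lemma shearMap_of_mem {x q : M} {θ : ℝ × Model n → ℝ} {a : Model n} {r t : ℝ}
    (hq : q ∈ (chart x).source) :
    shearMap x θ a r t q = (chart x).symm (shear θ a r (t, chart x q)) := if_pos hq

lemma shearMap_of_eq_zero {x q : M} {θ : ℝ × Model n → ℝ} {a : Model n} {r t : ℝ}
    (h : q ∈ (chart x).source → r * θ (t, chart x q) = 0) : shearMap x θ a r t q = q := by
  by_cases hq : q ∈ (chart x).source
  · rw [shearMap_of_mem hq, shear, h hq, zero_smul, add_zero, (chart x).left_inv hq]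
  · exact if_neg hq

lemma shearMap_of_notMem {x q : M} {θ : ℝ × Model n → ℝ} {a : Model n} {r t : ℝ}
    (h : (t, q) ∉ chartPreimage x (tsupport θ)) : shearMap x θ a r t q = q :=
  shearMap_of_eq_zero fun hq => by
    rw [image_eq_zero_of_notMem_tsupport fun h' => h ⟨hq, h'⟩, mul_zero]

/-- The shear is smooth in `(r, t, q)`, as long as it does not leave the chart: off the support of
`θ` it is the identity, which makes the two cases of its definition fit together. -/
lemma contMDiffAt_shearMap [T2Space M] (x : M) {θ : ℝ × Model n → ℝ} (hθ : ContDiff ℝ ∞ θ)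
    (hθc : HasCompactSupport θ) (hθt : ∀ z ∈ tsupport θ, z.2 ∈ (chart x).target) (a : Model n)
    {w : ℝ × ℝ × M}
    (hw : ∀ z ∈ tsupport θ, shear θ a w.1 z ∈ (chart x).target) :
    ContMDiffAt (𝓘(ℝ, ℝ).prod (𝓘(ℝ, ℝ).prod 𝓔)) 𝓔 ∞
      (fun w : ℝ × ℝ × M => shearMap x θ a w.1 w.2.1 w.2.2) w := by
  have hsnd : ContMDiffAt (𝓘(ℝ, ℝ).prod (𝓘(ℝ, ℝ).prod 𝓔)) 𝓔 ∞ (fun w : ℝ × ℝ × M => w.2.2) w :=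
    contMDiffAt_snd.comp (g := Prod.snd) w contMDiffAt_snd
  by_cases hz : w.2 ∈ chartPreimage x (tsupport θ)
  · have hs : {w : ℝ × ℝ × M | w.2.2 ∈ (chart x).source} ∈ 𝓝 w :=
      ((isOpen_snd_chart_source (n := n) x).preimage continuous_snd).mem_nhds hz.1
    have h0 : ContMDiffAt (𝓘(ℝ, ℝ).prod (𝓘(ℝ, ℝ).prod 𝓔)) 𝓘(ℝ, ℝ × Model n) ∞
        (fun w : ℝ × ℝ × M => (w.2.1, chart x w.2.2)) w := by
      refine ContMDiffAt.prodMk_space (contMDiffAt_fst.comp (g := Prod.fst) w contMDiffAt_snd) ?_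
      exact ContMDiffAt.comp (g := chart x) (f := fun w : ℝ × ℝ × M => w.2.2) w
          (contMDiffAt_chart hz.1) hsnd
    have h1 : ContMDiffAt (𝓘(ℝ, ℝ).prod (𝓘(ℝ, ℝ).prod 𝓔)) 𝓔 ∞
        (fun w : ℝ × ℝ × M => shear θ a w.1 (w.2.1, chart x w.2.2)) w := by
      have hS : ContDiff ℝ ∞ fun q : ℝ × (ℝ × Model n) => shear θ a q.1 q.2 := by
        unfold shear
        exact (contDiff_snd.comp contDiff_snd).add
          ((contDiff_fst.mul (hθ.comp contDiff_snd)).smul contDiff_const)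
      exact ContMDiffAt.comp (g := fun q : ℝ × (ℝ × Model n) => shear θ a q.1 q.2)
        (f := fun w : ℝ × ℝ × M => (w.1, (w.2.1, chart x w.2.2)))
        (I' := 𝓘(ℝ, ℝ × (ℝ × Model n))) w hS.contDiffAt.contMDiffAt
        (contMDiffAt_fst.prodMk_space h0)
    have h2 := ContMDiffAt.comp (g := (chart x).symm)
      (f := fun w : ℝ × ℝ × M => shear θ a w.1 (w.2.1, chart x w.2.2)) w
      (contMDiffAt_chart_symm (hw _ hz.2)) h1
    refine h2.congr_of_eventuallyEq ?_
    filter_upwards [hs] with w hw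
    exact shearMap_of_mem hw
  · refine hsnd.congr_of_eventuallyEq ?_
    filter_upwards [((isClosed_chartPreimage x hθc.isCompact hθt).isOpen_compl.preimage
      continuous_snd).mem_nhds hz] with w hw
    exact shearMap_of_notMem hw

end ChartExtension

/-! ### The integrand of the energy -/

section EnergyDensity

variable {n : ℕ} {N M : Type*} [TopologicalSpace N] [ChartedSpace (Model n) N]
  [TopologicalSpace M] [ChartedSpace (Model n) M]
  [IsManifold 𝓘(ℝ, Model n) ∞ N] [IsManifold 𝓘(ℝ, Model n) ∞ M]

local notation "𝓔" => 𝓘(ℝ, Model n)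
local notation "chart" => extChartAt 𝓘(ℝ, Model n)

/-- The integrand of the energy at the time `t` and the particle `p`. -/
noncomputable def energyDensity (ν : VolumeForm n N) (g : Metric n M) (lam : ℝ → ℝ)
    (η : ℝ → N → M) (F : ℝ → N → ℝ) (t : ℝ) (p : N) : ℝ :=
  lam (particleDensity ν g (η t) p) / particleDensity ν g (η t) p *
      (deriv (fun τ => F τ p) t * deriv (fun τ => F τ p) t) +
    g.inner (η t p) (velocity (fun τ => η τ p) t) (velocity (fun τ => η τ p) t)

/-- The integrand of the energy at `(t, p)` depends on the germ of the curve at `(t, p)` only. -/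
lemma energyDensity_congr {ν : VolumeForm n N} {g : Metric n M} {lam : ℝ → ℝ} {η η' : ℝ → N → M}
    {F F' : ℝ → N → ℝ} {t : ℝ} {p : N}
    (hη : (fun z : ℝ × N => η' z.1 z.2) =ᶠ[𝓝 (t, p)] fun z => η z.1 z.2)
    (hF : (fun z : ℝ × N => F' z.1 z.2) =ᶠ[𝓝 (t, p)] fun z => F z.1 z.2) :
    energyDensity ν g lam η' F' t p = energyDensity ν g lam η F t p := by
  have ct : Tendsto (fun τ : ℝ => (τ, p)) (𝓝 t) (𝓝 (t, p)) :=
    (Continuous.prodMk_left p).tendsto t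
  have cp : Tendsto (fun q : N => (t, q)) (𝓝 p) (𝓝 (t, p)) :=
    (Continuous.prodMk_right t).tendsto p
  have h1 : (fun τ => F' τ p) =ᶠ[𝓝 t] fun τ => F τ p := ct.eventually hF
  have h2 : (fun τ => η' τ p) =ᶠ[𝓝 t] fun τ => η τ p := ct.eventually hη
  have h3 : η' t =ᶠ[𝓝 p] η t := cp.eventually hη
  have h4 : η' t p = η t p := h3.self_of_nhds
  have h5 : ∀ w : Tan n p, (mfderiv 𝓔 𝓔 (η' t) p w : Model n) = mfderiv 𝓔 𝓔 (η t) p w := fun w =>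
    congrArg (fun L : Model n →L[ℝ] Model n => L w) (h3.mfderiv_eq (I := 𝓔) (I' := 𝓔))
  have h6 : (velocity (fun τ => η' τ p) t : Model n) = velocity (fun τ => η τ p) t :=
    congrArg (fun L : ℝ →L[ℝ] Model n => L 1) (h2.mfderiv_eq (I := 𝓘(ℝ, ℝ)) (I' := 𝓔))
  have key : ∀ z z' : M, z' = z → ∀ v v' : Model n, v' = v →
      g.inner z' (show Tan n z' from v') (show Tan n z' from v') =
        g.inner z (show Tan n z from v) (show Tan n z from v) := by
    rintro z _ rfl v _ rfl; rfl
  have key2 : ∀ z z' : M, z' = z → ∀ v v' : Fin n → Model n, v' = v →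
      riemVol g z' (fun i => (show Tan n z' from v' i)) =
        riemVol g z (fun i => (show Tan n z from v i)) := by
    rintro z _ rfl v _ rfl; rfl
  have h7 : particleDensity ν g (η' t) p = particleDensity ν g (η t) p :=
    congrArg (fun c => |ν.toFun p fun i => (stdVec i : Model n)| / c)
      (key2 _ _ h4 _ _ (funext fun i => h5 (stdVec i : Model n)))
  have h8 := key _ _ h4 _ _ h6
  unfold energyDensity
  rw [h7, h1.deriv_eq]
  exact congrArg _ h8

/-- The coordinate expression of the integrand of the energy in terms of the density `r`, the
derivative `κ` of the function component, and the velocity `w` at the point `y`. -/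
noncomputable def coordEnergy (g : Metric n M) (lam : ℝ → ℝ) (x : M) (r κ : ℝ)
    (w y : Model n) : ℝ :=
  lam r / r * (κ * κ) + metricCoord g x w w y

/-- The integrand of the energy for a curve that arises from `(η, F)` by composition with a
time-dependent map `S` and addition of a time-dependent function `f`, both given in a chart of
`M`. -/
lemma energyDensity_coord {ν : VolumeForm n N} {g : Metric n M} {lam : ℝ → ℝ} {η H : ℝ → N → M}
    {F K : ℝ → N → ℝ} {t : ℝ} {p : N} {x : M} {ρ : M → ℝ} (hρ : IsDensity ν g (η t) ρ)
    (hη : ContMDiffAt (𝓘(ℝ, ℝ).prod 𝓔) 𝓔 ∞ (fun z : ℝ × N => η z.1 z.2) (t, p))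
    (hH : ContMDiffAt (𝓘(ℝ, ℝ).prod 𝓔) 𝓔 ∞ (fun z : ℝ × N => H z.1 z.2) (t, p))
    (hF : DifferentiableAt ℝ (fun τ => F τ p) t)
    (hx : η t p ∈ (chart x).source) (hxH : H t p ∈ (chart x).source)
    {S : ℝ × Model n → Model n} {f : ℝ × Model n → ℝ}
    (hS : DifferentiableAt ℝ S (t, chart x (η t p)))
        (hf : DifferentiableAt ℝ f (t, chart x (η t p)))
    (hHS : ∀ᶠ z : ℝ × N in 𝓝 (t, p), chart x (H z.1 z.2) = S (z.1, chart x (η z.1 z.2)))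
    (hKf : ∀ᶠ τ in 𝓝 t, K τ p = F τ p + f (τ, chart x (η τ p)))
    {V : Model n} (hV : mfderiv 𝓔 𝓔 (chart x) (η t p) (velocity (fun τ => η τ p) t) = V) :
    energyDensity ν g lam H K t p = coordEnergy g lam x
      (ρ (η t p) * volCoord g x (chart x (η t p)) / (volCoord g x (S (t, chart x (η t p))) *
        |((fderiv ℝ S (t, chart x (η t p))).comp (.inr ℝ ℝ (Model n))).det|))
      (deriv (fun τ => F τ p) t + fderiv ℝ f (t, chart x (η t p)) (1, V))
      (fderiv ℝ S (t, chart x (η t p)) (1, V)) (S (t, chart x (η t p))) := by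
  have ct : Tendsto (fun τ : ℝ => (τ, p)) (𝓝 t) (𝓝 (t, p)) :=
    (Continuous.prodMk_left p).tendsto t
  have cp : Tendsto (fun q : N => (t, q)) (𝓝 p) (𝓝 (t, p)) :=
    (Continuous.prodMk_right t).tendsto p
  have mt : ∀ {h : ℝ → N → M}, ContMDiffAt (𝓘(ℝ, ℝ).prod 𝓔) 𝓔 ∞ (fun z : ℝ × N => h z.1 z.2)
      (t, p) →
      MDifferentiableAt 𝓘(ℝ, ℝ) 𝓔 (fun τ => h τ p) t := fun hh =>
    MDifferentiableAt.comp (f := fun τ : ℝ => (τ, p)) t (hh.mdifferentiableAt (by simp))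
      (mdifferentiableAt_id.prodMk (mdifferentiableAt_const (c := p)))
  have mp : ∀ {h : ℝ → N → M}, ContMDiffAt (𝓘(ℝ, ℝ).prod 𝓔) 𝓔 ∞ (fun z : ℝ × N => h z.1 z.2)
      (t, p) →
      MDifferentiableAt 𝓔 𝓔 (h t) p := fun hh =>
    MDifferentiableAt.comp (f := fun q : N => (t, q)) p (hh.mdifferentiableAt (by simp))
      ((mdifferentiableAt_const (c := t)).prodMk mdifferentiableAt_id)
  set y := chart x (η t p) with hy
  set L := fderiv ℝ S (t, y) with hL
  have hHy : chart x (H t p) = S (t, y) := hHS.self_of_nhds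
  -- the velocity in the chart
  have hcη : HasDerivAt (fun τ => chart x (η τ p)) V t := hV ▸ hasDerivAt_chart_comp hx (mt hη)
  have hpair : HasDerivAt (fun τ => (τ, chart x (η τ p))) (1, V) t := (hasDerivAt_id t).prodMk hcη
  have hvel : mfderiv 𝓔 𝓔 (chart x) (H t p) (velocity (fun τ => H τ p) t) = L (1, V) := by
    have h1 := hasDerivAt_chart_comp hxH (mt hH)
    have h2 : HasDerivAt (fun τ => S (τ, chart x (η τ p))) (L (1, V)) t :=
      HasFDerivAt.comp_hasDerivAt (l := S) t hS.hasFDerivAt hpair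
    exact h1.unique (h2.congr_of_eventuallyEq (ct.eventually hHS))
  -- the derivative of the function component
  have hK : deriv (fun τ => K τ p) t = deriv (fun τ => F τ p) t + fderiv ℝ f (t, y) (1, V) := by
    have h2 : HasDerivAt (fun τ => f (τ, chart x (η τ p))) (fderiv ℝ f (t, y) (1, V)) t :=
      HasFDerivAt.comp_hasDerivAt (l := f) t hf.hasFDerivAt hpair
    exact ((hF.hasDerivAt.add h2).congr_of_eventuallyEq hKf).deriv
  -- the spatial derivative in the chart
  set A : Model n →L[ℝ] Model n := (mfderiv 𝓔 𝓔 (chart x) (η t p)).comp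
      (mfderiv 𝓔 𝓔 (η t) p) with hA
  have hspace : ∀ w : Tan n p, mfderiv 𝓔 𝓔 (chart x) (H t p) (mfderiv 𝓔 𝓔 (H t) p w) =
      (L.comp (.inr ℝ ℝ (Model n))).comp A w := by
    intro w
    have e1 := mfderiv_comp p (mdifferentiableAt_chart hxH) (mp hH)
    have e2 := mfderiv_comp p (mdifferentiableAt_chart hx) (mp hη)
    have hSy : HasFDerivAt (fun v : Model n => S (t, v)) (L.comp (.inr ℝ ℝ (Model n))) y :=
      hS.hasFDerivAt.comp y (hasFDerivAt_prodMk_right t y)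
    have e3 := mfderiv_comp (g := fun v : Model n => S (t, v)) p
      (hSy.differentiableAt.mdifferentiableAt) ((mdifferentiableAt_chart hx).comp p (mp hη))
    have e4 : (chart x ∘ H t) =ᶠ[𝓝 p] (fun v : Model n => S (t, v)) ∘ (chart x ∘ η t) :=
      cp.eventually hHS
    have e5 := e4.mfderiv_eq (I := 𝓔) (I' := 𝓔)
    have e6 : mfderiv 𝓔 𝓔 (fun v : Model n => S (t, v)) y = L.comp (.inr ℝ ℝ (Model n)) := by
      rw [mfderiv_eq_fderiv]; exact hSy.fderiv
    have f1 := congrArg (fun B : Model n →L[ℝ] Model n => B w) e1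
    have f2 := congrArg (fun B : Model n →L[ℝ] Model n => B w) e2
    have f3 := congrArg (fun B : Model n →L[ℝ] Model n => B w) e3
    have f5 := congrArg (fun B : Model n →L[ℝ] Model n => B w) e5
    have f6 := congrArg (fun B : Model n →L[ℝ] Model n =>
      B (mfderiv 𝓔 𝓔 (chart x ∘ η t) p w)) e6
    have f7 := congrArg (fun v : Model n => (L.comp (.inr ℝ ℝ (Model n))) v) f2
    exact f1.symm.trans (f5.trans (f3.trans (f6.trans f7)))
  have hvolη : riemVol g (η t p) (fun i => mfderiv 𝓔 𝓔 (η t) p (stdVec i : Model n)) =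
      volCoord g x y * |A.det| :=
    riemVol_eq_volCoord g hx _ A fun i => rfl
  have hvolH : riemVol g (H t p) (fun i => mfderiv 𝓔 𝓔 (H t) p (stdVec i : Model n)) =
      volCoord g x (S (t, y)) * |((L.comp (.inr ℝ ℝ (Model n))).comp A).det| := by
    rw [← hHy]
    exact riemVol_eq_volCoord g hxH _ _ fun i => hspace (stdVec i : Model n)
  have hdetc : ((L.comp (.inr ℝ ℝ (Model n))).comp A).det =
      (L.comp (.inr ℝ ℝ (Model n))).det * A.det := by
    rw [det_eq_det_stdMatrix, stdMatrix_comp, Matrix.det_mul, ← det_eq_det_stdMatrix,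
      ← det_eq_det_stdMatrix]
  have hpd : particleDensity ν g (H t) p = ρ (η t p) * volCoord g x y /
      (volCoord g x (S (t, y)) * |(L.comp (.inr ℝ ℝ (Model n))).det|) := by
    have h1 := hρ p fun i => (stdVec i : Model n)
    have h2 := hρ.riemVol_pos p
    rw [hvolη] at h1 h2
    have hAne : |A.det| ≠ 0 := fun h => by rw [h, mul_zero] at h2; exact lt_irrefl _ h2
    rw [particleDensity, hvolH, ← h1, hdetc, abs_mul, ← mul_assoc, ← mul_assoc,
      mul_div_mul_right _ _ hAne]
  unfold energyDensity coordEnergy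
  rw [hpd, hK, inner_eq_metricCoord g hxH, hvel, hHy]

end EnergyDensity

/-! ### Smoothness of the metric coefficients along maps -/

section MetricSmooth

variable {n : ℕ} {M : Type*} [TopologicalSpace M] [ChartedSpace (Model n) M]
  [IsManifold 𝓘(ℝ, Model n) ∞ M]

local notation "𝓔" => 𝓘(ℝ, Model n)
local notation "chart" => extChartAt 𝓘(ℝ, Model n)

lemma contDiffOn_coord {Z : Type*} [NormedAddCommGroup Z] [NormedSpace ℝ Z] {s : Set Z}
    {v : Z → Model n} (hv : ContDiffOn ℝ ∞ v s) (i : Fin n) : ContDiffOn ℝ ∞ (fun z => v z i) s :=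
  (EuclideanSpace.proj i : Model n →L[ℝ] ℝ).contDiff.comp_contDiffOn hv

lemma contDiffOn_metricCoord_comp (g : Metric n M) (x : M) {Z : Type*} [NormedAddCommGroup Z]
    [NormedSpace ℝ Z] {s : Set Z} {v w y : Z → Model n} (hv : ContDiffOn ℝ ∞ v s)
    (hw : ContDiffOn ℝ ∞ w s) (hy : ContDiffOn ℝ ∞ y s) (hys : ∀ z ∈ s, y z ∈ (chart x).target) :
    ContDiffOn ℝ ∞ (fun z => metricCoord g x (v z) (w z) (y z)) s := by
  have h : (fun z => metricCoord g x (v z) (w z) (y z)) = fun z => ∑ a, ∑ b,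
      v z a * (w z b * metricCoord g x (stdVec a) (stdVec b) (y z)) := by
    ext z; exact metricCoord_expand g x _ _ _
  rw [h]
  exact ContDiffOn.sum fun a _ => ContDiffOn.sum fun b _ => (contDiffOn_coord hv a).mul
    ((contDiffOn_coord hw b).mul ((contDiffOn_metricCoord g x _ _).comp hy hys))

lemma fderiv_metricCoord_expand (g : Metric n M) {x : M} {y : Model n} (hy : y ∈ (chart x).target)
    (v w e : Model n) : fderiv ℝ (metricCoord g x v w) y e = ∑ a, ∑ b,
      v a * (w b * fderiv ℝ (metricCoord g x (stdVec a) (stdVec b)) y e) := by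
  have h : metricCoord g x v w = fun y => ∑ a, ∑ b,
      v a * (w b * metricCoord g x (stdVec a) (stdVec b) y) := by
    ext z; exact metricCoord_expand g x _ _ _
  have hd : ∀ a b, HasFDerivAt (metricCoord g x (stdVec a) (stdVec b))
      (fderiv ℝ (metricCoord g x (stdVec a) (stdVec b)) y) y := fun a b =>
    (((contDiffOn_metricCoord g x _ _).contDiffAt
      ((isOpen_chart_target x).mem_nhds hy)).differentiableAt (by simp)).hasFDerivAt
  have h2 := HasFDerivAt.fun_sum (u := Finset.univ) fun a _ =>
    HasFDerivAt.fun_sum (u := Finset.univ) fun b _ => ((hd a b).const_mul (w b)).const_mul (v a)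
  rw [h, h2.fderiv]
  simp

lemma contDiffOn_fderiv_metricCoord_comp (g : Metric n M) (x : M) {Z : Type*}
    [NormedAddCommGroup Z] [NormedSpace ℝ Z] {s : Set Z} {v w y : Z → Model n}
    (hv : ContDiffOn ℝ ∞ v s) (hw : ContDiffOn ℝ ∞ w s) (hy : ContDiffOn ℝ ∞ y s)
    (hys : ∀ z ∈ s, y z ∈ (chart x).target) (e : Model n) :
    ContDiffOn ℝ ∞ (fun z => fderiv ℝ (metricCoord g x (v z) (w z)) (y z) e) s := by
  have h : EqOn (fun z => fderiv ℝ (metricCoord g x (v z) (w z)) (y z) e) (fun z => ∑ a, ∑ b,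
      v z a * (w z b * fderiv ℝ (metricCoord g x (stdVec a) (stdVec b)) (y z) e)) s :=
    fun z hz => fderiv_metricCoord_expand g (hys z hz) _ _ _
  refine ContDiffOn.congr ?_ h
  have hd : ∀ a b, ContDiffOn ℝ ∞
      (fun y => fderiv ℝ (metricCoord g x (stdVec a) (stdVec b)) y e) (chart x).target :=
    fun a b y hy => (contDiffAt_fderiv_apply ((contDiffOn_metricCoord g x _ _).contDiffAt
      ((isOpen_chart_target x).mem_nhds hy)) e).contDiffWithinAt
  exact ContDiffOn.sum fun a _ => ContDiffOn.sum fun b _ => (contDiffOn_coord hv a).mul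
    ((contDiffOn_coord hw b).mul ((hd a b).comp hy hys))

lemma metricCoord_add_smul (g : Metric n M) (x : M) (v a : Model n) (c : ℝ) (y : Model n) :
    metricCoord g x (v + c • a) (v + c • a) y = metricCoord g x v v y +
      2 * c * metricCoord g x v a y + c ^ 2 * metricCoord g x a a y := by
  have h := congrFun (metricCoord_comm g x a v) y
  rw [metricCoord_eq_pullbackForm, metricCoord_eq_pullbackForm] at h
  simp only [metricCoord_eq_pullbackForm, map_add, map_smul, add_apply, smul_apply, smul_eq_mul]
  rw [h]
  ring

end MetricSmooth

/-! ### The integrand of the energy under a shear -/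

section Perturbation

variable {n : ℕ} {M : Type*} [TopologicalSpace M] [ChartedSpace (Model n) M]
  [IsManifold 𝓘(ℝ, Model n) ∞ M]

local notation "𝓔" => 𝓘(ℝ, Model n)
local notation "chart" => extChartAt 𝓘(ℝ, Model n)

/-- The energy integrand of the sheared curve in the chart at `x`, where `V`, `R`, `κ` are the
velocity field, the density and the derivative of the function component of the original curve,
and where the function component is perturbed by `r b θ`. -/
noncomputable def shearedEnergy (g : Metric n M) (lam : ℝ → ℝ) (x : M) (θ : ℝ × Model n → ℝ)
    (a : Model n) (b : ℝ) (V : ℝ × Model n → Model n) (R κ : ℝ × Model n → ℝ) (r : ℝ)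
    (z : ℝ × Model n) : ℝ :=
  coordEnergy g lam x
    (R z * volCoord g x z.2 / (volCoord g x (shear θ a r z) * (1 + r * fderiv ℝ θ z (0, a))))
    (κ z + r * b * fderiv ℝ θ z (1, V z)) (V z + (r * fderiv ℝ θ z (1, V z)) • a) (shear θ a r z)

/-- The pairs `(r, z)` for which the shear of size `r` stays in the chart and is a local
diffeomorphism at `z`. -/
def shearDomain (x : M) (U : Set (ℝ × Model n)) (θ : ℝ × Model n → ℝ) (a : Model n) :
    Set (ℝ × (ℝ × Model n)) :=
  {q | q.2 ∈ U ∧ shear θ a q.1 q.2 ∈ (chart x).target ∧ 0 < 1 + q.1 * fderiv ℝ θ q.2 (0, a)}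

variable {x : M} {U : Set (ℝ × Model n)} {θ : ℝ × Model n → ℝ} {a : Model n} {b : ℝ}

lemma contDiff_shear (hθ : ContDiff ℝ ∞ θ) (a : Model n) :
    ContDiff ℝ ∞ fun q : ℝ × (ℝ × Model n) => shear θ a q.1 q.2 := by
  unfold shear
  exact (contDiff_snd.comp contDiff_snd).add
    ((contDiff_fst.mul (hθ.comp contDiff_snd)).smul contDiff_const)

lemma contDiff_fderiv_const (hθ : ContDiff ℝ ∞ θ) (v : ℝ × Model n) :
    ContDiff ℝ ∞ fun z => fderiv ℝ θ z v :=
  contDiff_iff_contDiffAt.mpr fun _ => contDiffAt_fderiv_apply hθ.contDiffAt v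

lemma isOpen_shearDomain (hU : IsOpen U) (hθ : ContDiff ℝ ∞ θ) :
    IsOpen (shearDomain x U θ a) := by
  refine (hU.preimage continuous_snd).inter
    (((isOpen_chart_target x).preimage (contDiff_shear hθ a).continuous).inter ?_)
  exact isOpen_lt continuous_const (continuous_const.add
    (continuous_fst.mul ((contDiff_fderiv_const hθ (0, a)).continuous.comp continuous_snd)))

lemma zero_mem_shearDomain (hUt : ∀ z ∈ U, z.2 ∈ (extChartAt 𝓘(ℝ, Model n) x).target)
    {z : ℝ × Model n} (hz : z ∈ U) :
    ((0 : ℝ), z) ∈ shearDomain x U θ a :=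
  ⟨hz, by simpa [shear] using hUt z hz, by simp⟩

lemma fderiv_eq_zero_of_notMem_tsupport {Z : Type*} [NormedAddCommGroup Z] [NormedSpace ℝ Z]
    {θ : Z → ℝ} {z : Z} (hz : z ∉ tsupport θ) : fderiv ℝ θ z = 0 := by
  rw [(notMem_tsupport_iff_eventuallyEq.mp hz).fderiv_eq]
  simp

variable {g : Metric n M} {lam : ℝ → ℝ} {V : ℝ × Model n → Model n} {R κ : ℝ × Model n → ℝ}

lemma shearedEnergy_of_notMem {z : ℝ × Model n} (hz : z ∉ tsupport θ) (r : ℝ) :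
    shearedEnergy g lam x θ a b V R κ r z = shearedEnergy g lam x θ a b V R κ 0 z := by
  simp [shearedEnergy, shear, fderiv_eq_zero_of_notMem_tsupport hz,
    image_eq_zero_of_notMem_tsupport hz]

lemma shearedEnergy_zero {z : ℝ × Model n} (hz : z.2 ∈ (chart x).target) :
    shearedEnergy g lam x θ a b V R κ 0 z = coordEnergy g lam x (R z) (κ z) (V z) z.2 := by
  have := (volCoord_pos g hz).ne'
  simp [shearedEnergy, shear, mul_div_cancel_right₀ _ this]

variable (hlam : ContDiffOn ℝ ∞ lam (Ioi 0)) (hU : IsOpen U)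
  (hUt : ∀ z ∈ U, z.2 ∈ (extChartAt 𝓘(ℝ, Model n) x).target) (hθ : ContDiff ℝ ∞ θ)
      (hV : ContDiffOn ℝ ∞ V U)
  (hR : ContDiffOn ℝ ∞ R U) (hR0 : ∀ z ∈ U, 0 < R z) (hκ : ContDiffOn ℝ ∞ κ U)

lemma contDiffOn_div_self {lam : ℝ → ℝ} (hlam : ContDiffOn ℝ ∞ lam (Ioi 0)) :
    ContDiffOn ℝ ∞ (fun r => lam r / r) (Ioi 0) :=
  hlam.div contDiffOn_id fun _ hr => (ne_of_gt hr)

include hlam hUt hθ hV hR hR0 hκ in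
/-- The energy integrand of the sheared curve is jointly smooth in the size `r` of the shear and the
point, which allows differentiation under the integral. -/
lemma contDiffOn_shearedEnergy : ContDiffOn ℝ ∞
    (fun q : ℝ × (ℝ × Model n) => shearedEnergy g lam x θ a b V R κ q.1 q.2)
    (shearDomain x U θ a) := by
  have hsnd : ContDiffOn ℝ ∞ (fun q : ℝ × (ℝ × Model n) => q.2) (shearDomain x U θ a) :=
    contDiffOn_snd
  have hmaps : MapsTo (fun q : ℝ × (ℝ × Model n) => q.2) (shearDomain x U θ a) U :=
    fun q hq => hq.1
  have hfst : ContDiffOn ℝ ∞ (fun q : ℝ × (ℝ × Model n) => q.1) (shearDomain x U θ a) :=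
    contDiffOn_fst
  have hS := (contDiff_shear hθ a).contDiffOn (s := shearDomain x U θ a)
  have hV' := hV.comp hsnd hmaps
  have hd : ContDiffOn ℝ ∞ (fun q : ℝ × (ℝ × Model n) => fderiv ℝ θ q.2 (1, V q.2))
      (shearDomain x U θ a) :=
    ((hθ.fderiv_right (m := ∞) (by simp)).comp_contDiffOn hsnd).clm_apply
      (contDiffOn_const.prodMk hV')
  have hd0 : ContDiffOn ℝ ∞ (fun q : ℝ × (ℝ × Model n) => fderiv ℝ θ q.2 (0, a))
      (shearDomain x U θ a) := (contDiff_fderiv_const hθ (0, a)).comp_contDiffOn hsnd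
  have hvol : ContDiffOn ℝ ∞ (fun q : ℝ × (ℝ × Model n) => volCoord g x q.2.2)
      (shearDomain x U θ a) := (contDiffOn_volCoord g x).comp
        (contDiff_snd.comp contDiff_snd).contDiffOn fun q hq => hUt _ hq.1
  have hvolS : ContDiffOn ℝ ∞ (fun q : ℝ × (ℝ × Model n) => volCoord g x (shear θ a q.1 q.2))
      (shearDomain x U θ a) := (contDiffOn_volCoord g x).comp hS fun q hq => hq.2.1
  have hden : ContDiffOn ℝ ∞ (fun q : ℝ × (ℝ × Model n) =>
      volCoord g x (shear θ a q.1 q.2) * (1 + q.1 * fderiv ℝ θ q.2 (0, a)))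
      (shearDomain x U θ a) := hvolS.mul (contDiffOn_const.add (hfst.mul hd0))
  have hden0 : ∀ q ∈ shearDomain x U θ a,
      0 < volCoord g x (shear θ a q.1 q.2) * (1 + q.1 * fderiv ℝ θ q.2 (0, a)) :=
    fun q hq => mul_pos (volCoord_pos g hq.2.1) hq.2.2
  have hr : ContDiffOn ℝ ∞ (fun q : ℝ × (ℝ × Model n) => R q.2 * volCoord g x q.2.2 /
      (volCoord g x (shear θ a q.1 q.2) * (1 + q.1 * fderiv ℝ θ q.2 (0, a))))
      (shearDomain x U θ a) :=
    ((hR.comp hsnd hmaps).mul hvol).div hden fun q hq => (hden0 q hq).ne'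
  have hκ' : ContDiffOn ℝ ∞ (fun q : ℝ × (ℝ × Model n) =>
      κ q.2 + q.1 * b * fderiv ℝ θ q.2 (1, V q.2)) (shearDomain x U θ a) :=
    (hκ.comp hsnd hmaps).add ((hfst.mul contDiffOn_const).mul hd)
  have hw : ContDiffOn ℝ ∞ (fun q : ℝ × (ℝ × Model n) =>
      V q.2 + (q.1 * fderiv ℝ θ q.2 (1, V q.2)) • a) (shearDomain x U θ a) :=
    hV'.add ((hfst.mul hd).smul contDiffOn_const)
  have hmet : ContDiffOn ℝ ∞ (fun q : ℝ × (ℝ × Model n) => metricCoord g x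
      (V q.2 + (q.1 * fderiv ℝ θ q.2 (1, V q.2)) • a)
          (V q.2 + (q.1 * fderiv ℝ θ q.2 (1, V q.2)) • a)
      (shear θ a q.1 q.2)) (shearDomain x U θ a) :=
    contDiffOn_metricCoord_comp g x hw hw hS fun q hq => hq.2.1
  have hr0 : ∀ q ∈ shearDomain x U θ a, R q.2 * volCoord g x q.2.2 /
      (volCoord g x (shear θ a q.1 q.2) * (1 + q.1 * fderiv ℝ θ q.2 (0, a))) ∈ Ioi (0 : ℝ) :=
    fun q hq => div_pos (mul_pos (hR0 q.2 hq.1) (volCoord_pos g (hUt q.2 hq.1))) (hden0 q hq)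
  have hQ := ContDiffOn.comp (g := fun r => lam r / r) (contDiffOn_div_self hlam) hr hr0
  exact (hQ.mul (hκ'.mul hκ')).add hmet

include hlam hθ in
/-- The first variation of the energy integrand. The first summand comes from the change of the
density by compression, the second one from the change of the velocities, and the last one from the
change of the metric with the position. -/
lemma hasDerivAt_shearedEnergy {z : ℝ × Model n} (hz : z.2 ∈ (chart x).target) (hRz : 0 < R z) :
    HasDerivAt (fun r => shearedEnergy g lam x θ a b V R κ r z)
      (deriv (fun r => lam r / r) (R z) * (-(R z / volCoord g x z.2) *
          fderiv ℝ (fun w : ℝ × Model n => volCoord g x w.2 * θ w) z (0, a)) * κ z ^ 2 +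
        2 * (lam (R z) / R z * κ z * b + metricCoord g x (V z) a z.2) * fderiv ℝ θ z (1, V z) +
        θ z * fderiv ℝ (metricCoord g x (V z) (V z)) z.2 a) 0 := by
  have hn : (∞ : ℕ∞ω) ≠ 0 := by simp
  have hnear := (isOpen_chart_target x).mem_nhds hz
  have hvol0 := volCoord_pos g hz
  have hS : HasDerivAt (fun r => shear θ a r z) (θ z • a) 0 := by
    have h := (((hasDerivAt_id (0 : ℝ)).mul_const (θ z)).smul_const a).const_add z.2
    rw [one_mul] at h
    exact h
  have hS0 : shear θ a 0 z = z.2 := by simp [shear]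
  have hcomp : ∀ {f : Model n → ℝ}, DifferentiableAt ℝ f z.2 →
      HasDerivAt (fun r => f (shear θ a r z)) (θ z * fderiv ℝ f z.2 a) 0 := by
    intro f hf
    have h := HasFDerivAt.comp_hasDerivAt (l := f) 0 (by rw [hS0]; exact hf.hasFDerivAt) hS
    rw [map_smul, smul_eq_mul] at h
    exact h
  have hvold : DifferentiableAt ℝ (volCoord g x) z.2 :=
    ((contDiffOn_volCoord g x).contDiffAt hnear).differentiableAt hn
  have hmet : ∀ v w, DifferentiableAt ℝ (metricCoord g x v w) z.2 := fun v w =>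
    ((contDiffOn_metricCoord g x v w).contDiffAt hnear).differentiableAt hn
  have hθz : DifferentiableAt ℝ θ z := hθ.differentiable hn z
  have hprod : fderiv ℝ (fun w : ℝ × Model n => volCoord g x w.2 * θ w) z (0, a) =
      volCoord g x z.2 * fderiv ℝ θ z (0, a) + fderiv ℝ (volCoord g x) z.2 a * θ z := by
    have h1 : HasFDerivAt (fun w : ℝ × Model n => volCoord g x w.2)
        ((fderiv ℝ (volCoord g x) z.2).comp (.snd ℝ ℝ (Model n))) z :=
      hvold.hasFDerivAt.comp z hasFDerivAt_snd
    rw [fderiv_mul_apply' h1.differentiableAt hθz, h1.fderiv]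
    simp
  have hlin : ∀ c : ℝ, HasDerivAt (fun r : ℝ => r * c) c 0 := fun c => by
    simpa using (hasDerivAt_id (0 : ℝ)).mul_const c
  have hX : HasDerivAt (fun r => R z * volCoord g x z.2 / (volCoord g x (shear θ a r z) *
      (1 + r * fderiv ℝ θ z (0, a)))) (-(R z / volCoord g x z.2) *
          fderiv ℝ (fun w : ℝ × Model n => volCoord g x w.2 * θ w) z (0, a)) 0 := by
    have h1 := (hcomp hvold).fun_mul ((hlin (fderiv ℝ θ z (0, a))).const_add 1)
    have h2 := (hasDerivAt_const (0 : ℝ) (R z * volCoord g x z.2)).fun_div h1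
      (by rw [hS0]; simpa using hvol0.ne')
    refine h2.congr_deriv ?_
    rw [hS0, hprod]
    field_simp
    ring
  have hX0 : R z * volCoord g x z.2 / (volCoord g x (shear θ a 0 z) *
      (1 + 0 * fderiv ℝ θ z (0, a))) = R z := by
    rw [hS0, zero_mul, add_zero, mul_one, mul_div_cancel_right₀ _ hvol0.ne']
  have hQ : HasDerivAt (fun r => lam r / r) (deriv (fun r => lam r / r) (R z)) (R z) :=
    (((contDiffOn_div_self hlam).contDiffAt (Ioi_mem_nhds hRz)).differentiableAt hn).hasDerivAt
  have hQX := HasDerivAt.comp (h₂ := fun r => lam r / r) (0 : ℝ) (by rw [hX0]; exact hQ) hX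
  have hκ : HasDerivAt (fun r => κ z + r * b * fderiv ℝ θ z (1, V z))
      (b * fderiv ℝ θ z (1, V z)) 0 := ((hlin b).mul_const _).const_add _
  have hG : HasDerivAt (fun r => metricCoord g x (V z + (r * fderiv ℝ θ z (1, V z)) • a)
      (V z + (r * fderiv ℝ θ z (1, V z)) • a) (shear θ a r z))
      (θ z * fderiv ℝ (metricCoord g x (V z) (V z)) z.2 a +
        2 * fderiv ℝ θ z (1, V z) * metricCoord g x (V z) a z.2) 0 := by
    simp only [metricCoord_add_smul]
    have hl := hlin (fderiv ℝ θ z (1, V z))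
    have h := ((hcomp (hmet (V z) (V z))).fun_add
      ((hl.const_mul 2).fun_mul (hcomp (hmet (V z) a)))).fun_add
      ((hl.fun_pow 2).fun_mul (hcomp (hmet a a)))
    refine h.congr_deriv ?_
    rw [hS0]
    simp
  have h := (hQX.fun_mul (hκ.fun_mul hκ)).fun_add hG
  refine HasDerivAt.congr_deriv (f := fun r => shearedEnergy g lam x θ a b V R κ r z) h ?_
  simp only [Function.comp_apply, zero_mul, add_zero, hS0, mul_one,
    mul_div_cancel_right₀ _ hvol0.ne']
  ring

end Perturbation

/-! ### Curves of configurations and their perturbations -/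

section FlowCurve

variable {n : ℕ} {N M : Type*} [TopologicalSpace N] [ChartedSpace (Model n) N]
  [TopologicalSpace M] [ChartedSpace (Model n) M] [IsManifold 𝓘(ℝ, Model n) ∞ M]

local notation "𝓔" => 𝓘(ℝ, Model n)
local notation "chart" => extChartAt 𝓘(ℝ, Model n)

/-- The domain of the coordinates `(t, y)`, where `y` are coordinates in the chart at `x`. -/
def timeDomain (n : ℕ) [ChartedSpace (Model n) M] (T : ℝ) (x : M) : Set (ℝ × Model n) :=
  Ioo (-T) T ×ˢ (extChartAt 𝓘(ℝ, Model n) x).target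

lemma isOpen_timeDomain (T : ℝ) (x : M) : IsOpen (timeDomain n T x) :=
  isOpen_Ioo.prod (isOpen_chart_target x)

/-- The components of a time-dependent vector field in the chart at `x`. -/
noncomputable def timeField (x : M) (u : ℝ → ∀ x : M, Tan n x) (z : ℝ × Model n) : Model n :=
  coordRep x (u z.1) z.2

/-- A time-dependent function in the chart at `x`. -/
noncomputable def timeFun (n : ℕ) [ChartedSpace (Model n) M] (x : M) (f : ℝ → M → ℝ)
    (z : ℝ × Model n) : ℝ :=
  f z.1 ((extChartAt 𝓘(ℝ, Model n) x).symm z.2)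

/-- A smooth curve `(η, F)` of configurations with velocity field `u`, density `ρ`, and
derivative `k ∘ η` of the function component. -/
structure FlowCurve (ν : VolumeForm n N) (g : Metric n M) (T : ℝ) (η : ℝ → N → M)
    (F : ℝ → N → ℝ) (u : ℝ → ∀ x : M, Tan n x) (ρ k : ℝ → M → ℝ) : Prop where
  diffeo : ∀ t ∈ Ioo (-T) T, ∃ Φ : Diffeomorph 𝓘(ℝ, Model n) 𝓘(ℝ, Model n) N M ∞, ⇑Φ = η t
  contMDiffOn_map : ContMDiffOn (𝓘(ℝ, ℝ).prod 𝓘(ℝ, Model n)) 𝓘(ℝ, Model n) ∞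
    (fun z : ℝ × N => η z.1 z.2) (Ioo (-T) T ×ˢ univ)
  contMDiffOn_fun : ContMDiffOn (𝓘(ℝ, ℝ).prod 𝓘(ℝ, Model n)) 𝓘(ℝ, ℝ) ∞
    (fun z : ℝ × N => F z.1 z.2) (Ioo (-T) T ×ˢ univ)
  velocity_eq : ∀ t ∈ Ioo (-T) T, ∀ p, velocity (fun τ => η τ p) t = u t (η t p)
  density : ∀ t ∈ Ioo (-T) T, IsDensity ν g (η t) (ρ t)
  deriv_eq : ∀ t ∈ Ioo (-T) T, ∀ p, deriv (fun τ => F τ p) t = k t (η t p)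
  contDiffOn_field : ∀ x : M, ContDiffOn ℝ ∞ (timeField x u) (timeDomain n T x)
  contDiffOn_density : ∀ x : M, ContDiffOn ℝ ∞ (timeFun n x ρ) (timeDomain n T x)
  contDiffOn_deriv : ∀ x : M, ContDiffOn ℝ ∞ (timeFun n x k) (timeDomain n T x)

variable {ν : VolumeForm n N} {g : Metric n M} {T : ℝ} {η : ℝ → N → M}
    {F : ℝ → N → ℝ} {u : ℝ → ∀ x : M, Tan n x} {ρ k : ℝ → M → ℝ}

lemma FlowCurve.contMDiffAt_map (hc : FlowCurve ν g T η F u ρ k) {t : ℝ} (ht : t ∈ Ioo (-T) T)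
    (p : N) : ContMDiffAt (𝓘(ℝ, ℝ).prod 𝓔) 𝓔 ∞ (fun z : ℝ × N => η z.1 z.2) (t, p) :=
  hc.contMDiffOn_map.contMDiffAt ((isOpen_Ioo.prod isOpen_univ).mem_nhds ⟨ht, trivial⟩)

lemma FlowCurve.contMDiffAt_fun (hc : FlowCurve ν g T η F u ρ k) {t : ℝ} (ht : t ∈ Ioo (-T) T)
    (p : N) : ContMDiffAt (𝓘(ℝ, ℝ).prod 𝓔) 𝓘(ℝ, ℝ) ∞ (fun z : ℝ × N => F z.1 z.2) (t, p) :=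
  hc.contMDiffOn_fun.contMDiffAt ((isOpen_Ioo.prod isOpen_univ).mem_nhds ⟨ht, trivial⟩)

lemma FlowCurve.continuousAt_map (hc : FlowCurve ν g T η F u ρ k) {t : ℝ} (ht : t ∈ Ioo (-T) T)
    (p : N) : ContinuousAt (fun z : ℝ × N => η z.1 z.2) (t, p) :=
  (hc.contMDiffAt_map ht p).continuousAt

variable [IsManifold 𝓘(ℝ, Model n) ∞ N]

lemma FlowCurve.differentiableAt_fun (hc : FlowCurve ν g T η F u ρ k) {t : ℝ}
    (ht : t ∈ Ioo (-T) T) (p : N) : DifferentiableAt ℝ (fun τ => F τ p) t :=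
  mdifferentiableAt_iff_differentiableAt.mp
    (MDifferentiableAt.comp (f := fun τ : ℝ => (τ, p)) t
      ((hc.contMDiffAt_fun ht p).mdifferentiableAt (by simp))
      (mdifferentiableAt_id.prodMk (mdifferentiableAt_const (c := p))))

lemma FlowCurve.density_pos (hc : FlowCurve ν g T η F u ρ k) {t : ℝ} (ht : t ∈ Ioo (-T) T)
    (x : M) : 0 < ρ t x := by
  obtain ⟨Φ, hΦ⟩ := hc.diffeo t ht
  have h := (hc.density t ht).pos_apply (Φ.symm x)
  rwa [← hΦ, Φ.apply_symm_apply] at h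

variable {lam : ℝ → ℝ}

lemma FlowCurve.energyDensity_eq (hc : FlowCurve ν g T η F u ρ k) {t : ℝ}
    (ht : t ∈ Ioo (-T) T) {p : N} {x : M} (hx : η t p ∈ (chart x).source) :
    energyDensity ν g lam η F t p = coordEnergy g lam x (timeFun n x ρ (t, chart x (η t p)))
      (timeFun n x k (t, chart x (η t p))) (timeField x u (t, chart x (η t p)))
      (chart x (η t p)) := by
  unfold energyDensity coordEnergy timeFun timeField
  rw [(hc.density t ht).particleDensity_eq, hc.deriv_eq t ht, hc.velocity_eq t ht,
    inner_eq_metricCoord g hx, (chart x).left_inv hx, coordRep_chart hx]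

lemma FlowCurve.continuousAt_energyDensity (hc : FlowCurve ν g T η F u ρ k)
    (hlam : ContDiffOn ℝ ∞ lam (Ioi 0)) {t : ℝ} (ht : t ∈ Ioo (-T) T) (p : N) :
    ContinuousAt (fun z : ℝ × N => energyDensity ν g lam η F z.1 z.2) (t, p) := by
  set x := η t p with hx
  have hmap := hc.continuousAt_map ht p
  have hxs : x ∈ (chart x).source := mem_extChartAt_source x
  have e1 : ∀ᶠ z : ℝ × N in 𝓝 (t, p), η z.1 z.2 ∈ (chart x).source :=
    hmap.eventually ((isOpen_chart_source x).mem_nhds hxs)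
  have e2 : ∀ᶠ z : ℝ × N in 𝓝 (t, p), z.1 ∈ Ioo (-T) T :=
    continuousAt_fst.eventually (isOpen_Ioo.mem_nhds ht)
  have hopen := isOpen_timeDomain (n := n) T x
  have hmem : (t, chart x x) ∈ timeDomain n T x := ⟨ht, chart_mem_target x⟩
  have hE : ContDiffOn ℝ ∞ (fun z : ℝ × Model n => coordEnergy g lam x (timeFun n x ρ z)
      (timeFun n x k z) (timeField x u z) z.2) (timeDomain n T x) := by
    have hk := hc.contDiffOn_deriv x
    have hu := hc.contDiffOn_field x
    have h1 : ContDiffOn ℝ ∞ (fun z : ℝ × Model n => metricCoord g x (timeField x u z)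
        (timeField x u z) z.2) (timeDomain n T x) :=
      contDiffOn_metricCoord_comp g x hu hu contDiffOn_snd fun z hz => hz.2
    have h2 := ContDiffOn.comp (g := fun r => lam r / r) (contDiffOn_div_self hlam)
      (hc.contDiffOn_density x) fun z hz => hc.density_pos hz.1 _
    exact (h2.mul (hk.mul hk)).add h1
  have hcomp : ContinuousAt (fun z : ℝ × N => (z.1, chart x (η z.1 z.2))) (t, p) :=
    continuousAt_fst.prodMk (ContinuousAt.comp (g := chart x)
      (f := fun z : ℝ × N => η z.1 z.2) (continuousAt_extChartAt' hxs) hmap)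
  have h := ContinuousAt.comp (f := fun z : ℝ × N => (z.1, chart x (η z.1 z.2)))
    (x := (t, p)) (hE.contDiffAt (hopen.mem_nhds hmem)).continuousAt hcomp
  refine h.congr ?_
  filter_upwards [e1, e2] with z h1 h2
  exact (hc.energyDensity_eq h2 h1).symm

/-- The function component of the perturbed curve. -/
noncomputable def perturbedFun (x : M) (θ : ℝ × Model n → ℝ) (b : ℝ) (η : ℝ → N → M)
    (F : ℝ → N → ℝ) (r t : ℝ) (p : N) : ℝ :=
  F t p + r * b * chartExt x θ (t, η t p)

/-- The map component of the perturbed curve. -/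
noncomputable def perturbedMap (x : M) (θ : ℝ × Model n → ℝ) (a : Model n) (η : ℝ → N → M)
    (r t : ℝ) (p : N) : M :=
  shearMap x θ a r t (η t p)

/-- The change of the energy integrand in the chart at `x`. It vanishes off the support of `θ`. -/
noncomputable def energyDiff (g : Metric n M) (lam : ℝ → ℝ) (x : M) (θ : ℝ × Model n → ℝ)
    (a : Model n) (b : ℝ) (u : ℝ → ∀ x : M, Tan n x) (ρ k : ℝ → M → ℝ) (r : ℝ)
    (z : ℝ × Model n) : ℝ :=
  shearedEnergy g lam x θ a b (timeField x u) (timeFun n x ρ) (timeFun n x k) r z -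
    shearedEnergy g lam x θ a b (timeField x u) (timeFun n x ρ) (timeFun n x k) 0 z

variable {x : M} {θ : ℝ × Model n → ℝ} {a : Model n} {b : ℝ}

lemma energyDiff_of_notMem {z : ℝ × Model n} (hz : z ∉ tsupport θ) (r : ℝ) :
    energyDiff g lam x θ a b u ρ k r z = 0 := by
  rw [energyDiff, shearedEnergy_of_notMem hz, sub_self]

variable (hθ : ContDiff ℝ ∞ θ) (hθc : HasCompactSupport θ)
  (hθt : ∀ z ∈ tsupport θ, z.2 ∈ (extChartAt 𝓘(ℝ, Model n) x).target)

lemma shear_mem_target {r : ℝ}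
    (hr : ∀ z ∈ tsupport θ, (r, z) ∈ shearDomain x (timeDomain n T x) θ a) {z : ℝ × Model n}
    (hz : z.2 ∈ (chart x).target) : shear θ a r z ∈ (chart x).target := by
  by_cases h : z ∈ tsupport θ
  · exact (hr z h).2.1
  · simpa [shear, image_eq_zero_of_notMem_tsupport h] using hz

variable [T2Space M]

include hθ hθc hθt in
lemma FlowCurve.contMDiffAt_perturbedMap (hc : FlowCurve ν g T η F u ρ k) {r t : ℝ}
    (hr : ∀ z ∈ tsupport θ, (r, z) ∈ shearDomain x (timeDomain n T x) θ a)
    (ht : t ∈ Ioo (-T) T) (p : N) : ContMDiffAt (𝓘(ℝ, ℝ).prod (𝓘(ℝ, ℝ).prod 𝓔)) 𝓔 ∞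
      (fun z : ℝ × ℝ × N => perturbedMap x θ a η z.1 z.2.1 z.2.2) (r, t, p) := by
  have h1 : ContMDiffAt (𝓘(ℝ, ℝ).prod (𝓘(ℝ, ℝ).prod 𝓔)) 𝓔 ∞
      (fun z : ℝ × ℝ × N => η z.2.1 z.2.2) (r, t, p) :=
    ContMDiffAt.comp (g := fun z : ℝ × N => η z.1 z.2) (f := Prod.snd) (r, t, p)
      (hc.contMDiffAt_map ht p) contMDiffAt_snd
  have h2 : ContMDiffAt (𝓘(ℝ, ℝ).prod (𝓘(ℝ, ℝ).prod 𝓔)) (𝓘(ℝ, ℝ).prod (𝓘(ℝ, ℝ).prod 𝓔)) ∞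
      (fun z : ℝ × ℝ × N => (z.1, z.2.1, η z.2.1 z.2.2)) (r, t, p) :=
    contMDiffAt_fst.prodMk ((contMDiffAt_fst.comp (g := Prod.fst)
        (r, t, p) contMDiffAt_snd).prodMk h1)
  exact ContMDiffAt.comp (g := fun w : ℝ × ℝ × M => shearMap x θ a w.1 w.2.1 w.2.2)
    (f := fun z : ℝ × ℝ × N => (z.1, z.2.1, η z.2.1 z.2.2)) (r, t, p)
    (contMDiffAt_shearMap x hθ hθc hθt a fun z hz => (hr z hz).2.1) h2

include hθ hθc hθt in
lemma FlowCurve.contMDiffAt_perturbedFun (hc : FlowCurve ν g T η F u ρ k) {r t : ℝ}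
    (ht : t ∈ Ioo (-T) T) (p : N) : ContMDiffAt (𝓘(ℝ, ℝ).prod (𝓘(ℝ, ℝ).prod 𝓔)) 𝓘(ℝ, ℝ) ∞
      (fun z : ℝ × ℝ × N => perturbedFun x θ b η F z.1 z.2.1 z.2.2) (r, t, p) := by
  have h0 : ContMDiffAt (𝓘(ℝ, ℝ).prod (𝓘(ℝ, ℝ).prod 𝓔)) 𝓘(ℝ, ℝ) ∞
      (fun z : ℝ × ℝ × N => F z.2.1 z.2.2) (r, t, p) :=
    ContMDiffAt.comp (g := fun z : ℝ × N => F z.1 z.2) (f := Prod.snd) (r, t, p)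
      (hc.contMDiffAt_fun ht p) contMDiffAt_snd
  have h1 : ContMDiffAt (𝓘(ℝ, ℝ).prod (𝓘(ℝ, ℝ).prod 𝓔)) 𝓔 ∞
      (fun z : ℝ × ℝ × N => η z.2.1 z.2.2) (r, t, p) :=
    ContMDiffAt.comp (g := fun z : ℝ × N => η z.1 z.2) (f := Prod.snd) (r, t, p)
      (hc.contMDiffAt_map ht p) contMDiffAt_snd
  have h2 : ContMDiffAt (𝓘(ℝ, ℝ).prod (𝓘(ℝ, ℝ).prod 𝓔)) (𝓘(ℝ, ℝ).prod 𝓔) ∞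
      (fun z : ℝ × ℝ × N => (z.2.1, η z.2.1 z.2.2)) (r, t, p) :=
    (contMDiffAt_fst.comp (g := Prod.fst) (r, t, p) contMDiffAt_snd).prodMk h1
  have h3 := ContMDiffAt.comp (g := chartExt x θ)
    (f := fun z : ℝ × ℝ × N => (z.2.1, η z.2.1 z.2.2)) (r, t, p)
    (contMDiff_chartExt x hθc.isCompact hθt
      (fun z hz => image_eq_zero_of_notMem_tsupport hz) hθ _) h2
  exact h0.add ((contMDiffAt_fst.mul contMDiffAt_const).mul h3)

include hθ hθc hθt in
/-- The perturbation changes the integrand of the energy by `energyDiff`, carried by the chart. -/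
lemma FlowCurve.energyDensity_perturbed (hc : FlowCurve ν g T η F u ρ k) {r t : ℝ}
    (hr : ∀ z ∈ tsupport θ, (r, z) ∈ shearDomain x (timeDomain n T x) θ a)
    (ht : t ∈ Ioo (-T) T) (p : N) :
    energyDensity ν g lam (perturbedMap x θ a η r) (perturbedFun x θ b η F r) t p =
      energyDensity ν g lam η F t p +
        chartExt x (energyDiff g lam x θ a b u ρ k r) (t, η t p) := by
  have hpair : ContinuousAt (fun z : ℝ × N => (z.1, η z.1 z.2)) (t, p) :=
    continuousAt_fst.prodMk (hc.continuousAt_map ht p)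
  by_cases hz : (t, η t p) ∈ chartPreimage x (tsupport θ)
  · obtain ⟨hx, hzt⟩ := hz
    set y := chart x (η t p) with hy
    have hnear : ∀ᶠ z : ℝ × N in 𝓝 (t, p), η z.1 z.2 ∈ (chart x).source :=
      (hc.continuousAt_map ht p).eventually ((isOpen_chart_source x).mem_nhds hx)
    have ct : Tendsto (fun τ : ℝ => (τ, p)) (𝓝 t) (𝓝 (t, p)) :=
      (Continuous.prodMk_left p).tendsto t
    have hH : ∀ {q : M} {τ : ℝ}, q ∈ (chart x).source →
        shearMap x θ a r τ q ∈ (chart x).source ∧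
          chart x (shearMap x θ a r τ q) = shear θ a r (τ, chart x q) := by
      intro q τ hq
      have h1 := shear_mem_target (z := (τ, chart x q)) hr ((chart x).map_source hq)
      rw [shearMap_of_mem hq]
      exact ⟨(chart x).map_target h1, (chart x).right_inv h1⟩
    have hθz : DifferentiableAt ℝ θ (t, y) := hθ.differentiable (by simp) _
    have hpos := (hr _ hzt).2.2
    have hcont : ContMDiffAt (𝓘(ℝ, ℝ).prod 𝓔) 𝓔 ∞
        (fun z : ℝ × N => perturbedMap x θ a η r z.1 z.2) (t, p) :=
      ContMDiffAt.comp (g := fun z : ℝ × ℝ × N => perturbedMap x θ a η z.1 z.2.1 z.2.2)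
        (f := fun z : ℝ × N => (r, z)) (t, p)
        (hc.contMDiffAt_perturbedMap hθ hθc hθt hr ht p)
        (contMDiffAt_const.prodMk contMDiffAt_id)
    have hmain := energyDensity_coord (lam := lam) (K := perturbedFun x θ b η F r)
      (S := shear θ a r) (f := fun z => r * b * θ z)
      (hc.density t ht) (hc.contMDiffAt_map ht p) hcont (hc.differentiableAt_fun ht p) hx
      (hH hx).1 (hasFDerivAt_shear hθz a r).differentiableAt (hθz.const_mul _)
      (by filter_upwards [hnear] with z hz using (hH hz).2)
      (by
        filter_upwards [ct.eventually hnear] with τ hτ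
        rw [perturbedFun, chartExt_of_mem hτ])
      (V := timeField x u (t, y)) (by
        rw [hc.velocity_eq t ht]
        exact (coordRep_chart hx _).symm)
    rw [chartExt_of_mem hx, hmain, energyDiff,
      shearedEnergy_zero (z := (t, y)) ((chart x).map_source hx), hc.energyDensity_eq ht hx]
    rw [det_fderiv_shear hθz, abs_of_pos hpos, fderiv_shear_apply hθz, hc.deriv_eq t ht,
      fderiv_const_mul hθz]
    rw [add_sub_cancel, shearedEnergy]
    have hsymm : (chart x).symm y = η t p := (chart x).left_inv hx
    simp only [timeFun, hsymm, smul_apply, smul_eq_mul, ← hy]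
  · have h0 : ∀ᶠ w : ℝ × M in 𝓝 (t, η t p), w ∉ chartPreimage x (tsupport θ) :=
      (isClosed_chartPreimage x hθc.isCompact hθt).isOpen_compl.mem_nhds hz
    have h1 : chartExt x (energyDiff g lam x θ a b u ρ k r) (t, η t p) = 0 :=
      (chartExt_eventuallyEq_zero x hθc.isCompact hθt
        (fun z hz => energyDiff_of_notMem hz r) hz).self_of_nhds
    rw [h1, add_zero]
    refine energyDensity_congr ?_ ?_
    · filter_upwards [hpair.eventually h0] with w hw
      exact shearMap_of_notMem hw
    · have h2 := chartExt_eventuallyEq_zero x hθc.isCompact hθt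
        (fun z hz => image_eq_zero_of_notMem_tsupport hz) hz
      filter_upwards [hpair.eventually h2] with w hw
      rw [perturbedFun, hw]
      simp

end FlowCurve

/-! ### The first variation of the energy -/

section FirstVariation

variable {n : ℕ} {N M : Type*} [TopologicalSpace N] [ChartedSpace (Model n) N]
  [TopologicalSpace M] [ChartedSpace (Model n) M]
  [IsManifold 𝓘(ℝ, Model n) ∞ N] [IsManifold 𝓘(ℝ, Model n) ∞ M]
  [CompactSpace N] [MeasurableSpace N] [BorelSpace N] [T2Space M]

local notation "𝓔" => 𝓘(ℝ, Model n)
local notation "chart" => extChartAt 𝓘(ℝ, Model n)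

variable {ν : VolumeForm n N} {g : Metric n M} {T : ℝ} {η : ℝ → N → M}
    {F : ℝ → N → ℝ} {u : ℝ → ∀ x : M, Tan n x} {ρ k : ℝ → M → ℝ} {lam : ℝ → ℝ}
    {x : M} {θ : ℝ × Model n → ℝ} {a : Model n} {b : ℝ}

/-- The mass density in the chart at `x`. -/
noncomputable def massCoord (g : Metric n M) (x : M) (ρ : ℝ → M → ℝ) (z : ℝ × Model n) : ℝ :=
  timeFun n x ρ z * volCoord g x z.2

omit [CompactSpace N] [MeasurableSpace N] [BorelSpace N] [T2Space M] in
lemma FlowCurve.contDiffOn_massCoord (hc : FlowCurve ν g T η F u ρ k) (x : M) :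
    ContDiffOn ℝ ∞ (massCoord g x ρ) (timeDomain n T x) :=
  (hc.contDiffOn_density x).mul ((contDiffOn_volCoord g x).comp contDiffOn_snd fun _ hz => hz.2)

omit [CompactSpace N] [MeasurableSpace N] [BorelSpace N] [T2Space M] in
lemma FlowCurve.contDiffOn_energyDiff (hc : FlowCurve ν g T η F u ρ k)
    (hlam : ContDiffOn ℝ ∞ lam (Ioi 0)) (hθ : ContDiff ℝ ∞ θ) : ContDiffOn ℝ ∞
      (fun q : ℝ × (ℝ × Model n) => energyDiff g lam x θ a b u ρ k q.1 q.2)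
      (shearDomain x (timeDomain n T x) θ a) := by
  have hUt : ∀ z ∈ timeDomain n T x, z.2 ∈ (chart x).target := fun z hz => hz.2
  have h1 := contDiffOn_shearedEnergy (g := g) (a := a) (b := b) hlam hUt hθ (hc.contDiffOn_field x)
    (hc.contDiffOn_density x) (fun z hz => hc.density_pos hz.1 _) (hc.contDiffOn_deriv x)
  refine h1.sub ?_
  exact ContDiffOn.comp (g := fun q : ℝ × (ℝ × Model n) => shearedEnergy g lam x θ a b
      (timeField x u) (timeFun n x ρ) (timeFun n x k) q.1 q.2)
          (f := fun q : ℝ × (ℝ × Model n) => ((0 : ℝ), q.2)) h1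
    (contDiff_const.prodMk contDiff_snd).contDiffOn fun q hq => zero_mem_shearDomain hUt hq.1

omit [CompactSpace N] [MeasurableSpace N] [BorelSpace N] [T2Space M] in
lemma FlowCurve.continuous_energyDiff (hc : FlowCurve ν g T η F u ρ k)
    (hlam : ContDiffOn ℝ ∞ lam (Ioi 0)) (hθ : ContDiff ℝ ∞ θ) {r : ℝ}
    (hr : ∀ z ∈ tsupport θ, (r, z) ∈ shearDomain x (timeDomain n T x) θ a) :
    Continuous (energyDiff g lam x θ a b u ρ k r) := by
  rw [continuous_iff_continuousAt]
  intro z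
  by_cases hz : z ∈ tsupport θ
  · have h1 := (hc.contDiffOn_energyDiff (b := b) hlam hθ).contDiffAt
      ((isOpen_shearDomain (isOpen_timeDomain T x) hθ).mem_nhds (hr z hz))
    exact ContinuousAt.comp
      (g := fun q : ℝ × (ℝ × Model n) => energyDiff g lam x θ a b u ρ k q.1 q.2)
      (f := fun z => (r, z)) h1.continuousAt (by fun_prop)
  · refine (continuousAt_const (y := (0 : ℝ))).congr ?_
    filter_upwards [(isClosed_tsupport θ).isOpen_compl.mem_nhds hz] with w hw
    exact (energyDiff_of_notMem hw r).symm

/-- The energy of the perturbed curve. The change of the integrand is carried by the chart at `x`,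
so that the change of variables `y = η t p` turns it into an integral over the chart, in which `ν`
becomes the mass density. -/
lemma FlowCurve.energy_perturbed (hc : FlowCurve ν g T η F u ρ k)
    (hlam : ContDiffOn ℝ ∞ lam (Ioi 0)) (hθ : ContDiff ℝ ∞ θ) (hθc : HasCompactSupport θ)
    {t₁ t₂ : ℝ} (ht₁ : -T < t₁) (ht : t₁ < t₂) (ht₂ : t₂ < T)
    (hθs : tsupport θ ⊆ Ioo t₁ t₂ ×ˢ (extChartAt 𝓘(ℝ, Model n) x).target) {r : ℝ}
    (hr : ∀ z ∈ tsupport θ, (r, z) ∈ shearDomain x (timeDomain n T x) θ a) :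
    energy ν g lam t₁ t₂ (perturbedMap x θ a η r) (perturbedFun x θ b η F r) =
      energy ν g lam t₁ t₂ η F +
        (1 / 2) * ∫ z, energyDiff g lam x θ a b u ρ k r z * massCoord g x ρ z := by
  have hfin := isFiniteMeasure_measure ν
  have hθt : ∀ z ∈ tsupport θ, z.2 ∈ (extChartAt 𝓘(ℝ, Model n) x).target := fun z hz => (hθs hz).2
  set D := energyDiff g lam x θ a b u ρ k r with hD
  have hDc : Continuous D := hc.continuous_energyDiff hlam hθ hr
  have hD0 : ∀ z ∉ tsupport θ, D z = 0 := fun z hz => energyDiff_of_notMem hz r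
  have hI : ∀ t ∈ Icc t₁ t₂, t ∈ Ioo (-T) T := fun t ht => ⟨ht₁.trans_le ht.1, ht.2.trans_lt ht₂⟩
  have hbase : ContinuousOn (fun t => ∫ p, energyDensity ν g lam η F t p ∂ν.measure)
      (Icc t₁ t₂) := by
    refine continuousOn_integral_of_compact_support isCompact_univ ?_ ?_
    · rintro ⟨t, p⟩ ⟨h1, -⟩
      exact (hc.continuousAt_energyDensity hlam (hI t h1) p).continuousWithinAt
    · intro t p _ hp
      exact absurd (mem_univ p) hp
  have hmass : ∀ t ∈ Ioo (-T) T, ∫ p, chartExt x D (t, η t p) ∂ν.measure =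
      ∫ y, D (t, y) * massCoord g x ρ (t, y) := by
    intro t ht
    let _ : MeasurableSpace M := borel M
    have : BorelSpace M := ⟨rfl⟩
    obtain ⟨Φ, hΦ⟩ := hc.diffeo t ht
    have hdens := hc.density t ht
    rw [← hΦ] at hdens ⊢
    have hmeas : AEMeasurable (fun y => ρ t ((chart x).symm y) * volCoord g x y)
        (volume.restrict (chart x).target) := by
      have h1 : ContinuousOn (fun y => massCoord g x ρ (t, y)) (chart x).target :=
        (hc.contDiffOn_massCoord x).continuousOn.comp (f := fun y => (t, y)) (by fun_prop)
          fun y hy => ⟨ht, hy⟩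
      exact h1.aemeasurable (isOpen_chart_target x).measurableSet
    exact integral_comp_eq ν g Φ hdens x (f := fun y => D (t, y))
      (hDc.comp (by fun_prop)).measurable hmeas (fun y hy => hD0 _ fun h => hy (hθt _ h))
      (fun p hp => chartExt_of_mem hp) (fun p hp => chartExt_of_notMem hp)
  have hsplit : ∀ t ∈ Icc t₁ t₂, ∫ p, energyDensity ν g lam (perturbedMap x θ a η r)
      (perturbedFun x θ b η F r) t p ∂ν.measure =
      ∫ p, energyDensity ν g lam η F t p ∂ν.measure +
        ∫ y, D (t, y) * massCoord g x ρ (t, y) := by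
    intro t ht
    rw [← hmass t (hI t ht), ← integral_add]
    · exact integral_congr_ae (ae_of_all _ fun p =>
        hc.energyDensity_perturbed hθ hθc hθt hr (hI t ht) p)
    · have h1 : Continuous fun p => energyDensity ν g lam η F t p := by
        rw [continuous_iff_continuousAt]
        intro p
        exact ContinuousAt.comp (g := fun z : ℝ × N => energyDensity ν g lam η F z.1 z.2)
          (f := fun p => (t, p)) (hc.continuousAt_energyDensity hlam (hI t ht) p)
          (by fun_prop)
      exact h1.integrable_of_hasCompactSupport (HasCompactSupport.of_compactSpace _)
    · have h1 : Continuous fun p => chartExt x D (t, η t p) := by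
        obtain ⟨Φ, hΦ⟩ := hc.diffeo t (hI t ht)
        rw [← hΦ]
        exact (continuous_chartExt x hθc.isCompact hθt hD0 hDc).comp
          (continuous_const.prodMk Φ.contMDiff.continuous)
      exact h1.integrable_of_hasCompactSupport (HasCompactSupport.of_compactSpace _)
  have hint : Integrable (fun z => D z * massCoord g x ρ z) := by
    refine integrable_of_continuousOn_of_eq_zero hθc.isCompact ?_ fun z hz => by
      rw [hD0 z hz, zero_mul]
    exact hDc.continuousOn.mul ((hc.contDiffOn_massCoord x).continuousOn.mono fun z hz =>
      ⟨hI _ (Ioo_subset_Icc_self (hθs hz).1), (hθs hz).2⟩)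
  have hint' : Integrable (fun t => ∫ y, D (t, y) * massCoord g x ρ (t, y)) := by
    rw [Measure.volume_eq_prod] at hint
    exact hint.integral_prod_left
  have hsupp : Function.support (fun t => ∫ y, D (t, y) * massCoord g x ρ (t, y)) ⊆
      Ioc t₁ t₂ := by
    intro t ht
    by_contra hnot
    apply ht
    have : ∀ y, D (t, y) * massCoord g x ρ (t, y) = 0 := fun y => by
      rw [hD0 _ fun h => hnot (Ioo_subset_Ioc_self (hθs h).1), zero_mul]
    simp [this]
  have htotal : ∫ z, D z * massCoord g x ρ z =
      ∫ t in t₁..t₂, ∫ y, D (t, y) * massCoord g x ρ (t, y) := by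
    rw [intervalIntegral.integral_eq_integral_of_support_subset hsupp]
    rw [Measure.volume_eq_prod] at hint ⊢
    exact integral_prod _ hint
  have hle : uIcc t₁ t₂ = Icc t₁ t₂ := uIcc_of_le ht.le
  have hfinal : energy ν g lam t₁ t₂ (perturbedMap x θ a η r) (perturbedFun x θ b η F r) =
      (1 / 2) * ∫ t in t₁..t₂, (∫ p, energyDensity ν g lam η F t p ∂ν.measure +
        ∫ y, D (t, y) * massCoord g x ρ (t, y)) := by
    unfold energy
    congr 1
    refine intervalIntegral.integral_congr fun t ht => ?_
    rw [hle] at ht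
    exact hsplit t ht
  rw [hfinal, intervalIntegral.integral_add, mul_add, htotal]
  · rfl
  · exact (hle ▸ hbase).intervalIntegrable
  · exact hint'.intervalIntegrable

/-- The weak form of the geodesic equation in a chart: the first variation of the energy, for the
shear in the direction `a` and the change `b θ` of the function component, vanishes. -/
lemma FlowCurve.integral_eq_zero (hc : FlowCurve ν g T η F u ρ k)
    (hlam : ContDiffOn ℝ ∞ lam (Ioi 0)) (hgeo : IsGeodesic ν g lam T η F)
    (hθ : ContDiff ℝ ∞ θ) (hθc : HasCompactSupport θ)
    {t₁ t₂ : ℝ} (ht₁ : -T < t₁) (ht : t₁ < t₂) (ht₂ : t₂ < T)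
    (hθs : tsupport θ ⊆ Ioo t₁ t₂ ×ˢ (extChartAt 𝓘(ℝ, Model n) x).target) (a : Model n) (b : ℝ) :
    ∫ z, deriv (fun r => energyDiff g lam x θ a b u ρ k r z * massCoord g x ρ z) 0 = 0 := by
  have hθt : ∀ z ∈ tsupport θ, z.2 ∈ (extChartAt 𝓘(ℝ, Model n) x).target := fun z hz => (hθs hz).2
  set U := timeDomain n T x with hU
  have hUopen : IsOpen U := isOpen_timeDomain T x
  have hθU : tsupport θ ⊆ U := fun z hz =>
    ⟨⟨ht₁.trans (hθs hz).1.1, (hθs hz).1.2.trans ht₂⟩, (hθs hz).2⟩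
  have hUt : ∀ z ∈ U, z.2 ∈ (extChartAt 𝓘(ℝ, Model n) x).target := fun z hz => hz.2
  have hW : IsOpen (shearDomain x U θ a) := isOpen_shearDomain hUopen hθ
  have hKW : ∀ z ∈ tsupport θ, ((0 : ℝ), z) ∈ shearDomain x U θ a :=
    fun z hz => zero_mem_shearDomain hUt (hθU hz)
  -- by compactness of the support, all sufficiently small shears stay in the chart and are local
  -- diffeomorphisms
  obtain ⟨v, w, hv, -, h0v, hKw, hvw⟩ :=
    generalized_tube_lemma (isCompact_singleton (x := (0 : ℝ))) hθc.isCompact hW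
      (by rintro ⟨r, z⟩ ⟨hr, hz⟩; obtain rfl : r = 0 := hr; exact hKW z hz)
  obtain ⟨ε, hε, hball⟩ := Metric.isOpen_iff.mp hv 0 (h0v rfl)
  have hin : ∀ r ∈ Ioo (-ε) ε, ∀ z ∈ tsupport θ, (r, z) ∈ shearDomain x U θ a := by
    intro r hr z hz
    refine hvw ⟨hball ?_, hKw hz⟩
    rw [Metric.mem_ball, Real.dist_eq, sub_zero, abs_lt]
    exact hr
  -- the perturbation has fixed end points, since `θ` is supported in `(t₁, t₂)`
  have hend : ∀ t, t ∉ Ioo t₁ t₂ → ∀ r, perturbedMap x θ a η r t = η t ∧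
      perturbedFun x θ b η F r t = F t := by
    intro t ht' r
    have h1 : ∀ y, (t, y) ∉ tsupport θ := fun y h => ht' (hθs h).1
    refine ⟨funext fun p => shearMap_of_notMem fun h => h1 _ h.2, funext fun p => ?_⟩
    have h2 : chartExt x θ (t, η t p) = 0 := by
      by_cases hx : η t p ∈ (chart x).source
      · rw [chartExt_of_mem hx]
        exact image_eq_zero_of_notMem_tsupport (h1 _)
      · exact chartExt_of_notMem hx
    rw [perturbedFun, h2, mul_zero, add_zero]
  have hcrit := hgeo t₁ t₂ ht₁ ht ht₂ ε hε (perturbedMap x θ a η) (perturbedFun x θ b η F)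
    (fun z hz => (hc.contMDiffAt_perturbedMap hθ hθc hθt
        (hin z.1 hz.1) hz.2.1 z.2.2).contMDiffWithinAt)
    (fun z hz => (hc.contMDiffAt_perturbedFun hθ hθc hθt hz.2.1 z.2.2).contMDiffWithinAt)
    (fun t _ => ⟨funext fun p => shearMap_of_eq_zero fun _ => zero_mul _,
      funext fun p => by simp [perturbedFun]⟩)
    (fun r _ => ⟨(hend t₁ (by simp) r).1, (hend t₁ (by simp) r).2, (hend t₂ (by simp) r).1,
      (hend t₂ (by simp) r).2⟩)
  have hDW : ContDiffOn ℝ ∞ (fun q : ℝ × (ℝ × Model n) =>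
      energyDiff g lam x θ a b u ρ k q.1 q.2 * massCoord g x ρ q.2) (shearDomain x U θ a) :=
    (hc.contDiffOn_energyDiff hlam hθ).mul ((hc.contDiffOn_massCoord x).comp
      contDiffOn_snd fun q hq => hq.1)
  have hderiv := hasDerivAt_integral_of_compact (μ := volume)
    (f := fun r z => energyDiff g lam x θ a b u ρ k r z * massCoord g x ρ z)
    hW hθc.isCompact hKW hDW fun r z hz => by rw [energyDiff_of_notMem hz, zero_mul]
  have hderiv' := (hderiv.const_mul (1 / 2)).const_add (energy ν g lam t₁ t₂ η F)
  have heq : (fun r => energy ν g lam t₁ t₂ (perturbedMap x θ a η r) (perturbedFun x θ b η F r))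
      =ᶠ[𝓝 0] fun r => energy ν g lam t₁ t₂ η F + 1 / 2 *
        ∫ z, energyDiff g lam x θ a b u ρ k r z * massCoord g x ρ z := by
    filter_upwards [Ioo_mem_nhds (neg_lt_zero.mpr hε) hε] with r hr
    exact hc.energy_perturbed hlam hθ hθc ht₁ ht ht₂ hθs (hin r hr)
  have := hcrit.unique (hderiv'.congr_of_eventuallyEq heq)
  linarith

omit [CompactSpace N] [MeasurableSpace N] [BorelSpace N] in
lemma contDiffOn_deriv_div_self (hlam : ContDiffOn ℝ ∞ lam (Ioi 0)) :
    ContDiffOn ℝ ∞ (deriv fun r => lam r / r) (Ioi 0) :=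
  (contDiffOn_div_self hlam).deriv_of_isOpen isOpen_Ioi (by simp)

/-- The geodesic equation in a chart, tested with the direction `a` for the positions and `b` for
the function component. The mass density is transported by the flow by the hypothesis `hcont`. -/
lemma FlowCurve.geodesic_equation (hc : FlowCurve ν g T η F u ρ k)
    (hlam : ContDiffOn ℝ ∞ lam (Ioi 0)) (hgeo : IsGeodesic ν g lam T η F)
    (hcont : ∀ z ∈ timeDomain n T x, fderiv ℝ (massCoord g x ρ) z (1, timeField x u z) +
      massCoord g x ρ z * tr n ((fderiv ℝ (timeField x u) z).comp (.inr ℝ ℝ (Model n))) = 0)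
    (a : Model n) (b : ℝ) {z : ℝ × Model n} (hz : z ∈ timeDomain n T x) :
    massCoord g x ρ z * fderiv ℝ (fun w => lam (timeFun n x ρ w) / timeFun n x ρ w *
        timeFun n x k w * b + metricCoord g x (timeField x u w) a w.2) z (1, timeField x u z) =
      (1 / 2) * massCoord g x ρ z *
        fderiv ℝ (metricCoord g x (timeField x u z) (timeField x u z)) z.2 a -
      volCoord g x z.2 * fderiv ℝ (fun w => -(1 / 2) * deriv (fun r => lam r / r)
          (timeFun n x ρ w) *
        timeFun n x ρ w ^ 2 * timeFun n x k w ^ 2) z (0, a) := by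
  -- the criticality is used on a compact interval `[t₁, t₂]` around the time of `z`
  obtain ⟨t₁, ht₁, ht₁z⟩ := exists_between hz.1.1
  obtain ⟨t₂, ht₂z, ht₂⟩ := exists_between hz.1.2
  set U : Set (ℝ × Model n) := Ioo t₁ t₂ ×ˢ (extChartAt 𝓘(ℝ, Model n) x).target with hU
  have hUopen : IsOpen U := isOpen_Ioo.prod (isOpen_chart_target x)
  have hUT : U ⊆ timeDomain n T x := fun w hw =>
    ⟨⟨ht₁.trans hw.1.1, hw.1.2.trans ht₂⟩, hw.2⟩
  have hVs := (hc.contDiffOn_field x).mono hUT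
  have hρs := (hc.contDiffOn_density x).mono hUT
  have hks := (hc.contDiffOn_deriv x).mono hUT
  have hms := (hc.contDiffOn_massCoord x).mono hUT
  have hρ0 : ∀ w ∈ U, timeFun n x ρ w ∈ Ioi (0 : ℝ) := fun w hw => hc.density_pos (hUT hw).1 _
  have hvols : ContDiffOn ℝ ∞ (fun w : ℝ × Model n => volCoord g x w.2) U :=
    (contDiffOn_volCoord g x).comp contDiffOn_snd fun w hw => hw.2
  refine strong_of_weak (p := fun w => -(1 / 2) * deriv (fun r => lam r / r) (timeFun n x ρ w) *
      timeFun n x ρ w ^ 2 * timeFun n x k w ^ 2) (s := fun w => volCoord g x w.2)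
    (m := fun w => lam (timeFun n x ρ w) / timeFun n x ρ w *
        timeFun n x k w * b + metricCoord g x (timeField x u w) a w.2)
    (R := massCoord g x ρ) (k := fun w => (1 / 2) * massCoord g x ρ w *
        fderiv ℝ (metricCoord g x (timeField x u w) (timeField x u w)) w.2 a)
    (V := timeField x u) hUopen ?_ hvols ?_ hms ?_ hVs
    (fun w hw => hcont w (hUT hw)) ?_ z ⟨⟨ht₁z, ht₂z⟩, hz.2⟩
  · exact ((contDiffOn_const.mul ((contDiffOn_deriv_div_self hlam).comp hρs hρ0)).mul
      (hρs.pow 2)).mul (hks.pow 2)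
  · exact ((((contDiffOn_div_self hlam).comp hρs hρ0).mul hks).mul contDiffOn_const).add
      (contDiffOn_metricCoord_comp g x hVs contDiffOn_const contDiffOn_snd fun w hw => hw.2)
  · exact (contDiffOn_const.mul hms).mul
      (contDiffOn_fderiv_metricCoord_comp g x hVs hVs contDiffOn_snd (fun w hw => hw.2) a)
  · intro θ hθ hθc hθs
    have h0 := hc.integral_eq_zero hlam hgeo hθ hθc ht₁ (ht₁z.trans ht₂z) ht₂ hθs a b
    have h0' : ∫ z, (1 / 2) *
        deriv (fun r => energyDiff g lam x θ a b u ρ k r z * massCoord g x ρ z) 0 = 0 := by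
      rw [integral_const_mul, h0, mul_zero]
    refine (integral_congr_ae (ae_of_all _ fun w => ?_)).trans h0'
    by_cases hw : w ∈ tsupport θ
    · have hwU := hθs hw
      have hρw : 0 < timeFun n x ρ w := hρ0 w hwU
      have h1 := ((hasDerivAt_shearedEnergy (g := g) (a := a) (b := b) (V := timeField x u)
        (κ := timeFun n x k) hlam hθ hwU.2 hρw).sub_const
        (shearedEnergy g lam x θ a b (timeField x u) (timeFun n x ρ) (timeFun n x k) 0 w)).mul_const
        (massCoord g x ρ w)
      have h2 : deriv (fun r => energyDiff g lam x θ a b u ρ k r w * massCoord g x ρ w) 0 = _ :=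
        h1.deriv
      have hvol := (volCoord_pos g hwU.2).ne'
      rw [h2]
      simp only [massCoord]
      field_simp
    · have h2 : (fun r => energyDiff g lam x θ a b u ρ k r w * massCoord g x ρ w) = fun _ => 0 := by
        ext r; rw [energyDiff_of_notMem hw, zero_mul]
      have h3 : fderiv ℝ (fun w : ℝ × Model n => volCoord g x w.2 * θ w) w = 0 :=
        fderiv_eq_zero_of_notMem_tsupport fun h => hw (tsupport_mul_subset_right h)
      simp only [h2, h3, fderiv_eq_zero_of_notMem_tsupport hw, image_eq_zero_of_notMem_tsupport hw]
      simp

end FirstVariation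

/-! ### Gradients in coordinates -/

section Gradient

variable {n : ℕ} {M : Type*} [TopologicalSpace M] [ChartedSpace (Model n) M]
  [IsManifold 𝓘(ℝ, Model n) ∞ M]

local notation "𝓔" => 𝓘(ℝ, Model n)
local notation "chart" => extChartAt 𝓘(ℝ, Model n)

lemma mfderiv_eq_fderiv_of_mem_source {f : M → ℝ} {x₀ x : M} (hx : x ∈ (chart x₀).source)
    (hf : DifferentiableAt ℝ (fun y => f ((chart x₀).symm y)) (chart x₀ x)) (v : Tan n x) :
    mfderiv 𝓔 𝓘(ℝ, ℝ) f x v =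
      fderiv ℝ (fun y => f ((chart x₀).symm y)) (chart x₀ x) (mfderiv 𝓔 𝓔 (chart x₀) x v) := by
  have h1 : f =ᶠ[𝓝 x] (fun y => f ((chart x₀).symm y)) ∘ chart x₀ := by
    filter_upwards [(isOpen_chart_source x₀).mem_nhds hx] with z hz
    exact congrArg f ((chart x₀).left_inv hz).symm
  have h2 := h1.mfderiv_eq (I := 𝓔) (I' := 𝓘(ℝ, ℝ))
  have h3 := mfderiv_comp x hf.mdifferentiableAt (mdifferentiableAt_chart hx)
  rw [mfderiv_eq_fderiv] at h3
  exact (congrArg (fun L : Model n →L[ℝ] ℝ => L v) h2).trans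
    (congrArg (fun L : Model n →L[ℝ] ℝ => L v) h3)

lemma mfderiv_eq_fderiv_chart {f : M → ℝ} {x : M}
    (hf : DifferentiableAt ℝ (fun y => f ((chart x).symm y)) (chart x x)) (v : Tan n x) :
    mfderiv 𝓔 𝓘(ℝ, ℝ) f x v = fderiv ℝ (fun y => f ((chart x).symm y)) (chart x x) v :=
  (mfderiv_eq_fderiv_of_mem_source (mem_extChartAt_source x) hf v).trans (congrArg (fun w : Model n =>
    fderiv ℝ (fun y => f ((chart x).symm y)) (chart x x) w) (mfderiv_chart_self x v))

lemma grad_eq (g : Metric n M) {f : M → ℝ} {x : M}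
    (hf : DifferentiableAt ℝ (fun y => f ((chart x).symm y)) (chart x x)) :
    (grad g f x : Model n) = raise g x fun l =>
      fderiv ℝ (fun y => f ((chart x).symm y)) (chart x x) (stdVec l) :=
  congrArg (raise g x) (funext fun _ => mfderiv_eq_fderiv_chart hf _)

end Gradient

/-! ### Barotropic geodesics and the Euler equation -/

section Barotropic

variable {n : ℕ} {N M : Type*} [TopologicalSpace N] [ChartedSpace (Model n) N]
  [TopologicalSpace M] [ChartedSpace (Model n) M]
  [IsManifold 𝓘(ℝ, Model n) ∞ N] [IsManifold 𝓘(ℝ, Model n) ∞ M]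
  [CompactSpace N] [MeasurableSpace N] [BorelSpace N] [T2Space M]

local notation "𝓔" => 𝓘(ℝ, Model n)
local notation "chart" => extChartAt 𝓘(ℝ, Model n)

variable {ν : VolumeForm n N} {g : Metric n M} {T : ℝ} {η : ℝ → N → M}
    {F : ℝ → N → ℝ} {u : ℝ → ∀ x : M, Tan n x} {ρ k : ℝ → M → ℝ} {lam : ℝ → ℝ}

omit [CompactSpace N] [MeasurableSpace N] [BorelSpace N] [T2Space M] in
/-- The derivative along a particle path is the material derivative `∂ₜ + u · ∇`. -/
lemma FlowCurve.hasDerivAt_along (hc : FlowCurve ν g T η F u ρ k) {t : ℝ} (ht : t ∈ Ioo (-T) T)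
    (p : N) {x : M} (hx : η t p ∈ (chart x).source) {q : ℝ × Model n → ℝ}
    (hq : DifferentiableAt ℝ q (t, chart x (η t p))) :
    HasDerivAt (fun τ => q (τ, chart x (η τ p)))
      (fderiv ℝ q (t, chart x (η t p)) (1, timeField x u (t, chart x (η t p)))) t := by
  have hmd : MDifferentiableAt 𝓘(ℝ, ℝ) 𝓔 (fun τ => η τ p) t :=
    MDifferentiableAt.comp (f := fun τ : ℝ => (τ, p)) t
      ((hc.contMDiffAt_map ht p).mdifferentiableAt (by simp))
      (mdifferentiableAt_id.prodMk (mdifferentiableAt_const (c := p)))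
  have h1 := hasDerivAt_chart_comp hx hmd
  have h2 : mfderiv 𝓔 𝓔 (chart x) (η t p) (velocity (fun τ => η τ p) t) =
      timeField x u (t, chart x (η t p)) := by
    rw [hc.velocity_eq t ht]
    exact (coordRep_chart hx _).symm
  rw [h2] at h1
  exact HasFDerivAt.comp_hasDerivAt (l := q) t hq.hasFDerivAt ((hasDerivAt_id t).prodMk h1)

/-- The charge `λ(ρ) k / ρ` is conserved along the flow of a geodesic, so that the velocity of a
geodesic remains in the barotropic distribution. -/
lemma FlowCurve.barotropic (hc : FlowCurve ν g T η F u ρ k) (hT : 0 < T)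
    (hlam : ContDiffOn ℝ ∞ lam (Ioi 0)) (hlam_pos : ∀ r, 0 < r → 0 < lam r)
    (hgeo : IsGeodesic ν g lam T η F)
    (hcont : ∀ x, ∀ z ∈ timeDomain n T x, fderiv ℝ (massCoord g x ρ) z (1, timeField x u z) +
      massCoord g x ρ z * tr n ((fderiv ℝ (timeField x u) z).comp (.inr ℝ ℝ (Model n))) = 0)
    (hk : ∀ p, k 0 (η 0 p) = ρ 0 (η 0 p) / lam (ρ 0 (η 0 p))) {t : ℝ} (ht : t ∈ Ioo (-T) T)
    (x : M) : k t x = ρ t x / lam (ρ t x) := by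
  obtain ⟨Φ, hΦ⟩ := hc.diffeo t ht
  obtain ⟨p, rfl⟩ : ∃ p, η t p = x := ⟨Φ.symm x, by rw [← hΦ, Φ.apply_symm_apply]⟩
  -- the charge of the particle `p`; it equals `1` initially
  set c : ℝ → ℝ := fun τ => lam (ρ τ (η τ p)) / ρ τ (η τ p) * k τ (η τ p) with hcdef
  have hder : ∀ τ ∈ Ioo (-T) T, HasDerivAt c 0 τ := by
    intro τ hτ
    set x := η τ p with hx
    have hxs : x ∈ (chart x).source := mem_extChartAt_source x
    have hz : (τ, chart x x) ∈ timeDomain n T x := ⟨hτ, chart_mem_target x⟩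
    -- varying the function component alone leaves a conservation law without a source
    have hgeo' := hc.geodesic_equation hlam hgeo (hcont x) 0 1 hz
    have hopen := (isOpen_timeDomain (n := n) T x).mem_nhds hz
    have hq : DifferentiableAt ℝ (fun w => lam (timeFun n x ρ w) / timeFun n x ρ w *
        timeFun n x k w) (τ, chart x x) := by
      have h1 : ContDiffOn ℝ ∞ (fun w => lam (timeFun n x ρ w) / timeFun n x ρ w)
          (timeDomain n T x) :=
        ContDiffOn.comp (g := fun r => lam r / r) (contDiffOn_div_self hlam)
          (hc.contDiffOn_density x) fun w hw => hc.density_pos hw.1 _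
      exact ((h1.mul (hc.contDiffOn_deriv x)).contDiffAt hopen).differentiableAt (by simp)
    have hzero : ∀ v y, metricCoord g x v 0 y = 0 := fun v y => by
      rw [metricCoord_eq_pullbackForm, map_zero]
    have hmass : massCoord g x ρ (τ, chart x x) ≠ 0 :=
      (mul_pos (hc.density_pos hτ _) (volCoord_pos g (chart_mem_target x))).ne'
    simp only [hzero, mul_one, add_zero, Prod.mk_zero_zero, map_zero, mul_zero, sub_zero] at hgeo'
    have h2 := hc.hasDerivAt_along hτ p hxs hq
    rw [(mul_eq_zero.mp hgeo').resolve_left hmass] at h2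
    refine h2.congr_of_eventuallyEq ?_
    have h3 : ContinuousAt (fun τ => η τ p) τ :=
      ContinuousAt.comp (g := fun z : ℝ × N => η z.1 z.2) (f := fun τ : ℝ => (τ, p))
        (hc.continuousAt_map hτ p) (by fun_prop)
    filter_upwards [h3.eventually ((isOpen_chart_source x).mem_nhds hxs)] with s hs
    simp only [hcdef, timeFun, (chart x).left_inv hs]
  have h0 : (0 : ℝ) ∈ Ioo (-T) T := ⟨neg_lt_zero.mpr hT, hT⟩
  have hconst : c t = c 0 := isOpen_Ioo.is_const_of_deriv_eq_zero isPreconnected_Ioo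
    (fun τ hτ => (hder τ hτ).differentiableAt.differentiableWithinAt)
    (fun τ hτ => (hder τ hτ).deriv) ht h0
  have hρ := hc.density_pos ht (η t p)
  have hρ0 := hc.density_pos h0 (η 0 p)
  have hl := hlam_pos _ hρ
  have hl0 := hlam_pos _ hρ0
  have h1 : c 0 = 1 := by
    simp only [hcdef]
    rw [hk p]
    field_simp
  rw [h1] at hconst
  simp only [hcdef] at hconst
  field_simp at hconst ⊢
  linarith

omit [CompactSpace N] [MeasurableSpace N] [BorelSpace N] [T2Space M] in
/-- The pressure is what the variation of `λ(r) / r` with the density contributes to the momentum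
equation, for a velocity with the function component `r / λ(r)`. -/
lemma pressure_eq (hlam : ContDiffOn ℝ ∞ lam (Ioi 0)) (hlam_pos : ∀ r, 0 < r → 0 < lam r) {r : ℝ}
    (hr : 0 < r) :
    -(1 / 2) * deriv (fun r => lam r / r) r * r ^ 2 * (r / lam r) ^ 2 = pressure lam r := by
  have h1 : DifferentiableAt ℝ lam r := (hlam.contDiffAt (Ioi_mem_nhds hr)).differentiableAt
      (by simp)
  have h2 := hlam_pos r hr
  rw [(h1.hasDerivAt.fun_div (hasDerivAt_id' r) hr.ne').deriv, pressure, phi]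
  field_simp
  ring

lemma contDiffOn_phi (hlam : ContDiffOn ℝ ∞ lam (Ioi 0)) : ContDiffOn ℝ ∞ (phi lam) (Ioi 0) :=
  contDiffOn_const.mul (hlam.sub (contDiffOn_id.mul (hlam.deriv_of_isOpen isOpen_Ioi (by simp))))

lemma contDiffOn_pressure (hlam : ContDiffOn ℝ ∞ lam (Ioi 0))
    (hlam_pos : ∀ r, 0 < r → 0 < lam r) : ContDiffOn ℝ ∞ (pressure lam) (Ioi 0) :=
  ((contDiffOn_id.pow 2).mul (contDiffOn_phi hlam)).div (hlam.pow 2) fun r hr =>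
    (pow_pos (hlam_pos r hr) 2).ne'

omit [CompactSpace N] [MeasurableSpace N] [BorelSpace N] [T2Space M] in
/-- The product rule for `⟨V, e⟩`, where `e` has constant components: the metric coefficients
themselves depend on the point. -/
lemma fderiv_metricCoord_comp (g : Metric n M) {x : M} {V : ℝ × Model n → Model n}
    {z : ℝ × Model n} (hV : DifferentiableAt ℝ V z) (hz : z.2 ∈ (chart x).target) (e : Model n)
    (v : ℝ × Model n) : fderiv ℝ (fun w => metricCoord g x (V w) e w.2) z v =
      metricCoord g x (fderiv ℝ V z v) e z.2 + fderiv ℝ (metricCoord g x (V z) e) z.2 v.2 := by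
  have h : (fun w : ℝ × Model n => metricCoord g x (V w) e w.2) = fun w => ∑ a,
      V w a * metricCoord g x (stdVec a) e w.2 := by
    ext w
    simp only [metricCoord_eq_pullbackForm]
    conv_lhs => rw [← sum_smul_stdVec (V w)]
    simp [map_sum, sum_apply]
  have h' : ∀ c : Model n, metricCoord g x c e = fun y => ∑ a, c a * metricCoord g x
      (stdVec a) e y := by
    intro c
    ext w
    simp only [metricCoord_eq_pullbackForm]
    conv_lhs => rw [← sum_smul_stdVec c]
    simp [map_sum, sum_apply]
  have hd : ∀ a, HasFDerivAt (metricCoord g x (stdVec a) e)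
      (fderiv ℝ (metricCoord g x (stdVec a) e) z.2) z.2 := fun a =>
    (((contDiffOn_metricCoord g x _ _).contDiffAt
      ((isOpen_chart_target x).mem_nhds hz)).differentiableAt (by simp)).hasFDerivAt
  have hVa : ∀ a, HasFDerivAt (fun w => V w a)
      ((EuclideanSpace.proj a : Model n →L[ℝ] ℝ).comp (fderiv ℝ V z)) z := fun a =>
    (EuclideanSpace.proj a : Model n →L[ℝ] ℝ).hasFDerivAt.comp z hV.hasFDerivAt
  have h1 := HasFDerivAt.fun_sum (u := Finset.univ) fun a _ =>
    (hVa a).fun_mul ((hd a).comp z hasFDerivAt_snd)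
  have h2 := HasFDerivAt.fun_sum (u := Finset.univ) fun a _ => (hd a).const_mul (V z a)
  rw [h, (show HasFDerivAt (fun w => ∑ a, V w a * metricCoord g x (stdVec a) e w.2) _ z from
    h1).fderiv, h' (V z), h2.fderiv, h' (fderiv ℝ V z v)]
  simp [Finset.sum_add_distrib, mul_comm, add_comm]

/-- The Euler equation of a barotropic geodesic, at the centre of a chart. -/
lemma FlowCurve.euler_coord (hc : FlowCurve ν g T η F u ρ k)
    (hlam : ContDiffOn ℝ ∞ lam (Ioi 0)) (hlam_pos : ∀ r, 0 < r → 0 < lam r)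
    (hgeo : IsGeodesic ν g lam T η F)
    (hcont : ∀ x, ∀ z ∈ timeDomain n T x, fderiv ℝ (massCoord g x ρ) z (1, timeField x u z) +
      massCoord g x ρ z * tr n ((fderiv ℝ (timeField x u) z).comp (.inr ℝ ℝ (Model n))) = 0)
    (hk : ∀ t ∈ Ioo (-T) T, ∀ x, k t x = ρ t x / lam (ρ t x)) {t : ℝ} (ht : t ∈ Ioo (-T) T)
    (x : M) : fderiv ℝ (timeField x u) (t, chart x x) (1, u t x) =
      -christoffel g x (u t x) (u t x) - (ρ t x)⁻¹ • raise g x (fun l =>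
        fderiv ℝ (fun z => pressure lam (timeFun n x ρ z)) (t, chart x x) (0, stdVec l)) := by
  have hz : (t, chart x x) ∈ timeDomain n T x := ⟨ht, chart_mem_target x⟩
  have hnear := (isOpen_timeDomain (n := n) T x).mem_nhds hz
  have hV : DifferentiableAt ℝ (timeField x u) (t, chart x x) :=
    ((hc.contDiffOn_field x).contDiffAt hnear).differentiableAt (by simp)
  have hVz : timeField x u (t, chart x x) = u t x := coordRep_self x (u t)
  have hρz : timeFun n x ρ (t, chart x x) = ρ t x :=
    congrArg (ρ t) (extChartAt_to_inv (I := 𝓔) x)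
  have hρpos := hc.density_pos ht x
  have hvol := volCoord_pos g (chart_mem_target x)
  -- on the barotropic distribution the force term of the geodesic equation is the pressure
  have hp : (fun w => -(1 / 2) * deriv (fun r => lam r / r) (timeFun n x ρ w) *
        timeFun n x ρ w ^ 2 * timeFun n x k w ^ 2) =ᶠ[𝓝 (t, chart x x)]
        fun z => pressure lam (timeFun n x ρ z) := by
    filter_upwards [hnear] with w hw
    have hw0 : 0 < timeFun n x ρ w := hc.density_pos hw.1 _
    rw [← pressure_eq hlam hlam_pos hw0,
      show timeFun n x k w = timeFun n x ρ w / lam (timeFun n x ρ w) from hk _ hw.1 _]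
  have key : ∀ l, metricCoord g x (fderiv ℝ (timeField x u) (t, chart x x) (1, u t x)) (stdVec l)
      (chart x x) = (-1) * ((1 / 2) *
    (fderiv ℝ (metricCoord g x (u t x) (stdVec l)) (chart x x) (u t x)
      + fderiv ℝ (metricCoord g x (u t x) (stdVec l)) (chart x x) (u t x)
      - fderiv ℝ (metricCoord g x (u t x) (u t x)) (chart x x) (stdVec l))) +
      -(ρ t x)⁻¹ * fderiv ℝ (fun z => pressure lam (timeFun n x ρ z)) (t, chart x x)
        (0, stdVec l) := by
    intro l
    -- shears in the direction of the `l`-th coordinate vector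
    have h := hc.geodesic_equation hlam hgeo (hcont x) (stdVec l) 0 hz
    simp only [mul_zero, zero_add] at h
    rw [fderiv_metricCoord_comp g hV hz.2, hp.fderiv_eq, massCoord, hVz, hρz] at h
    field_simp at h ⊢
    linear_combination h
  have h1 := eq_raise_of_inner g x _ _ fun l =>
    (inner_eq_metricCoord_self g x _ _).trans (key l)
  rw [h1]
  refine (raise_add g x _ _).trans ?_
  have e : ∀ A B : Model n, (-1 : ℝ) • A + (-(ρ t x)⁻¹) • B = -A - (ρ t x)⁻¹ • B := fun A B => by
    rw [neg_smul, neg_smul, one_smul, sub_eq_add_neg]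
  exact (congrArg₂ (fun A B : Model n => A + B) (raise_smul g x (-1) _)
    (raise_smul g x (-(ρ t x)⁻¹) _)).trans (e _ _)

end Barotropic

/-! ### Brackets, divergences and Christoffel symbols at the centre of a chart -/

section Coordinates

variable {n : ℕ} {M : Type*} [TopologicalSpace M] [ChartedSpace (Model n) M]
  [IsManifold 𝓘(ℝ, Model n) ∞ M]

local notation "𝓔" => 𝓘(ℝ, Model n)
local notation "chart" => extChartAt 𝓘(ℝ, Model n)

lemma contMDiffAt_time_chart {x : M} {z : ℝ × M} (hz : z.2 ∈ (chart x).source) :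
    ContMDiffAt (𝓘(ℝ, ℝ).prod 𝓔) 𝓘(ℝ, ℝ × Model n) ∞ (fun w : ℝ × M => (w.1, chart x w.2)) z := by
  refine ContMDiffAt.prodMk_space contMDiffAt_fst ?_
  exact ContMDiffAt.comp (g := chart x) (f := Prod.snd) z (contMDiffAt_chart hz) contMDiffAt_snd

omit [IsManifold 𝓘(ℝ, Model n) ∞ M] in
lemma eventually_mem_source (z : ℝ × M) :
    ∀ᶠ w : ℝ × M in 𝓝 z, w.2 ∈ (extChartAt 𝓘(ℝ, Model n) z.2).source :=
  continuousAt_snd.eventually ((isOpen_chart_source z.2).mem_nhds (mem_extChartAt_source z.2))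

lemma smoothFun_of_coord {T : ℝ} {f : ℝ → M → ℝ}
    (hf : ∀ x, ContDiffOn ℝ ∞ (timeFun n x f) (timeDomain n T x)) : SmoothFun n T f := by
  rintro z ⟨ht, -⟩
  refine ContMDiffAt.contMDiffWithinAt ?_
  have hs := mem_extChartAt_source (I := 𝓔) z.2
  have h1 := (hf z.2).contDiffAt ((isOpen_timeDomain T z.2).mem_nhds
    (show (z.1, chart z.2 z.2) ∈ timeDomain n T z.2 from ⟨ht, chart_mem_target _⟩))
  have h2 := ContMDiffAt.comp (g := timeFun n z.2 f) (f := fun w : ℝ × M => (w.1, chart z.2 w.2))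
    (I' := 𝓘(ℝ, ℝ × Model n)) z h1.contMDiffAt (contMDiffAt_time_chart hs)
  refine h2.congr_of_eventuallyEq ?_
  filter_upwards [eventually_mem_source (n := n) z] with w hw
  exact congrArg (f w.1) ((chart z.2).left_inv hw).symm

lemma smoothField_of_coord {T : ℝ} {X : ℝ → ∀ x : M, Tan n x}
    (hX : ∀ x, ContDiffOn ℝ ∞ (timeField x X) (timeDomain n T x)) : SmoothField T X := by
  rintro z ⟨ht, -⟩
  refine ContMDiffAt.contMDiffWithinAt ?_
  have hs := mem_extChartAt_source (I := 𝓔) z.2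
  have h1 := (hX z.2).contDiffAt ((isOpen_timeDomain T z.2).mem_nhds
    (show (z.1, chart z.2 z.2) ∈ timeDomain n T z.2 from ⟨ht, chart_mem_target _⟩))
  have h2 := ContMDiffAt.comp (g := timeField z.2 X) (f := fun w : ℝ × M => (w.1, chart z.2 w.2))
    (I' := 𝓘(ℝ, ℝ × Model n)) z h1.contMDiffAt (contMDiffAt_time_chart hs)
  rw [show (𝓔).tangent = (𝓔).prod 𝓘(ℝ, Model n) from rfl,
    (trivializationAt (Model n) (TangentSpace 𝓔) z.2).contMDiffAt_iff (by
      rw [TangentBundle.trivializationAt_source]; exact mem_chart_source _ z.2)]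
  refine ⟨contMDiffAt_snd, h2.congr_of_eventuallyEq ?_⟩
  filter_upwards [eventually_mem_source (n := n) z] with w hw
  rw [trivializationAt_snd hw]
  exact (coordRep_chart hw _).symm

/-- The Lie bracket of vector fields at the centre of a chart. -/
lemma mlieBracket_eq (X Y : ∀ x : M, Tan n x) (x : M) :
    (VectorField.mlieBracket 𝓔 X Y x : Model n) =
      fderiv ℝ (coordRep x Y) (chart x x) (X x) - fderiv ℝ (coordRep x X) (chart x x) (Y x) := by
  have hrep : ∀ Z : ∀ x : M, Tan n x, (VectorField.mpullbackWithin 𝓔 𝓔 (chart x).symm Z (range 𝓔)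
      : Model n → Model n) =ᶠ[𝓝 (chart x x)] coordRep x Z := by
    intro Z
    filter_upwards [(isOpen_chart_target x).mem_nhds (chart_mem_target x)] with y hy
    have h1 := mfderiv_extChartAt_comp_mfderivWithin_extChartAt_symm (I := 𝓔) hy
    have h2 := mfderivWithin_extChartAt_symm_comp_mfderiv_extChartAt (I := 𝓔) hy
    have h3 : (mfderivWithin 𝓔 𝓔 (chart x).symm (range 𝓔) y).inverse =
        mfderiv 𝓔 𝓔 (chart x) ((chart x).symm y) := ContinuousLinearMap.inverse_eq h2 h1
    exact congrArg (fun L : Model n →L[ℝ] Model n => L (Z ((chart x).symm y))) h3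
  have hid : (mfderiv 𝓔 𝓔 (chart x) x).inverse = ContinuousLinearMap.id ℝ (Model n) := by
    rw [mfderiv_extChartAt_self]
    exact ContinuousLinearMap.inverse_eq (ContinuousLinearMap.id_comp _)
        (ContinuousLinearMap.id_comp _)
  have h1 := VectorField.mlieBracketWithin_apply (I := 𝓔) (V := X) (W := Y) (s := univ) (x₀ := x)
  rw [VectorField.mlieBracketWithin_univ, preimage_univ, univ_inter,
      ModelWithCorners.range_eq_univ] at h1
  have h2 := congrArg (fun L : Model n →L[ℝ] Model n => L (VectorField.lieBracketWithin ℝ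
    (VectorField.mpullbackWithin 𝓔 𝓔 (chart x).symm X univ : Model n → Model n)
    (VectorField.mpullbackWithin 𝓔 𝓔 (chart x).symm Y univ : Model n → Model n) univ
    (chart x x))) hid
  have h3 : ∀ A B : Model n → Model n, VectorField.lieBracketWithin ℝ A B univ (chart x x) =
      fderiv ℝ B (chart x x) (A (chart x x)) - fderiv ℝ A (chart x x) (B (chart x x)) := by
    intro A B
    rw [VectorField.lieBracketWithin_univ]
    rfl
  refine ((h1.trans h2).trans (h3 _ _)).trans ?_
  have eX := hrep X
  have eY := hrep Y
  rw [ModelWithCorners.range_eq_univ] at eX eY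
  have vX : (VectorField.mpullbackWithin 𝓔 𝓔 (chart x).symm X univ : Model n → Model n) (chart x x)
      = X x := eX.self_of_nhds.trans (coordRep_self x X)
  have vY : (VectorField.mpullbackWithin 𝓔 𝓔 (chart x).symm Y univ : Model n → Model n) (chart x x)
      = Y x := eY.self_of_nhds.trans (coordRep_self x Y)
  show fderiv ℝ (VectorField.mpullbackWithin 𝓔 𝓔 (chart x).symm Y univ : Model n → Model n)
      (chart x x)
    ((VectorField.mpullbackWithin 𝓔 𝓔 (chart x).symm X univ : Model n → Model n) (chart x x)) -
    fderiv ℝ (VectorField.mpullbackWithin 𝓔 𝓔 (chart x).symm X univ : Model n → Model n) (chart x x)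
    ((VectorField.mpullbackWithin 𝓔 𝓔 (chart x).symm Y univ : Model n → Model n) (chart x x)) = _
  rw [vX, vY, eX.fderiv_eq, eY.fderiv_eq]

/-- The divergence of `f X` at the centre of a chart. -/
lemma div_smul_eq (g : Metric n M) {x : M} {f : M → ℝ} {X : ∀ z : M, Tan n z}
    (hf : DifferentiableAt ℝ (fun y => f ((chart x).symm y)) (chart x x))
    (hX : DifferentiableAt ℝ (coordRep x X) (chart x x)) :
    div g (fun z => f z • X z) x = fderiv ℝ (fun y => f ((chart x).symm y)) (chart x x) (X x) +
      f x * (tr n (fderiv ℝ (coordRep x X) (chart x x)) +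
        fderiv ℝ (volCoord g x) (chart x x) (X x) / volCoord g x (chart x x)) := by
  have h1 : coordRep x (fun z => f z • X z) = fun y => f ((chart x).symm y) • coordRep x X y := by
    ext1 y
    exact map_smul (mfderiv 𝓔 𝓔 (chart x) ((chart x).symm y)) _ _
  set v : Model n := X x with hv
  have hself : coordRep x X (chart x x) = v := coordRep_self x X
  have h2 : fderiv ℝ (coordRep x (fun z => f z • X z)) (chart x x) =
      f x • fderiv ℝ (coordRep x X) (chart x x) +
      (fderiv ℝ (fun y => f ((chart x).symm y)) (chart x x)).smulRight v := by
    rw [h1, fderiv_fun_smul hf hX, extChartAt_to_inv, hself]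
  have h3 : ∀ (L : Model n →L[ℝ] ℝ) (v : Model n), tr n (L.smulRight v) = L v := by
    intro L v
    conv_rhs => rw [← sum_smul_stdVec v]
    rw [tr_apply, map_sum]
    refine Finset.sum_congr rfl fun i _ => ?_
    simp [mul_comm]
  rw [div_eq, h2, map_add, map_smul, h3]
  have h4 : fderiv ℝ (volCoord g x) (chart x x) (f x • v) =
      f x * fderiv ℝ (volCoord g x) (chart x x) v := map_smul _ _ _
  rw [smul_eq_mul]
  refine (congrArg (fun c => f x * tr n (fderiv ℝ (coordRep x X) (chart x x)) +
    fderiv ℝ (fun y => f ((chart x).symm y)) (chart x x) v + c / volCoord g x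
        (chart x x)) h4).trans ?_
  ring

lemma fderiv_metricCoord_add (g : Metric n M) (x : M) (v v' w e : Model n) :
    fderiv ℝ (metricCoord g x (v + v') w) (chart x x) e =
      fderiv ℝ (metricCoord g x v w) (chart x x) e +
        fderiv ℝ (metricCoord g x v' w) (chart x x) e := by
  have hx := chart_mem_target (n := n) x
  rw [fderiv_metricCoord_expand g hx, fderiv_metricCoord_expand g hx v,
    fderiv_metricCoord_expand g hx v']
  simp only [PiLp.add_apply, add_mul, Finset.sum_add_distrib]

lemma fderiv_metricCoord_smul (g : Metric n M) (x : M) (c : ℝ) (v w e : Model n) :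
    fderiv ℝ (metricCoord g x (c • v) w) (chart x x) e =
      c * fderiv ℝ (metricCoord g x v w) (chart x x) e := by
  have hx := chart_mem_target (n := n) x
  rw [fderiv_metricCoord_expand g hx, fderiv_metricCoord_expand g hx v]
  simp only [PiLp.smul_apply, smul_eq_mul, Finset.mul_sum, mul_assoc]

lemma christoffel_comm (g : Metric n M) (x : M) (a b : Model n) :
    christoffel g x a b = christoffel g x b a := by
  unfold christoffel
  rw [metricCoord_comm g x a b]
  congr 1
  ext1 l
  ring

lemma christoffel_add (g : Metric n M) (x : M) (a a' b : Model n) :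
    christoffel g x (a + a') b = christoffel g x a b + christoffel g x a' b := by
  unfold christoffel
  rw [← raise_add]
  congr 1
  ext1 l
  rw [fderiv_metricCoord_add, fderiv_metricCoord_add, map_add]
  ring

lemma christoffel_smul (g : Metric n M) (x : M) (c : ℝ) (a b : Model n) :
    christoffel g x (c • a) b = c • christoffel g x a b := by
  unfold christoffel
  rw [← raise_smul]
  congr 1
  ext1 l
  rw [fderiv_metricCoord_smul, fderiv_metricCoord_smul, map_smul, smul_eq_mul]
  ring

/-- The Christoffel symbols at the centre of a chart as a bilinear map. -/
noncomputable def christoffelForm (g : Metric n M) (x : M) : Model n →L[ℝ] Model n →L[ℝ] Model n :=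
  (LinearMap.mk₂ ℝ (christoffel g x) (christoffel_add g x) (christoffel_smul g x)
    (fun a b b' => by rw [christoffel_comm, christoffel_add, christoffel_comm g x b,
      christoffel_comm g x b'])
    (fun c a b => by rw [christoffel_comm, christoffel_smul, christoffel_comm g x b])
    ).toContinuousBilinearMap

/-- The linearization of the quadratic term `Γ(V, V)` of the covariant acceleration. -/
lemma hasDerivAt_christoffel (g : Metric n M) (x : M) {V : ℝ → Model n} {V' : Model n} {s : ℝ}
    (hV : HasDerivAt V V' s) : HasDerivAt (fun s => christoffel g x (V s) (V s))
      (christoffel g x V' (V s) + christoffel g x (V s) V') s := by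
  have h := ((christoffelForm g x).hasFDerivAt.comp_hasDerivAt s hV).clm_apply hV
  exact h

lemma hasDerivAt_raise (g : Metric n M) (x : M) {α : ℝ → Fin n → ℝ} {α' : Fin n → ℝ} {s : ℝ}
    (hα : ∀ l, HasDerivAt (fun s => α s l) (α' l) s) :
    HasDerivAt (fun s => raise g x (α s)) (raise g x α') s := by
  unfold raise
  exact HasDerivAt.fun_sum fun k _ =>
    (HasDerivAt.fun_sum fun l _ => (hα l).const_mul _).smul_const _

end Coordinates

/-! ### Functions of two parameters and a point -/

section Slices

variable {n : ℕ} {G : Type*} [NormedAddCommGroup G] [NormedSpace ℝ G]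

lemma fderiv_slice {f : (ℝ × ℝ) × Model n → G} {s : ℝ} {z : ℝ × Model n}
    (hf : DifferentiableAt ℝ f ((s, z.1), z.2)) (v : ℝ × Model n) :
    fderiv ℝ (fun z : ℝ × Model n => f ((s, z.1), z.2)) z v =
      fderiv ℝ f ((s, z.1), z.2) ((0, v.1), v.2) := by
  have h1 : HasFDerivAt (fun z : ℝ × Model n => ((s, z.1), z.2))
      ((((0 : ℝ × Model n →L[ℝ] ℝ).prod (.fst ℝ ℝ (Model n))).prod (.snd ℝ ℝ (Model n)))) z :=
    ((hasFDerivAt_const s z).prodMk hasFDerivAt_fst).prodMk hasFDerivAt_snd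
  have h2 := (hf.hasFDerivAt.comp z h1).fderiv
  rw [show (fun z : ℝ × Model n => f ((s, z.1), z.2)) = f ∘ fun z => ((s, z.1), z.2) from rfl, h2]
  rfl

lemma fderiv_slice_inr {f : (ℝ × ℝ) × Model n → G} {s : ℝ} {z : ℝ × Model n}
    (hf : DifferentiableAt ℝ f ((s, z.1), z.2)) :
    (fderiv ℝ (fun z : ℝ × Model n => f ((s, z.1), z.2)) z).comp (.inr ℝ ℝ (Model n)) =
      (fderiv ℝ f ((s, z.1), z.2)).comp (.inr ℝ (ℝ × ℝ) (Model n)) := by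
  ext1 v
  exact fderiv_slice hf (0, v)

/-- The derivative of the differential is the differential of the derivative. -/
lemma fderiv_fderiv_eq {P : Type*} [NormedAddCommGroup P] [NormedSpace ℝ P] {f : P → G} {z : P}
    (hf : ContDiffAt ℝ ∞ f z) (e : P) :
    fderiv ℝ (fderiv ℝ f) z e = fderiv ℝ (fun w => fderiv ℝ f w e) z := by
  have hd : DifferentiableAt ℝ (fderiv ℝ f) z :=
    (hf.fderiv_right (m := 1) (by norm_cast)).differentiableAt (by simp)
  have hs : IsSymmSndFDerivAt ℝ f z := hf.isSymmSndFDerivAt two_le_infty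
  ext1 v
  rw [fderiv_clm_apply hd (by fun_prop)]
  simp
  exact hs.eq e v

variable {f : (ℝ × ℝ) × Model n → G} {z : (ℝ × ℝ) × Model n}

lemma hasDerivAt_fderiv_s (hf : ContDiffAt ℝ ∞ f z) :
    HasDerivAt (fun s => fderiv ℝ f ((s, z.1.2), z.2))
      (fderiv ℝ (fun w => fderiv ℝ f w ((1, 0), 0)) z) z.1.1 := by
  rw [← fderiv_fderiv_eq hf]
  exact fderiv_param_s ((hf.fderiv_right (m := 1) (by norm_cast)).differentiableAt (by simp))

lemma hasDerivAt_s (hf : ContDiffAt ℝ ∞ f z) :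
    HasDerivAt (fun s => f ((s, z.1.2), z.2)) (fderiv ℝ f z ((1, 0), 0)) z.1.1 :=
  fderiv_param_s (hf.differentiableAt (by simp))

lemma contDiffOn_fderiv_slice {U : Set ((ℝ × ℝ) × Model n)} (hU : IsOpen U)
    (hf : ContDiffOn ℝ ∞ f U) {W : Set (ℝ × Model n)} {s : ℝ}
    (hW : ∀ z ∈ W, ((s, z.1), z.2) ∈ U) (e : (ℝ × ℝ) × Model n) :
    ContDiffOn ℝ ∞ (fun z : ℝ × Model n => fderiv ℝ f ((s, z.1), z.2) e) W := by
  have h1 : ContDiffOn ℝ ∞ (fun w => fderiv ℝ f w e) U := fun w hw =>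
    (contDiffAt_fderiv_apply (hf.contDiffAt (hU.mem_nhds hw)) e).contDiffWithinAt
  exact h1.comp (f := fun z : ℝ × Model n => ((s, z.1), z.2))
    ((contDiff_const.prodMk contDiff_fst).prodMk contDiff_snd).contDiffOn hW

end Slices

/-! ### Variations of fields and functions -/

section Linearization

variable {n : ℕ} {M : Type*} [TopologicalSpace M] [ChartedSpace (Model n) M]
  [IsManifold 𝓘(ℝ, Model n) ∞ M]

local notation "𝓔" => 𝓘(ℝ, Model n)
local notation "chart" => extChartAt 𝓘(ℝ, Model n)

variable {S T : ℝ} {x : M} {u : ℝ → ℝ → ∀ x : M, Tan n x} {ρ : ℝ → ℝ → M → ℝ}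

/-- The derivative of a family of vector fields with respect to the parameter `s` at `s = 0`. -/
noncomputable def fieldVariation (u : ℝ → ℝ → ∀ x : M, Tan n x) (t : ℝ) (x : M) : Tan n x :=
  deriv (fun s => (u s t x : Model n)) 0

/-- The derivative of a family of functions with respect to the parameter `s` at `s = 0`. -/
noncomputable def funVariation (ρ : ℝ → ℝ → M → ℝ) (t : ℝ) (x : M) : ℝ :=
  deriv (fun s => ρ s t x) 0

omit [IsManifold 𝓘(ℝ, Model n) ∞ M] in
lemma mem_eulerDomain_center {s t : ℝ} (hs : s ∈ Ioo (-S) S) (ht : t ∈ Ioo (-T) T) (x : M) :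
    ((s, t), chart x x) ∈ eulerDomain n S T x := ⟨⟨hs, ht⟩, chart_mem_target x⟩

lemma mem_eulerDomain_slice {s : ℝ} (hs : s ∈ Ioo (-S) S) {z : ℝ × Model n}
    (hz : z ∈ timeDomain n T x) : ((s, z.1), z.2) ∈ eulerDomain n S T x := ⟨⟨hs, hz.1⟩, hz.2⟩

lemma contDiffAt_of_eulerDomain {G : Type*} [NormedAddCommGroup G] [NormedSpace ℝ G]
    {f : (ℝ × ℝ) × Model n → G} (hf : ContDiffOn ℝ ∞ f (eulerDomain n S T x))
    {z : (ℝ × ℝ) × Model n} (hz : z ∈ eulerDomain n S T x) : ContDiffAt ℝ ∞ f z :=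
  hf.contDiffAt ((isOpen_eulerDomain S T x).mem_nhds hz)

lemma contDiffOn_slice {G : Type*} [NormedAddCommGroup G] [NormedSpace ℝ G]
    {f : (ℝ × ℝ) × Model n → G} (hf : ContDiffOn ℝ ∞ f (eulerDomain n S T x)) {s : ℝ}
    (hs : s ∈ Ioo (-S) S) :
    ContDiffOn ℝ ∞ (fun z : ℝ × Model n => f ((s, z.1), z.2)) (timeDomain n T x) :=
  hf.comp (f := fun z : ℝ × Model n => ((s, z.1), z.2))
    ((contDiff_const.prodMk contDiff_fst).prodMk contDiff_snd).contDiffOn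
    fun _ hz => mem_eulerDomain_slice hs hz

/-- In a chart, `∂ₛ` at `s = 0` is a partial derivative of the coordinate expression. -/
lemma timeFun_funVariation (hS : 0 < S) (hρ : ContDiffOn ℝ ∞ (funCoord n x ρ) (eulerDomain n S T x))
    {z : ℝ × Model n} (hz : z ∈ timeDomain n T x) :
    timeFun n x (funVariation ρ) z = fderiv ℝ (funCoord n x ρ) ((0, z.1), z.2) ((1, 0), 0) :=
  (hasDerivAt_s (z := ((0, z.1), z.2)) (contDiffAt_of_eulerDomain hρ
    (mem_eulerDomain_slice ⟨neg_lt_zero.mpr hS, hS⟩ hz))).deriv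

/-- The components of `∂ₛ u` are the derivatives of the components of `u`, since the tangent space
at the point at which the derivative is taken does not depend on `s`. -/
lemma timeField_fieldVariation (hS : 0 < S)
    (hu : ContDiffOn ℝ ∞ (fieldCoord x u) (eulerDomain n S T x))
    {z : ℝ × Model n} (hz : z ∈ timeDomain n T x) :
    timeField x (fieldVariation u) z =
      fderiv ℝ (fieldCoord x u) ((0, z.1), z.2) ((1, 0), 0) := by
  have h1 := hasDerivAt_s (z := ((0, z.1), z.2)) (contDiffAt_of_eulerDomain hu
    (mem_eulerDomain_slice ⟨neg_lt_zero.mpr hS, hS⟩ hz))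
  set A : Model n →L[ℝ] Model n := coordFrame x z.2 with hA
  have h2 : HasDerivAt (fun s => A (fieldCoord x u ((s, z.1), z.2)))
      (A (fderiv ℝ (fieldCoord x u) ((0, z.1), z.2) ((1, 0), 0))) 0 :=
    A.hasFDerivAt.comp_hasDerivAt (0 : ℝ) h1
  have h3 : (fun s => A (fieldCoord x u ((s, z.1), z.2))) =
      fun s => (u s z.1 ((chart x).symm z.2) : Model n) := by
    ext1 s
    exact coordVec_coordRep hz.2 (u s z.1)
  rw [h3] at h2
  have h4 : (fieldVariation u z.1 ((chart x).symm z.2) : Model n) = _ := h2.deriv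
  have h5 := mfderiv_chart_coordVec hz.2 (fderiv ℝ (fieldCoord x u) ((0, z.1), z.2) ((1, 0), 0))
  exact (congrArg (fun v : Model n => (show Model n →L[ℝ] Model n from
    mfderiv 𝓔 𝓔 (chart x) ((chart x).symm z.2)) v) h4).trans h5

variable {t : ℝ} (ht : t ∈ Ioo (-T) T)
  (hρs : ContDiffOn ℝ ∞ (funCoord n x ρ) (eulerDomain n S T x))
  (hus : ContDiffOn ℝ ∞ (fieldCoord x u) (eulerDomain n S T x))

lemma funCoord_center (ρ : ℝ → ℝ → M → ℝ) (s t : ℝ) (x : M) :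
    funCoord n x ρ ((s, t), chart x x) = ρ s t x :=
  congrArg (ρ s t) (extChartAt_to_inv (I := 𝓔) x)

lemma fieldCoord_center (u : ℝ → ℝ → ∀ x : M, Tan n x) (s t : ℝ) (x : M) :
    fieldCoord x u ((s, t), chart x x) = u s t x := coordRep_self x (u s t)

include ht hρs in
lemma hasDerivAt_funVariation (hS : 0 < S) :
    HasDerivAt (fun s => ρ s t x) (funVariation ρ t x) 0 := by
  have h := hasDerivAt_s (contDiffAt_of_eulerDomain hρs
    (mem_eulerDomain_center ⟨neg_lt_zero.mpr hS, hS⟩ ht x))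
  have e : (fun s => funCoord n x ρ ((s, t), chart x x)) = fun s => ρ s t x :=
    funext fun s => funCoord_center ρ s t x
  exact ((e ▸ h : HasDerivAt (fun s => ρ s t x) _ 0).differentiableAt).hasDerivAt

include ht hus in
lemma hasDerivAt_fieldVariation (hS : 0 < S) :
    HasDerivAt (fun s => u s t x) (fieldVariation u t x) 0 := by
  have h := hasDerivAt_s (contDiffAt_of_eulerDomain hus
    (mem_eulerDomain_center ⟨neg_lt_zero.mpr hS, hS⟩ ht x))
  set w : ℝ → Model n := fun s => u s t x
  have e : (fun s => fieldCoord x u ((s, t), chart x x)) = w :=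
    funext fun s => fieldCoord_center u s t x
  have h' : HasDerivAt (fun s => fieldCoord x u ((s, t), chart x x)) _ 0 := h
  rw [e] at h'
  exact h'.differentiableAt.hasDerivAt

omit [IsManifold 𝓘(ℝ, Model n) ∞ M] in
include ht in
lemma hasDerivAt_time_of_eqOn {G : Type*} [NormedAddCommGroup G] [NormedSpace ℝ G]
    {c : ℝ → G} {f : (ℝ × ℝ) × Model n → G} {s : ℝ} {y : Model n}
    (hf : DifferentiableAt ℝ f ((s, t), y)) (hc : ∀ τ ∈ Ioo (-T) T, c τ = f ((s, τ), y)) :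
    HasDerivAt c (fderiv ℝ f ((s, t), y) ((0, 1), 0)) t := by
  refine (fderiv_param_t hf).congr_of_eventuallyEq ?_
  filter_upwards [isOpen_Ioo.mem_nhds ht] with τ hτ using hc τ hτ

/-- The coordinate form of the divergence of `f X`, for a family in the parameters `(s, t)`. -/
lemma div_family_eq (g : Metric n M) {f : M → ℝ} {X : ∀ z : M, Tan n z} {p : ℝ × ℝ}
    {f' : (ℝ × ℝ) × Model n → ℝ} {X' : (ℝ × ℝ) × Model n → Model n}
    (hf : DifferentiableAt ℝ f' (p, chart x x)) (hX : DifferentiableAt ℝ X' (p, chart x x))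
    (hff' : ∀ y ∈ (chart x).target, f ((chart x).symm y) = f' (p, y))
    (hXX' : ∀ y ∈ (chart x).target, coordRep x X y = X' (p, y)) :
    div g (fun z => f z • X z) x = fderiv ℝ f' (p, chart x x) (0, X' (p, chart x x)) +
      f' (p, chart x x) * (tr n ((fderiv ℝ X' (p, chart x x)).comp (.inr ℝ (ℝ × ℝ) (Model n))) +
        fderiv ℝ (volCoord g x) (chart x x) (X' (p, chart x x)) / volCoord g x (chart x x)) := by
  have hnear := (isOpen_chart_target x).mem_nhds (chart_mem_target (n := n) x)
  have hf1 := fderiv_param_y hf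
  have hX1 := fderiv_param_y hX
  have e1 : (fun y => f ((chart x).symm y)) =ᶠ[𝓝 (chart x x)] fun y => f' (p, y) := by
    filter_upwards [hnear] with y hy using hff' y hy
  have e2 : coordRep x X =ᶠ[𝓝 (chart x x)] fun y => X' (p, y) := by
    filter_upwards [hnear] with y hy using hXX' y hy
  have hf2 := hf1.congr_of_eventuallyEq e1
  have hX2 := hX1.congr_of_eventuallyEq e2
  have hXx : X' (p, chart x x) = X x := e2.self_of_nhds.symm.trans (coordRep_self x X)
  have hfx : f' (p, chart x x) = f x :=
    e1.self_of_nhds.symm.trans (congrArg f (extChartAt_to_inv (I := 𝓔) x))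
  rw [div_smul_eq g hf2.differentiableAt hX2.differentiableAt, hf2.fderiv, hX2.fderiv, hXx, hfx]
  rfl

end Linearization

/-! ### Families of flows and the continuity equation -/

section FlowFamily

variable {n : ℕ} {N M : Type*} [TopologicalSpace N] [ChartedSpace (Model n) N]
  [TopologicalSpace M] [ChartedSpace (Model n) M]
  [IsManifold 𝓘(ℝ, Model n) ∞ N] [IsManifold 𝓘(ℝ, Model n) ∞ M]

local notation "𝓔" => 𝓘(ℝ, Model n)
local notation "chart" => extChartAt 𝓘(ℝ, Model n)

/-- A smooth family `(η s, F s)` of curves of configurations whose velocity fields in the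
directions `t` and `s` are `u` and `j`, with density `ρ`, and derivative `k ∘ η` of the function
component in the direction `t`. -/
structure FlowFamily (ν : VolumeForm n N) (g : Metric n M) (S T : ℝ) (η : ℝ → ℝ → N → M)
    (F : ℝ → ℝ → N → ℝ) (u j : ℝ → ℝ → ∀ x : M, Tan n x) (ρ k : ℝ → ℝ → M → ℝ) : Prop where
  diffeo : ∀ s ∈ Ioo (-S) S, ∀ t ∈ Ioo (-T) T,
    ∃ Φ : Diffeomorph 𝓘(ℝ, Model n) 𝓘(ℝ, Model n) N M ∞, ⇑Φ = η s t
  contMDiffOn_map : ContMDiffOn (𝓘(ℝ, ℝ).prod (𝓘(ℝ, ℝ).prod 𝓘(ℝ, Model n))) 𝓘(ℝ, Model n) ∞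
    (fun z : ℝ × ℝ × N => η z.1 z.2.1 z.2.2) (Ioo (-S) S ×ˢ Ioo (-T) T ×ˢ univ)
  contMDiffOn_fun : ContMDiffOn (𝓘(ℝ, ℝ).prod (𝓘(ℝ, ℝ).prod 𝓘(ℝ, Model n))) 𝓘(ℝ, ℝ) ∞
    (fun z : ℝ × ℝ × N => F z.1 z.2.1 z.2.2) (Ioo (-S) S ×ˢ Ioo (-T) T ×ˢ univ)
  velocity_time : ∀ s ∈ Ioo (-S) S, ∀ t ∈ Ioo (-T) T, ∀ p,
    velocity (fun τ => η s τ p) t = u s t (η s t p)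
  velocity_param : ∀ s ∈ Ioo (-S) S, ∀ t ∈ Ioo (-T) T, ∀ p,
    velocity (fun σ => η σ t p) s = j s t (η s t p)
  density : ∀ s ∈ Ioo (-S) S, ∀ t ∈ Ioo (-T) T, IsDensity ν g (η s t) (ρ s t)
  deriv_eq : ∀ s ∈ Ioo (-S) S, ∀ t ∈ Ioo (-T) T, ∀ p,
    deriv (fun τ => F s τ p) t = k s t (η s t p)

/-- A function of the particles, for a family of diffeomorphisms, is a function of the positions. -/
lemma exists_eulerian {E : Type*} [Zero E] {S T : ℝ} {η : ℝ → ℝ → N → M}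
    (hη : ∀ s ∈ Ioo (-S) S, ∀ t ∈ Ioo (-T) T,
      ∃ Φ : Diffeomorph 𝓘(ℝ, Model n) 𝓘(ℝ, Model n) N M ∞, ⇑Φ = η s t) (f : ℝ → ℝ → N → E) :
    ∃ k : ℝ → ℝ → M → E, ∀ s ∈ Ioo (-S) S, ∀ t ∈ Ioo (-T) T, ∀ p, f s t p = k s t (η s t p) := by
  refine ⟨fun s t => Function.extend (η s t) (f s t) 0, fun s hs t ht p => ?_⟩
  obtain ⟨Φ, hΦ⟩ := hη s hs t ht
  exact (Function.Injective.extend_apply (hΦ ▸ Φ.injective) _ _ _).symm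

variable {ν : VolumeForm n N} {g : Metric n M} {S T : ℝ} {η : ℝ → ℝ → N → M}
  {F : ℝ → ℝ → N → ℝ} {u j : ℝ → ℝ → ∀ x : M, Tan n x} {ρ k : ℝ → ℝ → M → ℝ}

lemma FlowFamily.smoothFamily (hf : FlowFamily ν g S T η F u j ρ k) : SmoothFamily n S T η :=
  smoothFamily_of_contMDiffOn hf.contMDiffOn_map

lemma FlowFamily.surjective (hf : FlowFamily ν g S T η F u j ρ k) :
    ∀ s ∈ Ioo (-S) S, ∀ t ∈ Ioo (-T) T, Function.Surjective (η s t) := fun s hs t ht => by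
  obtain ⟨Φ, hΦ⟩ := hf.diffeo s hs t ht
  exact hΦ ▸ Φ.surjective

lemma FlowFamily.contDiffOn_field (hf : FlowFamily ν g S T η F u j ρ k) (x : M) :
    ContDiffOn ℝ ∞ (fieldCoord x u) (eulerDomain n S T x) :=
  contDiffOn_fieldCoord_t hf.smoothFamily hf.density hf.surjective hf.velocity_time x

lemma FlowFamily.contDiffOn_variation (hf : FlowFamily ν g S T η F u j ρ k) (x : M) :
    ContDiffOn ℝ ∞ (fieldCoord x j) (eulerDomain n S T x) :=
  contDiffOn_fieldCoord_s hf.smoothFamily hf.density hf.surjective hf.velocity_param x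

lemma FlowFamily.contDiffOn_density (hf : FlowFamily ν g S T η F u j ρ k) (x : M) :
    ContDiffOn ℝ ∞ (funCoord n x ρ) (eulerDomain n S T x) :=
  contDiffOn_funCoord_density hf.smoothFamily hf.density hf.surjective x

lemma FlowFamily.density_pos (hf : FlowFamily ν g S T η F u j ρ k) {s t : ℝ}
    (hs : s ∈ Ioo (-S) S) (ht : t ∈ Ioo (-T) T) (x : M) : 0 < ρ s t x := by
  obtain ⟨p, rfl⟩ := hf.surjective s hs t ht x
  exact (hf.density s hs t ht).pos_apply p

lemma FlowFamily.funCoord_pos (hf : FlowFamily ν g S T η F u j ρ k) {x : M}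
    {w : (ℝ × ℝ) × Model n} (hw : w ∈ eulerDomain n S T x) : 0 < funCoord n x ρ w :=
  hf.density_pos hw.1.1 hw.1.2 _

/-- The continuity equation in a chart, in a parameter direction `e` in which the family has the
velocity field `V`. -/
lemma FlowFamily.continuity (hf : FlowFamily ν g S T η F u j ρ k) {x : M} {e : ℝ × ℝ}
    {V : (ℝ × ℝ) × Model n → Model n} (hV : ContDiffOn ℝ ∞ V (eulerDomain n S T x))
    (hVc : ∀ p, ∀ z ∈ lagrDomain S T η p x,
      V (z.1, lagrCoord η p x z) = fderiv ℝ (lagrCoord η p x) z (e, 0))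
    {w : (ℝ × ℝ) × Model n} (hw : w ∈ eulerDomain n S T x) :
    fderiv ℝ (funCoord n x ρ) w (e, V w) + funCoord n x ρ w *
      (tr n ((fderiv ℝ V w).comp (.inr ℝ (ℝ × ℝ) (Model n))) +
        fderiv ℝ (volCoord g x) w.2 (V w) / volCoord g x w.2) = 0 := by
  have h := continuity_coord hf.smoothFamily hf.density hf.surjective hV hVc hw
  have hvol := volCoord_pos g hw.2
  have h1 := (contDiffAt_of_eulerDomain (hf.contDiffOn_density x) hw).differentiableAt (by simp)
  have h2 : DifferentiableAt ℝ (volCoord g x) w.2 :=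
    ((contDiffOn_volCoord g x).contDiffAt
      ((isOpen_chart_target x).mem_nhds hw.2)).differentiableAt (by simp)
  have h3 : HasFDerivAt (fun w : (ℝ × ℝ) × Model n => volCoord g x w.2)
      ((fderiv ℝ (volCoord g x) w.2).comp (.snd ℝ (ℝ × ℝ) (Model n))) w :=
    h2.hasFDerivAt.comp w hasFDerivAt_snd
  rw [(h1.hasFDerivAt.fun_mul h3).fderiv] at h
  simp only [add_apply, smul_apply, ContinuousLinearMap.comp_apply,
    ContinuousLinearMap.coe_snd', smul_eq_mul] at h
  field_simp
  linear_combination h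

/-- The continuity equation at the centre of a chart, in terms of the divergence. -/
lemma FlowFamily.continuity_div (hf : FlowFamily ν g S T η F u j ρ k) {x : M} {e : ℝ × ℝ}
    {X : ℝ → ℝ → ∀ x : M, Tan n x} (hX : ContDiffOn ℝ ∞ (fieldCoord x X) (eulerDomain n S T x))
    (hXc : ∀ p, ∀ z ∈ lagrDomain S T η p x,
      fieldCoord x X (z.1, lagrCoord η p x z) = fderiv ℝ (lagrCoord η p x) z (e, 0))
    {s t : ℝ} (hs : s ∈ Ioo (-S) S) (ht : t ∈ Ioo (-T) T) :
    fderiv ℝ (funCoord n x ρ) ((s, t), chart x x) (e, 0) = -div g (fun y => ρ s t y • X s t y) x :=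
        by
  have hw := mem_eulerDomain_center (n := n) hs ht x
  have h := hf.continuity hX hXc hw
  rw [div_family_eq (p := (s, t)) (f' := funCoord n x ρ) (X' := fieldCoord x X) g
    ((contDiffAt_of_eulerDomain (hf.contDiffOn_density x) hw).differentiableAt (by simp))
    ((contDiffAt_of_eulerDomain hX hw).differentiableAt (by simp)) (fun _ _ => rfl)
    (fun _ _ => rfl)]
  have hsplit : ((e, fieldCoord x X ((s, t), chart x x)) : (ℝ × ℝ) × Model n) =
      (e, 0) + (0, fieldCoord x X ((s, t), chart x x)) := by simp
  rw [hsplit, map_add] at h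
  linear_combination h

/-- The continuity equation for the time direction, differentiated in the parameter `s`. -/
lemma FlowFamily.linearized_continuity (hf : FlowFamily ν g S T η F u j ρ k) (hS : 0 < S) {t : ℝ}
    (ht : t ∈ Ioo (-T) T) (x : M) :
    HasDerivAt (fun τ => funVariation ρ τ x)
      (-div g (fun y => funVariation ρ t y • u 0 t y) x -
        div g (fun y => ρ 0 t y • fieldVariation u t y) x) t := by
  have h0 : (0 : ℝ) ∈ Ioo (-S) S := ⟨neg_lt_zero.mpr hS, hS⟩
  have hw := mem_eulerDomain_center (n := n) h0 ht x
  set w : (ℝ × ℝ) × Model n := ((0, t), chart x x) with hwdef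
  have hR := contDiffAt_of_eulerDomain (hf.contDiffOn_density x) hw
  have hU := contDiffAt_of_eulerDomain (hf.contDiffOn_field x) hw
  set R := funCoord n x ρ with hRdef
  set U := fieldCoord x u with hUdef
  set e : (ℝ × ℝ) × Model n := ((1, 0), 0) with he
  have hRe := (contDiffAt_fderiv_apply hR e).differentiableAt (by simp)
  have hUe := (contDiffAt_fderiv_apply hU e).differentiableAt (by simp)
  -- both sides of the continuity equation as functions of the parameter
  have hzero : (fun s => fderiv ℝ R ((s, t), chart x x) ((0, 1), U ((s, t), chart x x)) +
      R ((s, t), chart x x) *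
      (tr n ((fderiv ℝ U ((s, t), chart x x)).comp (.inr ℝ (ℝ × ℝ) (Model n))) +
        fderiv ℝ (volCoord g x) (chart x x) (U ((s, t), chart x x)) / volCoord g x (chart x x)))
      =ᶠ[𝓝 0] fun _ => 0 := by
    filter_upwards [isOpen_Ioo.mem_nhds h0] with s hs
    exact hf.continuity (hf.contDiffOn_field x)
      (fun p z hz => fieldCoord_t_lagrCoord hf.smoothFamily hf.velocity_time hz)
      (mem_eulerDomain_center hs ht x)
  have d1 : HasDerivAt (fun s => R ((s, t), chart x x)) (fderiv ℝ R w e) 0 := hasDerivAt_s hR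
  have d2 : HasDerivAt (fun s => U ((s, t), chart x x)) (fderiv ℝ U w e) 0 := hasDerivAt_s hU
  have d3 : HasDerivAt (fun s => fderiv ℝ R ((s, t), chart x x))
    (fderiv ℝ (fun w => fderiv ℝ R w e) w) 0 := hasDerivAt_fderiv_s hR
  have d4 : HasDerivAt (fun s => fderiv ℝ U ((s, t), chart x x))
    (fderiv ℝ (fun w => fderiv ℝ U w e) w) 0 := hasDerivAt_fderiv_s hU
  have d5 := d3.clm_apply ((hasDerivAt_const (0 : ℝ) ((0 : ℝ), (1 : ℝ))).prodMk d2)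
  have d6 : HasDerivAt (fun s => tr n ((fderiv ℝ U ((s, t), chart x x)).comp
      (.inr ℝ (ℝ × ℝ) (Model n))))
      (tr n ((fderiv ℝ (fun w => fderiv ℝ U w e) w).comp (.inr ℝ (ℝ × ℝ) (Model n)))) 0 := by
    have := (tr n).hasFDerivAt.comp_hasDerivAt (0 : ℝ)
      (d4.clm_comp (hasDerivAt_const (0 : ℝ) (ContinuousLinearMap.inr ℝ (ℝ × ℝ) (Model n))))
    exact HasDerivAt.congr_deriv this (by simp)
  have d7 : HasDerivAt (fun s => fderiv ℝ (volCoord g x) (chart x x) (U ((s, t), chart x x)))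
      (fderiv ℝ (volCoord g x) (chart x x) (fderiv ℝ U w e)) 0 :=
    (fderiv ℝ (volCoord g x) (chart x x)).hasFDerivAt.comp_hasDerivAt (0 : ℝ) d2
  have key := (d5.add (d1.mul (d6.add (d7.div_const (volCoord g x (chart x x)))))).unique
    ((hasDerivAt_const (0 : ℝ) (0 : ℝ)).congr_of_eventuallyEq hzero)
  have e1 := div_family_eq (p := (0, t)) (f' := fun w => fderiv ℝ R w e) (X' := U)
    (f := funVariation ρ t) (X := u 0 t) g hRe (hU.differentiableAt (by simp))
    (fun y hy => timeFun_funVariation (z := (t, y)) hS (hf.contDiffOn_density x) ⟨ht, hy⟩)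
    (fun _ _ => rfl)
  have e2 := div_family_eq (p := (0, t)) (f' := R) (X' := fun w => fderiv ℝ U w e)
    (f := ρ 0 t) (X := fieldVariation u t) g (hR.differentiableAt (by simp)) hUe (fun _ _ => rfl)
    (fun y hy => timeField_fieldVariation (z := (t, y)) hS (hf.contDiffOn_field x) ⟨ht, hy⟩)
  have d8 := hasDerivAt_time_of_eqOn ht (c := fun τ => funVariation ρ τ x)
    (f := fun w => fderiv ℝ R w e) (s := 0) (y := chart x x) hRe (fun τ hτ =>
      (congrArg (funVariation ρ τ) (extChartAt_to_inv (I := 𝓔) x).symm).trans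
      (timeFun_funVariation (z := (τ, chart x x)) hS (hf.contDiffOn_density x)
        ⟨hτ, chart_mem_target x⟩))
  have hsplit : (((0, 1), U w) : (ℝ × ℝ) × Model n) = ((0, 1), 0) + (0, U w) := by simp
  refine HasDerivAt.congr_deriv d8 ?_
  rw [e1, e2]
  have key' : fderiv ℝ (fun w => fderiv ℝ R w e) w ((0, 1), U w) +
      fderiv ℝ R w (0, fderiv ℝ U w e) +
      (fderiv ℝ R w e * (tr n ((fderiv ℝ U w).comp (.inr ℝ (ℝ × ℝ) (Model n))) +
        fderiv ℝ (volCoord g x) (chart x x) (U w) / volCoord g x (chart x x)) +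
      R w * (tr n ((fderiv ℝ (fun w => fderiv ℝ U w e) w).comp (.inr ℝ (ℝ × ℝ) (Model n))) +
        fderiv ℝ (volCoord g x) (chart x x) (fderiv ℝ U w e) / volCoord g x (chart x x))) = 0 := key
  rw [hsplit, map_add] at key'
  linear_combination key'

end FlowFamily

/-! ### The Euler equation and its linearization -/

section Euler

variable {n : ℕ} {N M : Type*} [TopologicalSpace N] [ChartedSpace (Model n) N]
  [TopologicalSpace M] [ChartedSpace (Model n) M]
  [IsManifold 𝓘(ℝ, Model n) ∞ N] [IsManifold 𝓘(ℝ, Model n) ∞ M]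

local notation "𝓔" => 𝓘(ℝ, Model n)
local notation "chart" => extChartAt 𝓘(ℝ, Model n)

variable {ν : VolumeForm n N} {g : Metric n M} {S T : ℝ} {η : ℝ → ℝ → N → M}
  {F : ℝ → ℝ → N → ℝ} {u j : ℝ → ℝ → ∀ x : M, Tan n x} {ρ k : ℝ → ℝ → M → ℝ} {lam h : ℝ → ℝ}

/-- Each curve of the family is a smooth flow curve. -/
lemma FlowFamily.flowCurve (hf : FlowFamily ν g S T η F u j ρ k) {s : ℝ} (hs : s ∈ Ioo (-S) S) :
    FlowCurve ν g T (η s) (F s) (u s) (ρ s) (k s) where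
  diffeo := hf.diffeo s hs
  contMDiffOn_map := hf.contMDiffOn_map.comp (f := fun z : ℝ × N => ((s, z) : ℝ × ℝ × N))
    (contMDiff_const.prodMk contMDiff_id).contMDiffOn fun _ hz => ⟨hs, hz⟩
  contMDiffOn_fun := hf.contMDiffOn_fun.comp (f := fun z : ℝ × N => ((s, z) : ℝ × ℝ × N))
    (contMDiff_const.prodMk contMDiff_id).contMDiffOn fun _ hz => ⟨hs, hz⟩
  velocity_eq := hf.velocity_time s hs
  density := hf.density s hs
  deriv_eq := hf.deriv_eq s hs
  contDiffOn_field x := contDiffOn_slice (hf.contDiffOn_field x) hs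
  contDiffOn_density x := contDiffOn_slice (hf.contDiffOn_density x) hs
  contDiffOn_deriv x := contDiffOn_slice (contDiffOn_funCoord_deriv hf.smoothFamily hf.density
    hf.surjective hf.contMDiffOn_fun hf.deriv_eq x) hs

/-- The conservation of mass in a chart, for a single curve of the family. -/
lemma FlowFamily.massCoord_continuity (hf : FlowFamily ν g S T η F u j ρ k) {s : ℝ}
    (hs : s ∈ Ioo (-S) S) (x : M) (z : ℝ × Model n) (hz : z ∈ timeDomain n T x) :
    fderiv ℝ (massCoord g x (ρ s)) z (1, timeField x (u s) z) +
      massCoord g x (ρ s) z *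
        tr n ((fderiv ℝ (timeField x (u s)) z).comp (.inr ℝ ℝ (Model n))) = 0 := by
  have hw := mem_eulerDomain_slice hs hz
  have h := continuity_coord hf.smoothFamily hf.density hf.surjective (hf.contDiffOn_field x)
    (fun p z hz => fieldCoord_t_lagrCoord hf.smoothFamily hf.velocity_time hz) hw
  have hU := (contDiffAt_of_eulerDomain (hf.contDiffOn_field x) hw).differentiableAt (by simp)
  have hR := (contDiffAt_of_eulerDomain (hf.contDiffOn_density x) hw).differentiableAt (by simp)
  have hvol : DifferentiableAt ℝ (fun w : (ℝ × ℝ) × Model n => volCoord g x w.2)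
      ((s, z.1), z.2) :=
    DifferentiableAt.comp (g := volCoord g x) (f := Prod.snd) _
      (((contDiffOn_volCoord g x).contDiffAt
        ((isOpen_chart_target x).mem_nhds hw.2)).differentiableAt (by simp)) differentiableAt_snd
  have e1 := fderiv_slice (hR.fun_mul hvol) (1, timeField x (u s) z)
  have e2 := fderiv_slice_inr hU
  refine Eq.trans ?_ h
  rw [← e2]
  exact congrArg (· + _) e1

/-- The enthalpy, a primitive of `p' / r`, is smooth. -/
lemma contDiffOn_enthalpy (hlam : ContDiffOn ℝ ∞ lam (Ioi 0)) (hlam_pos : ∀ r, 0 < r → 0 < lam r)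
    (hh : ∀ r, 0 < r → HasDerivAt h (deriv (pressure lam) r / r) r) :
    ContDiffOn ℝ ∞ h (Ioi 0) := by
  rw [contDiffOn_infty_iff_deriv_of_isOpen isOpen_Ioi]
  refine ⟨fun r hr => (hh r hr).differentiableAt.differentiableWithinAt, ?_⟩
  refine ContDiffOn.congr (f := fun r => deriv (pressure lam) r / r) ?_ fun r hr => (hh r hr).deriv
  exact ((contDiffOn_pressure hlam hlam_pos).deriv_of_isOpen isOpen_Ioi (by simp)).div contDiffOn_id
    fun r hr => ne_of_gt hr

/-- The Euler equation for the family, at the centre of a chart, with the pressure force expressed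
by the enthalpy. -/
lemma FlowFamily.euler [T2Space N] [CompactSpace N] [MeasurableSpace N] [BorelSpace N] [T2Space M]
    (hf : FlowFamily ν g S T η F u j ρ k)
    (hlam : ContDiffOn ℝ ∞ lam (Ioi 0)) (hlam_pos : ∀ r, 0 < r → 0 < lam r)
    (hh : ∀ r, 0 < r → HasDerivAt h (deriv (pressure lam) r / r) r)
    (hgeo : ∀ s ∈ Ioo (-S) S, IsGeodesic ν g lam T (η s) (F s))
    (hk : ∀ s ∈ Ioo (-S) S, ∀ t ∈ Ioo (-T) T, ∀ x, k s t x = ρ s t x / lam (ρ s t x))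
    {s t : ℝ} (hs : s ∈ Ioo (-S) S) (ht : t ∈ Ioo (-T) T) (x : M) :
    fderiv ℝ (fieldCoord x u) ((s, t), chart x x) ((0, 1), fieldCoord x u ((s, t), chart x x)) =
      -christoffel g x (fieldCoord x u ((s, t), chart x x)) (fieldCoord x u ((s, t), chart x x)) -
        raise g x fun l => fderiv ℝ (fun w => h (funCoord n x ρ w)) ((s, t), chart x x)
          (0, stdVec l) := by
  have hw := mem_eulerDomain_center (n := n) hs ht x
  have hE := (hf.flowCurve hs).euler_coord hlam hlam_pos (hgeo s hs) (hf.massCoord_continuity hs)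
    (hk s hs) ht x
  have hU := (contDiffAt_of_eulerDomain (hf.contDiffOn_field x) hw).differentiableAt (by simp)
  have hR := (contDiffAt_of_eulerDomain (hf.contDiffOn_density x) hw).differentiableAt (by simp)
  have hpos := hf.funCoord_pos hw
  have hp : DifferentiableAt ℝ (pressure lam) (funCoord n x ρ ((s, t), chart x x)) :=
    ((contDiffOn_pressure hlam hlam_pos).contDiffAt (Ioi_mem_nhds hpos)).differentiableAt (by simp)
  have hfun : funCoord n x ρ ((s, t), chart x x) = ρ s t x := funCoord_center ρ s t x
  have hfield : fieldCoord x u ((s, t), chart x x) = u s t x := fieldCoord_center u s t x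
  have e1 := fderiv_slice (z := (t, chart x x)) hU (1, fieldCoord x u ((s, t), chart x x))
  -- the chain rule with `h' = p' / r` turns `grad p / ρ` into `grad h`
  have e2 : ∀ l, fderiv ℝ (fun z => pressure lam (timeFun n x (ρ s) z)) (t, chart x x)
      (0, stdVec l) = ρ s t x * fderiv ℝ (fun w => h (funCoord n x ρ w)) ((s, t), chart x x)
        (0, stdVec l) := by
    intro l
    have a1 := fderiv_slice (z := (t, chart x x)) (hp.comp _ hR) (0, stdVec l)
    refine a1.trans ?_
    have a2 := (hp.hasDerivAt.comp_hasFDerivAt _ hR.hasFDerivAt).fderiv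
    have a3 := ((hh _ hpos).comp_hasFDerivAt _ hR.hasFDerivAt).fderiv
    have a3' : fderiv ℝ (fun w => h (funCoord n x ρ w)) ((s, t), chart x x) = _ := a3
    rw [a2, a3', ← hfun]
    simp only [smul_apply, smul_eq_mul]
    field_simp
    rfl
  rw [← e1, hfield]
  refine hE.trans ?_
  congr 1
  rw [← raise_smul]
  congr 1
  ext1 l
  rw [e2 l, inv_mul_cancel_left₀]
  rw [← hfun]
  exact hpos.ne'

/-- The Euler equation of each flow of the family. -/
lemma FlowFamily.hasDerivAt_velocity [T2Space N] [CompactSpace N] [MeasurableSpace N]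
    [BorelSpace N] [T2Space M]
    (hf : FlowFamily ν g S T η F u j ρ k)
    (hlam : ContDiffOn ℝ ∞ lam (Ioi 0)) (hlam_pos : ∀ r, 0 < r → 0 < lam r)
    (hgeo : ∀ s ∈ Ioo (-S) S, IsGeodesic ν g lam T (η s) (F s))
    (hk : ∀ s ∈ Ioo (-S) S, ∀ t ∈ Ioo (-T) T, ∀ x, k s t x = ρ s t x / lam (ρ s t x))
    {s t : ℝ} (hs : s ∈ Ioo (-S) S) (ht : t ∈ Ioo (-T) T) (x : M) :
    HasDerivAt (fun τ => u s τ x) (-nabla g (u s t) x (u s t x) -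
      (ρ s t x)⁻¹ • grad g (fun y => pressure lam (ρ s t y)) x) t := by
  have hw := mem_eulerDomain_center (n := n) hs ht x
  have hE := (hf.flowCurve hs).euler_coord hlam hlam_pos (hgeo s hs) (hf.massCoord_continuity hs)
    (hk s hs) ht x
  have hU := (contDiffAt_of_eulerDomain (hf.contDiffOn_field x) hw).differentiableAt (by simp)
  have hR := (contDiffAt_of_eulerDomain (hf.contDiffOn_density x) hw).differentiableAt (by simp)
  have hp : DifferentiableAt ℝ (pressure lam) (funCoord n x ρ ((s, t), chart x x)) :=
    ((contDiffOn_pressure hlam hlam_pos).contDiffAt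
      (Ioi_mem_nhds (hf.funCoord_pos hw))).differentiableAt (by simp)
  have hP : DifferentiableAt ℝ (fun w => pressure lam (funCoord n x ρ w)) ((s, t), chart x x) :=
    hp.comp _ hR
  have hd : HasDerivAt (F := Model n) (fun τ => u s τ x)
      (fderiv ℝ (fieldCoord x u) ((s, t), chart x x) ((0, 1), 0)) t :=
    hasDerivAt_time_of_eqOn ht hU fun τ _ => (fieldCoord_center u s τ x).symm
  refine HasDerivAt.congr_deriv hd ?_
  set v : Model n := u s t x with hv
  have e1 : fderiv ℝ (timeField x (u s)) (t, chart x x) (1, v) =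
      fderiv ℝ (fieldCoord x u) ((s, t), chart x x) ((0, 1), 0) +
        fderiv ℝ (coordRep x (u s t)) (chart x x) v := by
    have a1 : fderiv ℝ (timeField x (u s)) (t, chart x x) (1, v) =
      fderiv ℝ (fieldCoord x u) ((s, t), chart x x) ((0, 1), v) :=
        fderiv_slice (z := (t, chart x x)) hU (1, v)
    have a2 : fderiv ℝ (coordRep x (u s t)) (chart x x) = _ := (fderiv_param_y hU).fderiv
    rw [a1, a2, ContinuousLinearMap.comp_apply, ContinuousLinearMap.inr_apply, ← map_add]
    simp
  have e2 : (grad g (fun y => pressure lam (ρ s t y)) x : Model n) = raise g x fun l =>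
      fderiv ℝ (fun z => pressure lam (timeFun n x (ρ s) z)) (t, chart x x) (0, stdVec l) := by
    have a2 := fderiv_param_y hP
    refine (grad_eq g a2.differentiableAt).trans (congrArg (raise g x) (funext fun l => ?_))
    have a1 : fderiv ℝ (fun z => pressure lam (timeFun n x (ρ s) z)) (t, chart x x)
      (0, stdVec l) = _ := fderiv_slice (z := (t, chart x x)) hP (0, stdVec l)
    rw [a1]
    exact congrArg (fun L : Model n →L[ℝ] ℝ => L (stdVec l)) a2.fderiv
  set q : Model n := grad g (fun y => pressure lam (ρ s t y)) x with hq
  have h1 : fderiv ℝ (timeField x (u s)) (t, chart x x) (1, v) = -christoffel g x v v -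
      (ρ s t x)⁻¹ • q := by rw [e2]; exact hE
  show _ = -(fderiv ℝ (coordRep x (u s t)) (chart x x) v + christoffel g x v v) - (ρ s t x)⁻¹ • q
  rw [e1] at h1
  rw [eq_sub_of_add_eq h1]
  abel

/-- The Euler equation of the family, differentiated in the parameter `s`. -/
lemma FlowFamily.linearized_euler [T2Space N] [CompactSpace N] [MeasurableSpace N]
    [BorelSpace N] [T2Space M]
    (hf : FlowFamily ν g S T η F u j ρ k)
    (hlam : ContDiffOn ℝ ∞ lam (Ioi 0)) (hlam_pos : ∀ r, 0 < r → 0 < lam r)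
    (hh : ∀ r, 0 < r → HasDerivAt h (deriv (pressure lam) r / r) r)
    (hgeo : ∀ s ∈ Ioo (-S) S, IsGeodesic ν g lam T (η s) (F s))
    (hk : ∀ s ∈ Ioo (-S) S, ∀ t ∈ Ioo (-T) T, ∀ x, k s t x = ρ s t x / lam (ρ s t x))
    (hS : 0 < S) {t : ℝ} (ht : t ∈ Ioo (-T) T) (x : M) :
    HasDerivAt (fun τ => fieldVariation u τ x)
      (-nabla g (fieldVariation u t) x (u 0 t x) - nabla g (u 0 t) x (fieldVariation u t x) -
        grad g (fun y => deriv h (ρ 0 t y) * funVariation ρ t y) x) t := by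
  have h0 : (0 : ℝ) ∈ Ioo (-S) S := ⟨neg_lt_zero.mpr hS, hS⟩
  have hw := mem_eulerDomain_center (n := n) h0 ht x
  set w : (ℝ × ℝ) × Model n := ((0, t), chart x x) with hwdef
  have hR := contDiffAt_of_eulerDomain (hf.contDiffOn_density x) hw
  have hU := contDiffAt_of_eulerDomain (hf.contDiffOn_field x) hw
  have hHon : ContDiffOn ℝ ∞ (fun w => h (funCoord n x ρ w)) (eulerDomain n S T x) :=
    (contDiffOn_enthalpy hlam hlam_pos hh).comp (hf.contDiffOn_density x)
      fun w hw => hf.funCoord_pos hw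
  have hH := contDiffAt_of_eulerDomain hHon hw
  set R := funCoord n x ρ with hRdef
  set U := fieldCoord x u with hUdef
  set H : (ℝ × ℝ) × Model n → ℝ := fun w => h (R w) with hHdef
  set e : (ℝ × ℝ) × Model n := ((1, 0), 0) with he
  have hUe := (contDiffAt_fderiv_apply hU e).differentiableAt (by simp)
  have hHe := (contDiffAt_fderiv_apply hH e).differentiableAt (by simp)
  -- both sides of the Euler equation as functions of the parameter
  have hrel : (fun s => fderiv ℝ U ((s, t), chart x x) ((0, 1), U ((s, t), chart x x)))
      =ᶠ[𝓝 0] fun s => -christoffel g x (U ((s, t), chart x x)) (U ((s, t), chart x x)) -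
        raise g x fun l => fderiv ℝ H ((s, t), chart x x) (0, stdVec l) := by
    filter_upwards [isOpen_Ioo.mem_nhds h0] with s hs
    exact hf.euler hlam hlam_pos hh hgeo hk hs ht x
  have d2 : HasDerivAt (fun s => U ((s, t), chart x x)) (fderiv ℝ U w e) 0 := hasDerivAt_s hU
  have d3 : HasDerivAt (fun s => fderiv ℝ H ((s, t), chart x x))
    (fderiv ℝ (fun w => fderiv ℝ H w e) w) 0 := hasDerivAt_fderiv_s hH
  have d4 : HasDerivAt (fun s => fderiv ℝ U ((s, t), chart x x))
    (fderiv ℝ (fun w => fderiv ℝ U w e) w) 0 := hasDerivAt_fderiv_s hU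
  have d5 := d4.clm_apply ((hasDerivAt_const (0 : ℝ) ((0 : ℝ), (1 : ℝ))).prodMk d2)
  have d6 := hasDerivAt_raise g x (α := fun s l => fderiv ℝ H ((s, t), chart x x) (0, stdVec l))
    (α' := fun l => fderiv ℝ (fun w => fderiv ℝ H w e) w (0, stdVec l)) (s := 0) fun l =>
      (d3.clm_apply (hasDerivAt_const (0 : ℝ) ((0, stdVec l) : (ℝ × ℝ) × Model n))).congr_deriv
        (by simp)
  have key : fderiv ℝ (fun w => fderiv ℝ U w e) w ((0, 1), U w) +
      fderiv ℝ U w (0, fderiv ℝ U w e) =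
      -(christoffel g x (fderiv ℝ U w e) (U w) + christoffel g x (U w) (fderiv ℝ U w e)) -
      raise g x fun l => fderiv ℝ (fun w => fderiv ℝ H w e) w (0, stdVec l) :=
    d5.unique ((((hasDerivAt_christoffel g x d2).neg.sub d6)).congr_of_eventuallyEq hrel)
  have eU : U w = u 0 t x := fieldCoord_center u 0 t x
  have hrep : ∀ τ ∈ Ioo (-T) T, ∀ y ∈ (chart x).target, coordRep x (fieldVariation u τ) y =
      fderiv ℝ U ((0, τ), y) e := fun τ hτ y hy =>
    timeField_fieldVariation (z := (τ, y)) hS (hf.contDiffOn_field x) ⟨hτ, hy⟩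
  have eV : ∀ τ ∈ Ioo (-T) T, (fieldVariation u τ x : Model n) =
      fderiv ℝ U ((0, τ), chart x x) e := fun τ hτ =>
    (coordRep_self x (fieldVariation u τ)).symm.trans (hrep τ hτ _ (chart_mem_target x))
  have d8 : HasDerivAt (F := Model n) (fun τ => fieldVariation u τ x)
      (fderiv ℝ (fun w => fderiv ℝ U w e) w ((0, 1), 0)) t :=
    hasDerivAt_time_of_eqOn ht hUe eV
  have hnear := (isOpen_chart_target x).mem_nhds (chart_mem_target (n := n) x)
  have c1 : fderiv ℝ (coordRep x (u 0 t)) (chart x x) =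
      (fderiv ℝ U w).comp (.inr ℝ (ℝ × ℝ) (Model n)) :=
    (fderiv_param_y (z := w) (hU.differentiableAt (by simp))).fderiv
  have c2 : fderiv ℝ (coordRep x (fieldVariation u t)) (chart x x) =
      (fderiv ℝ (fun w => fderiv ℝ U w e) w).comp (.inr ℝ (ℝ × ℝ) (Model n)) := by
    refine ((fderiv_param_y (z := w) hUe).congr_of_eventuallyEq ?_).fderiv
    filter_upwards [hnear] with y hy using hrep t ht y hy
  have c3 : (grad g (fun y => deriv h (ρ 0 t y) * funVariation ρ t y) x : Model n) =
      raise g x fun l => fderiv ℝ (fun w => fderiv ℝ H w e) w (0, stdVec l) := by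
    have a1 : HasFDerivAt (fun y => deriv h (ρ 0 t ((chart x).symm y)) *
        funVariation ρ t ((chart x).symm y))
        ((fderiv ℝ (fun w => fderiv ℝ H w e) w).comp (.inr ℝ (ℝ × ℝ) (Model n))) (chart x x) := by
      refine (fderiv_param_y (z := w) hHe).congr_of_eventuallyEq ?_
      filter_upwards [hnear] with y hy
      have hy' := mem_eulerDomain_slice h0 (show ((t, y) : ℝ × Model n) ∈ timeDomain n T x from
        ⟨ht, hy⟩)
      have b1 : funVariation ρ t ((chart x).symm y) = fderiv ℝ R ((0, t), y) e :=
        timeFun_funVariation (z := (t, y)) hS (hf.contDiffOn_density x) ⟨ht, hy⟩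
      have b2 : HasDerivAt h (deriv h (R ((0, t), y))) (R ((0, t), y)) :=
        (hh _ (hf.funCoord_pos hy')).differentiableAt.hasDerivAt
      have b3 : fderiv ℝ H ((0, t), y) = _ := (b2.comp_hasFDerivAt _
        ((contDiffAt_of_eulerDomain (hf.contDiffOn_density x) hy').differentiableAt
          (by simp)).hasFDerivAt).fderiv
      rw [b1]
      show _ = fderiv ℝ H ((0, t), y) e
      rw [b3]
      rfl
    refine (grad_eq g a1.differentiableAt).trans (congrArg (raise g x) (funext fun l => ?_))
    exact congrArg (fun L : Model n →L[ℝ] ℝ => L (stdVec l)) a1.fderiv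
  refine HasDerivAt.congr_deriv d8 ?_
  set a : Model n := u 0 t x with ha
  set b : Model n := fieldVariation u t x with hb
  have eb : b = fderiv ℝ U w e := eV t ht
  set q : Model n := grad g (fun y => deriv h (ρ 0 t y) * funVariation ρ t y) x with hq
  show _ = -(fderiv ℝ (coordRep x (fieldVariation u t)) (chart x x) a + christoffel g x a b) -
    (fderiv ℝ (coordRep x (u 0 t)) (chart x x) b + christoffel g x b a) - q
  rw [c1, c2, c3]
  have hsplit : (((0, 1), a) : (ℝ × ℝ) × Model n) = ((0, 1), 0) + (0, a) := by simp
  rw [← eb, eU, hsplit, map_add] at key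
  simp only [ContinuousLinearMap.comp_apply, ContinuousLinearMap.inr_apply]
  rw [add_assoc] at key
  rw [eq_sub_of_add_eq key]
  abel

end Euler

/-! ### The linearized Lagrangian equations -/

section Lagrangian

variable {n : ℕ} {N M : Type*} [TopologicalSpace N] [ChartedSpace (Model n) N]
  [TopologicalSpace M] [ChartedSpace (Model n) M]
  [IsManifold 𝓘(ℝ, Model n) ∞ N] [IsManifold 𝓘(ℝ, Model n) ∞ M]

local notation "𝓔" => 𝓘(ℝ, Model n)
local notation "chart" => extChartAt 𝓘(ℝ, Model n)

variable {ν : VolumeForm n N} {g : Metric n M} {S T : ℝ} {η : ℝ → ℝ → N → M}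
  {F : ℝ → ℝ → N → ℝ} {u j : ℝ → ℝ → ∀ x : M, Tan n x} {ρ k : ℝ → ℝ → M → ℝ} {lam h : ℝ → ℝ}

/-- The continuity equation of each flow of the family. -/
lemma FlowFamily.hasDerivAt_density (hf : FlowFamily ν g S T η F u j ρ k) {s t : ℝ}
    (hs : s ∈ Ioo (-S) S) (ht : t ∈ Ioo (-T) T) (x : M) :
    HasDerivAt (fun τ => ρ s τ x) (-div g (fun y => ρ s t y • u s t y) x) t := by
  rw [← hf.continuity_div (e := (0, 1)) (hf.contDiffOn_field x)
    (fun p z hz => fieldCoord_t_lagrCoord hf.smoothFamily hf.velocity_time hz) hs ht]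
  exact hasDerivAt_time_of_eqOn ht ((contDiffAt_of_eulerDomain (hf.contDiffOn_density x)
    (mem_eulerDomain_center hs ht x)).differentiableAt (by simp))
    fun τ _ => (funCoord_center ρ s τ x).symm

/-- The equation `σ = -div (ρ j)` is the continuity equation in the direction of the parameter `s`,
in which the family moves with the velocity `j`. -/
lemma FlowFamily.funVariation_density (hf : FlowFamily ν g S T η F u j ρ k) (hS : 0 < S) {t : ℝ}
    (ht : t ∈ Ioo (-T) T) (x : M) :
    funVariation ρ t x = -div g (fun y => ρ 0 t y • j 0 t y) x := by
  rw [← hf.continuity_div (e := (1, 0)) (hf.contDiffOn_variation x)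
    (fun p z hz => fieldCoord_s_lagrCoord hf.smoothFamily hf.velocity_param hz)
    ⟨neg_lt_zero.mpr hS, hS⟩ ht]
  exact (congrArg (funVariation ρ t) (extChartAt_to_inv (I := 𝓔) x).symm).trans
    (timeFun_funVariation (z := (t, chart x x)) hS (hf.contDiffOn_density x)
      ⟨ht, chart_mem_target x⟩)

/-- The equation `∂ₜ j + [u, j] = v`: both `∂ₛ` and `∂ₜ` of the particle positions are transported
by the family, and they commute. -/
lemma FlowFamily.hasDerivAt_variation (hf : FlowFamily ν g S T η F u j ρ k) (hS : 0 < S) {t : ℝ}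
    (ht : t ∈ Ioo (-T) T) (x : M) :
    HasDerivAt (fun τ => j 0 τ x)
      (fieldVariation u t x - VectorField.mlieBracket 𝓘(ℝ, Model n) (u 0 t) (j 0 t) x) t := by
  have h0 : (0 : ℝ) ∈ Ioo (-S) S := ⟨neg_lt_zero.mpr hS, hS⟩
  have hw := mem_eulerDomain_center (n := n) h0 ht x
  have hU := (contDiffAt_of_eulerDomain (hf.contDiffOn_field x) hw).differentiableAt (by simp)
  have hJ := (contDiffAt_of_eulerDomain (hf.contDiffOn_variation x) hw).differentiableAt (by simp)
  have hc := velocity_compat_coord (e := (0, 1)) (e' := (1, 0)) hf.smoothFamily hf.density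
    hf.surjective (hf.contDiffOn_field x) (hf.contDiffOn_variation x)
    (fun p z hz => fieldCoord_t_lagrCoord hf.smoothFamily hf.velocity_time hz)
    (fun p z hz => fieldCoord_s_lagrCoord hf.smoothFamily hf.velocity_param hz) hw
  have hd : HasDerivAt (F := Model n) (fun τ => j 0 τ x)
      (fderiv ℝ (fieldCoord x j) ((0, t), chart x x) ((0, 1), 0)) t :=
    hasDerivAt_time_of_eqOn ht hJ fun τ _ => (fieldCoord_center j 0 τ x).symm
  refine HasDerivAt.congr_deriv hd ?_
  have hb := mlieBracket_eq (u 0 t) (j 0 t) x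
  have eV : (fieldVariation u t x : Model n) =
      fderiv ℝ (fieldCoord x u) ((0, t), chart x x) ((1, 0), 0) :=
    (coordRep_self x (fieldVariation u t)).symm.trans (timeField_fieldVariation
      (z := (t, chart x x)) hS (hf.contDiffOn_field x) ⟨ht, chart_mem_target x⟩)
  set a : Model n := u 0 t x with ha
  set b : Model n := j 0 t x with hb'
  set v : Model n := fieldVariation u t x with hv
  set B : Model n := VectorField.mlieBracket 𝓘(ℝ, Model n) (u 0 t) (j 0 t) x with hB
  have c1 : fderiv ℝ (coordRep x (u 0 t)) (chart x x) =
      (fderiv ℝ (fieldCoord x u) ((0, t), chart x x)).comp (.inr ℝ (ℝ × ℝ) (Model n)) :=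
    (fderiv_param_y hU).fderiv
  have c2 : fderiv ℝ (coordRep x (j 0 t)) (chart x x) =
      (fderiv ℝ (fieldCoord x j) ((0, t), chart x x)).comp (.inr ℝ (ℝ × ℝ) (Model n)) :=
    (fderiv_param_y hJ).fderiv
  have ea : fieldCoord x u ((0, t), chart x x) = a := fieldCoord_center u 0 t x
  have eb : fieldCoord x j ((0, t), chart x x) = b := fieldCoord_center j 0 t x
  have s1 : ∀ (e : ℝ × ℝ) (c : Model n), ((e, c) : (ℝ × ℝ) × Model n) = (e, 0) + (0, c) := by simp
  rw [ea, eb, s1 (0, 1), s1 (1, 0), map_add, map_add, ← eV] at hc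
  show _ = v - B
  rw [hb, c1, c2]
  simp only [ContinuousLinearMap.comp_apply, ContinuousLinearMap.inr_apply]
  rw [eq_sub_of_add_eq hc]
  abel

lemma FlowFamily.smoothFun_density (hf : FlowFamily ν g S T η F u j ρ k) (hS : 0 < S) :
    SmoothFun n T (ρ 0) :=
  smoothFun_of_coord fun x => contDiffOn_slice (hf.contDiffOn_density x) ⟨neg_lt_zero.mpr hS, hS⟩

lemma FlowFamily.smoothField_velocity (hf : FlowFamily ν g S T η F u j ρ k) (hS : 0 < S) :
    SmoothField T (u 0) :=
  smoothField_of_coord fun x => contDiffOn_slice (hf.contDiffOn_field x) ⟨neg_lt_zero.mpr hS, hS⟩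

lemma FlowFamily.smoothField_variation (hf : FlowFamily ν g S T η F u j ρ k) (hS : 0 < S) :
    SmoothField T (j 0) :=
  smoothField_of_coord fun x =>
    contDiffOn_slice (hf.contDiffOn_variation x) ⟨neg_lt_zero.mpr hS, hS⟩

lemma FlowFamily.smoothFun_funVariation (hf : FlowFamily ν g S T η F u j ρ k) (hS : 0 < S) :
    SmoothFun n T (funVariation ρ) :=
  smoothFun_of_coord fun x => (contDiffOn_fderiv_slice (isOpen_eulerDomain S T x)
    (hf.contDiffOn_density x) (fun _ hz => mem_eulerDomain_slice ⟨neg_lt_zero.mpr hS, hS⟩ hz)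
    ((1, 0), 0)).congr fun _ hz => timeFun_funVariation hS (hf.contDiffOn_density x) hz

lemma FlowFamily.smoothField_fieldVariation (hf : FlowFamily ν g S T η F u j ρ k) (hS : 0 < S) :
    SmoothField T (fieldVariation u) :=
  smoothField_of_coord fun x => (contDiffOn_fderiv_slice (isOpen_eulerDomain S T x)
    (hf.contDiffOn_field x) (fun _ hz => mem_eulerDomain_slice ⟨neg_lt_zero.mpr hS, hS⟩ hz)
    ((1, 0), 0)).congr fun _ hz => timeField_fieldVariation hS (hf.contDiffOn_field x) hz

/-- Along each geodesic of the family the velocity stays in the barotropic distribution. -/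
lemma FlowFamily.barotropic [T2Space N] [CompactSpace N] [MeasurableSpace N] [BorelSpace N]
    [T2Space M] (hf : FlowFamily ν g S T η F u j ρ k) (hT : 0 < T)
    (hlam : ContDiffOn ℝ ∞ lam (Ioi 0)) (hlam_pos : ∀ r, 0 < r → 0 < lam r)
    (hgeo : ∀ s ∈ Ioo (-S) S, IsGeodesic ν g lam T (η s) (F s))
    (hbar : ∀ s ∈ Ioo (-S) S, ∀ p,
      deriv (fun τ => F s τ p) 0 = ρ s 0 (η s 0 p) / lam (ρ s 0 (η s 0 p))) :
    ∀ s ∈ Ioo (-S) S, ∀ t ∈ Ioo (-T) T, ∀ x, k s t x = ρ s t x / lam (ρ s t x) :=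
  fun s hs _ ht x => (hf.flowCurve hs).barotropic hT hlam hlam_pos (hgeo s hs)
    (hf.massCoord_continuity hs)
    (fun p => (hf.deriv_eq s hs 0 ⟨neg_lt_zero.mpr hT, hT⟩ p).symm.trans (hbar s hs p)) ht x

lemma hasDerivAt_div_lam (hlam : ContDiffOn ℝ ∞ lam (Ioi 0)) (hlam_pos : ∀ r, 0 < r → 0 < lam r)
    {r : ℝ} (hr : 0 < r) :
    HasDerivAt (fun r => r / lam r) (2 * phi lam r / lam r ^ 2) r := by
  have h1 : DifferentiableAt ℝ lam r :=
    (hlam.contDiffAt (Ioi_mem_nhds hr)).differentiableAt (by simp)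
  refine ((hasDerivAt_id' r).fun_div h1.hasDerivAt (hlam_pos r hr).ne').congr_deriv ?_
  rw [phi]
  ring

/-- The Eulerian form `g` of the time derivative of the function component of the Jacobi field:
the derivative of `r / λ(r)` at the density, for the perturbation `σ` of the density and the
displacement field `j`. -/
noncomputable def funPerturbation (lam : ℝ → ℝ) (ρ : ℝ → M → ℝ) (σ : ℝ → M → ℝ)
    (j : ℝ → ∀ x : M, Tan n x) (t : ℝ) (x : M) : ℝ :=
  2 * phi lam (ρ t x) * σ t x / lam (ρ t x) ^ 2 +
    dirDeriv (fun y => ρ t y / lam (ρ t y)) x (j t x)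

lemma FlowFamily.contDiffOn_quotient (hf : FlowFamily ν g S T η F u j ρ k)
    (hlam : ContDiffOn ℝ ∞ lam (Ioi 0)) (hlam_pos : ∀ r, 0 < r → 0 < lam r) (x : M) :
    ContDiffOn ℝ ∞ (fun w => funCoord n x ρ w / lam (funCoord n x ρ w)) (eulerDomain n S T x) :=
  ContDiffOn.comp (g := fun r => r / lam r) (t := Ioi 0)
    (contDiffOn_id.div hlam fun r hr => (hlam_pos r hr).ne') (hf.contDiffOn_density x)
    fun _ hw => hf.funCoord_pos hw

/-- The function `funPerturbation` is the derivative of `ρ / λ(ρ)` along the particle paths in the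
direction of `s`, that is, along the vector field `∂ₛ + j`. -/
lemma FlowFamily.timeFun_funPerturbation (hf : FlowFamily ν g S T η F u j ρ k) (hS : 0 < S)
    (hlam : ContDiffOn ℝ ∞ lam (Ioi 0)) (hlam_pos : ∀ r, 0 < r → 0 < lam r) {x : M}
    {z : ℝ × Model n} (hz : z ∈ timeDomain n T x) :
    timeFun n x (funPerturbation lam (ρ 0) (funVariation ρ) (j 0)) z =
      fderiv ℝ (fun w => funCoord n x ρ w / lam (funCoord n x ρ w)) ((0, z.1), z.2)
        ((1, 0), fieldCoord x j ((0, z.1), z.2)) := by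
  have h0 : (0 : ℝ) ∈ Ioo (-S) S := ⟨neg_lt_zero.mpr hS, hS⟩
  have hw := mem_eulerDomain_slice h0 hz
  have hQ := (contDiffAt_of_eulerDomain (hf.contDiffOn_quotient hlam hlam_pos x)
    hw).differentiableAt (by simp)
  have hR := (contDiffAt_of_eulerDomain (hf.contDiffOn_density x) hw).differentiableAt (by simp)
  set Q : (ℝ × ℝ) × Model n → ℝ := fun w => funCoord n x ρ w / lam (funCoord n x ρ w) with hQdef
  have hsplit : (((1, 0), fieldCoord x j ((0, z.1), z.2)) : (ℝ × ℝ) × Model n) =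
      ((1, 0), 0) + (0, fieldCoord x j ((0, z.1), z.2)) := by simp
  have a1 : fderiv ℝ Q ((0, z.1), z.2) = _ := ((hasDerivAt_div_lam hlam hlam_pos
    (hf.funCoord_pos hw)).comp_hasFDerivAt _ hR.hasFDerivAt).fderiv
  have a2 := timeFun_funVariation hS (hf.contDiffOn_density x) hz
  set x' := (chart x).symm z.2 with hx'
  have hs : x' ∈ (chart x).source := (chart x).map_target hz.2
  have hr : chart x x' = z.2 := (chart x).right_inv hz.2
  have a3 := fderiv_param_y hQ
  have a4 := mfderiv_eq_fderiv_of_mem_source (f := fun y => ρ 0 z.1 y / lam (ρ 0 z.1 y)) hs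
    (by rw [hr]; exact a3.differentiableAt) (j 0 z.1 x')
  rw [hr] at a4
  rw [hsplit, map_add]
  have b1 : fderiv ℝ Q ((0, z.1), z.2) ((1, 0), 0) =
      2 * phi lam (ρ 0 z.1 x') * funVariation ρ z.1 x' / lam (ρ 0 z.1 x') ^ 2 := by
    have a5 : funVariation ρ z.1 x' =
      fderiv ℝ (funCoord n x ρ) ((0, z.1), z.2) ((1, 0), 0) := a2
    rw [a1, a5]
    simp only [smul_apply, smul_eq_mul]
    show 2 * phi lam (ρ 0 z.1 x') / lam (ρ 0 z.1 x') ^ 2 * _ = _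
    ring
  rw [b1]
  refine congrArg (2 * phi lam (ρ 0 z.1 x') * funVariation ρ z.1 x' / lam (ρ 0 z.1 x') ^ 2 + ·) ?_
  refine a4.trans ?_
  exact congrArg (fun L : Model n →L[ℝ] ℝ => L (fieldCoord x j ((0, z.1), z.2))) a3.fderiv

lemma FlowFamily.smoothFun_funPerturbation (hf : FlowFamily ν g S T η F u j ρ k) (hS : 0 < S)
    (hlam : ContDiffOn ℝ ∞ lam (Ioi 0)) (hlam_pos : ∀ r, 0 < r → 0 < lam r) :
    SmoothFun n T (funPerturbation lam (ρ 0) (funVariation ρ) (j 0)) := by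
  refine smoothFun_of_coord fun x => ?_
  have h0 : (0 : ℝ) ∈ Ioo (-S) S := ⟨neg_lt_zero.mpr hS, hS⟩
  have h1 : ContDiffOn ℝ ∞ (fun w => fderiv ℝ (fun w => funCoord n x ρ w / lam (funCoord n x ρ w)) w
      ((1, 0), fieldCoord x j w)) (eulerDomain n S T x) := fun w hw =>
    (ContDiffAt.clm_apply ((contDiffAt_of_eulerDomain
      (hf.contDiffOn_quotient hlam hlam_pos x) hw).fderiv_right (by simp))
      (contDiffAt_const.prodMk
        (contDiffAt_of_eulerDomain (hf.contDiffOn_variation x) hw))).contDiffWithinAt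
  exact (contDiffOn_slice h1 h0).congr fun z hz =>
    hf.timeFun_funPerturbation hS hlam hlam_pos hz

lemma hasDerivAt_param_fun (hS : 0 < S)
    (hF : ContMDiffOn (𝓘(ℝ, ℝ).prod (𝓘(ℝ, ℝ).prod 𝓘(ℝ, Model n))) 𝓘(ℝ, ℝ) ∞
      (fun z : ℝ × ℝ × N => F z.1 z.2.1 z.2.2) (Ioo (-S) S ×ˢ Ioo (-T) T ×ˢ univ)) {p : N}
    {z : ℝ × Model n} (hz : z ∈ timeDomain n T p) :
    HasDerivAt (fun s => F s z.1 ((chart p).symm z.2))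
      (fderiv ℝ (fun w : (ℝ × ℝ) × Model n => F w.1.1 w.1.2 ((chart p).symm w.2)) ((0, z.1), z.2)
        ((1, 0), 0)) 0 :=
  hasDerivAt_s (z := ((0, z.1), z.2))
    (contDiffAt_param_comp hF ⟨neg_lt_zero.mpr hS, hS⟩ hz.1 hz.2)

lemma smoothFun_funVariation_param (hS : 0 < S)
    (hF : ContMDiffOn (𝓘(ℝ, ℝ).prod (𝓘(ℝ, ℝ).prod 𝓘(ℝ, Model n))) 𝓘(ℝ, ℝ) ∞
      (fun z : ℝ × ℝ × N => F z.1 z.2.1 z.2.2) (Ioo (-S) S ×ˢ Ioo (-T) T ×ˢ univ)) :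
    SmoothFun n T (funVariation F) := by
  refine smoothFun_of_coord fun p => ?_
  have h1 : ContDiffOn ℝ ∞ (fun w : (ℝ × ℝ) × Model n => F w.1.1 w.1.2 ((chart p).symm w.2))
      (eulerDomain n S T p) := fun w hw =>
    (contDiffAt_param_comp hF hw.1.1 hw.1.2 hw.2).contDiffWithinAt
  exact (contDiffOn_fderiv_slice (isOpen_eulerDomain S T p) h1
    (fun _ hz => mem_eulerDomain_slice ⟨neg_lt_zero.mpr hS, hS⟩ hz) ((1, 0), 0)).congr
    fun z hz => (hasDerivAt_param_fun hS hF hz).deriv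

/-- The time derivative of the function component of the Jacobi field: the mixed derivatives of the
function component commute, and its time derivative is `r / λ(r)` at the density. -/
lemma FlowFamily.hasDerivAt_funVariation_time (hf : FlowFamily ν g S T η F u j ρ k) (hS : 0 < S)
    (hlam : ContDiffOn ℝ ∞ lam (Ioi 0)) (hlam_pos : ∀ r, 0 < r → 0 < lam r)
    (hk : ∀ s ∈ Ioo (-S) S, ∀ t ∈ Ioo (-T) T, ∀ x, k s t x = ρ s t x / lam (ρ s t x))
    {t : ℝ} (ht : t ∈ Ioo (-T) T) (p : N) :
    HasDerivAt (fun τ => funVariation F τ p)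
      (funPerturbation lam (ρ 0) (funVariation ρ) (j 0) t (η 0 t p)) t := by
  have h0 : (0 : ℝ) ∈ Ioo (-S) S := ⟨neg_lt_zero.mpr hS, hS⟩
  set x := η 0 t p with hx
  set z₀ : (ℝ × ℝ) × Model n := ((0, t), chart p p) with hz₀
  have hz : z₀ ∈ lagrDomain S T η p x := by
    refine ⟨⟨h0, ht⟩, chart_mem_target p, ?_⟩
    show η 0 t ((chart p).symm (chart p p)) ∈ _
    rw [extChartAt_to_inv]
    exact mem_extChartAt_source x
  have hl : lagrCoord η p x z₀ = chart x x := by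
    show chart x (η 0 t ((chart p).symm (chart p p))) = _
    rw [extChartAt_to_inv]
  set A : (ℝ × ℝ) × Model n → ℝ := fun w => F w.1.1 w.1.2 ((chart p).symm w.2) with hA
  set Q : (ℝ × ℝ) × Model n → ℝ := fun w => funCoord n x ρ w / lam (funCoord n x ρ w) with hQ
  have hAz : ContDiffAt ℝ ∞ A z₀ := contDiffAt_param_comp hf.contMDiffOn_fun h0 ht hz.2.1
  have hw : ((0, t), chart x x) ∈ eulerDomain n S T x := mem_eulerDomain_center h0 ht x
  have hQd : DifferentiableAt ℝ Q (z₀.1, lagrCoord η p x z₀) := by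
    rw [hl]
    exact (contDiffAt_of_eulerDomain (hf.contDiffOn_quotient hlam hlam_pos x)
      hw).differentiableAt (by simp)
  -- the barotropic velocity, as a function of the particle
  have e1 : (fun w => fderiv ℝ A w ((0, 1), 0)) =ᶠ[𝓝 z₀] fun w => Q (w.1, lagrCoord η p x w) := by
    filter_upwards [lagrDomain_mem_nhds hf.smoothFamily hz] with w hw
    have b1 := (fderiv_param_t ((contDiffAt_param_comp hf.contMDiffOn_fun hw.1.1 hw.1.2
      hw.2.1).differentiableAt (by simp))).deriv
    have b2 := hf.deriv_eq _ hw.1.1 _ hw.1.2 ((chart p).symm w.2)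
    rw [hk _ hw.1.1 _ hw.1.2] at b2
    refine b1.symm.trans (b2.trans ?_)
    rw [hQ]
    simp only [funCoord_lagrCoord hw]
  have hdc := (contDiffAt_lagrCoord hf.smoothFamily hz).differentiableAt (by simp)
  have e2 : fderiv ℝ (fun w => fderiv ℝ A w ((1, 0), 0)) z₀ ((0, 1), 0) =
      funPerturbation lam (ρ 0) (funVariation ρ) (j 0) t x := by
    rw [fderiv_fderiv_apply_comm hAz, e1.fderiv_eq, fderiv_comp_family hdc hQd,
      ← fieldCoord_s_lagrCoord hf.smoothFamily hf.velocity_param hz, hl]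
    refine (hf.timeFun_funPerturbation (z := (t, chart x x)) hS hlam hlam_pos
      ⟨ht, chart_mem_target x⟩).symm.trans ?_
    exact congrArg (funPerturbation lam (ρ 0) (funVariation ρ) (j 0) t)
      (extChartAt_to_inv (I := 𝓔) x)
  rw [← e2]
  refine hasDerivAt_time_of_eqOn ht
    ((contDiffAt_fderiv_apply hAz ((1, 0), 0)).differentiableAt (by simp)) fun τ hτ => ?_
  have b3 := (hasDerivAt_param_fun (z := (τ, chart p p)) hS hf.contMDiffOn_fun
    ⟨hτ, chart_mem_target p⟩).deriv
  rw [← b3]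
  show deriv (fun s => F s τ p) 0 = deriv (fun s => F s τ ((chart p).symm (chart p p))) 0
  rw [extChartAt_to_inv]

lemma hasDerivAt_funVariation_param (hS : 0 < S)
    (hF : ContMDiffOn (𝓘(ℝ, ℝ).prod (𝓘(ℝ, ℝ).prod 𝓘(ℝ, Model n))) 𝓘(ℝ, ℝ) ∞
      (fun z : ℝ × ℝ × N => F z.1 z.2.1 z.2.2) (Ioo (-S) S ×ˢ Ioo (-T) T ×ˢ univ)) {t : ℝ}
    (ht : t ∈ Ioo (-T) T) (p : N) : HasDerivAt (fun s => F s t p) (funVariation F t p) 0 := by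
  have h := hasDerivAt_param_fun (z := (t, chart p p)) hS hF ⟨ht, chart_mem_target p⟩
  simp only [extChartAt_to_inv] at h
  exact h.differentiableAt.hasDerivAt

end Lagrangian

end BarotropicFlow

open BarotropicFlow
theorem mainTheorem9 {n : ℕ} {N M : Type*}
    [TopologicalSpace N] [ChartedSpace (Model n) N] [IsManifold 𝓘(ℝ, Model n) ∞ N]
    [T2Space N] [CompactSpace N] [MeasurableSpace N] [BorelSpace N]
    [TopologicalSpace M] [ChartedSpace (Model n) M] [IsManifold 𝓘(ℝ, Model n) ∞ M]
    [T2Space M] [CompactSpace M]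
    (ν : VolumeForm n N) (m : Metric n M)
    (lam : ℝ → ℝ) (hlam : ContDiffOn ℝ ∞ lam (Ioi 0)) (hlam_pos : ∀ r, 0 < r → 0 < lam r)
    (h : ℝ → ℝ) (hh : ∀ r, 0 < r → HasDerivAt h (deriv (pressure lam) r / r) r)
    (S T : ℝ) (hS : 0 < S) (hT : 0 < T)
    -- a smooth family of curves `(η s, F s)` of configurations, with parameter `s`
    (η : ℝ → ℝ → N → M) (F : ℝ → ℝ → N → ℝ)
    (hη : ContMDiffOn (𝓘(ℝ, ℝ).prod (𝓘(ℝ, ℝ).prod 𝓘(ℝ, Model n))) 𝓘(ℝ, Model n) ∞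
      (fun z : ℝ × ℝ × N => η z.1 z.2.1 z.2.2) (Ioo (-S) S ×ˢ Ioo (-T) T ×ˢ univ))
    (hF : ContMDiffOn (𝓘(ℝ, ℝ).prod (𝓘(ℝ, ℝ).prod 𝓘(ℝ, Model n))) 𝓘(ℝ, ℝ) ∞
      (fun z : ℝ × ℝ × N => F z.1 z.2.1 z.2.2) (Ioo (-S) S ×ˢ Ioo (-T) T ×ˢ univ))
    (hdiff : ∀ s ∈ Ioo (-S) S, ∀ t ∈ Ioo (-T) T,
      ∃ Φ : Diffeomorph 𝓘(ℝ, Model n) 𝓘(ℝ, Model n) N M ∞, ⇑Φ = η s t)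
    -- every curve of the family is a geodesic
    (hgeo : ∀ s ∈ Ioo (-S) S, IsGeodesic ν m lam T (η s) (F s))
    -- the velocity field and the density of the fluid
    (u : ℝ → ℝ → ∀ x : M, Tan n x) (ρ : ℝ → ℝ → M → ℝ)
    (hu : ∀ s ∈ Ioo (-S) S, ∀ t ∈ Ioo (-T) T, ∀ p,
      velocity (fun τ => η s τ p) t = u s t (η s t p))
    (hρ : ∀ s ∈ Ioo (-S) S, ∀ t ∈ Ioo (-T) T, IsDensity ν m (η s t) (ρ s t))
    -- the initial velocities lie in the barotropic distribution
    (hbar : ∀ s ∈ Ioo (-S) S, ∀ p,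
      deriv (fun τ => F s τ p) 0 = ρ s 0 (η s 0 p) / lam (ρ s 0 (η s 0 p))) :
    -- the base flow is smooth and solves the barotropic equations
    (SmoothFun n T (ρ 0) ∧ SmoothField T (u 0) ∧
      ∀ t ∈ Ioo (-T) T, ∀ x : M,
        0 < ρ 0 t x ∧
        HasDerivAt (fun τ => ρ 0 τ x) (-div m (fun y => ρ 0 t y • u 0 t y) x) t ∧
        HasDerivAt (fun τ => u 0 τ x)
          (-nabla m (u 0 t) x (u 0 t x)
            - (ρ 0 t x)⁻¹ • grad m (fun y => pressure lam (ρ 0 t y)) x) t) ∧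
    ∃ (j : ℝ → ∀ x : M, Tan n x) (G : ℝ → N → ℝ) (g σ : ℝ → M → ℝ) (v : ℝ → ∀ x : M, Tan n x),
      SmoothField T j ∧ SmoothFun n T G ∧ SmoothFun n T g ∧ SmoothFun n T σ ∧ SmoothField T v ∧
      -- the Jacobi field is `J = (j ∘ η, G)`
      (∀ t ∈ Ioo (-T) T, ∀ p : N,
        velocity (fun s => η s t p) 0 = j t (η 0 t p) ∧
        HasDerivAt (fun s => F s t p) (G t p) 0 ∧
        HasDerivAt (fun τ => G τ p) (g t (η 0 t p)) t) ∧
      (∀ t ∈ Ioo (-T) T, ∀ x : M,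
        -- `σ` and `v` are the linear perturbations of density and velocity
        HasDerivAt (fun s => ρ s t x) (σ t x) 0 ∧
        HasDerivAt (fun s => u s t x) (v t x) 0 ∧
        -- the linearized Lagrangian equations
        σ t x = -div m (fun y => ρ 0 t y • j t y) x ∧
        g t x = 2 * phi lam (ρ 0 t x) * σ t x / lam (ρ 0 t x) ^ 2
          + dirDeriv (fun y => ρ 0 t y / lam (ρ 0 t y)) x (j t x) ∧
        HasDerivAt (fun τ => j τ x)
          (v t x - VectorField.mlieBracket 𝓘(ℝ, Model n) (u 0 t) (j t) x) t ∧
        -- the linearized continuity equation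
        HasDerivAt (fun τ => σ τ x)
          (-div m (fun y => σ t y • u 0 t y) x - div m (fun y => ρ 0 t y • v t y) x) t ∧
        -- the linearized Euler equation
        HasDerivAt (fun τ => v τ x)
          (-nabla m (v t) x (u 0 t x) - nabla m (u 0 t) x (v t x)
            - grad m (fun y => deriv h (ρ 0 t y) * σ t y) x) t) := by
  obtain ⟨j, hj⟩ := exists_eulerian (E := Model n) hdiff
    fun s t p => (velocity (fun σ => η σ t p) s : Model n)
  obtain ⟨k, hk⟩ := exists_eulerian hdiff fun s t p => deriv (fun τ => F s τ p) t
  have hf : FlowFamily ν m S T η F u (fun s t x => j s t x) ρ k :=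
    ⟨hdiff, hη, hF, hu, hj, hρ, hk⟩
  have h0 : (0 : ℝ) ∈ Ioo (-S) S := ⟨neg_lt_zero.mpr hS, hS⟩
  have hk' := hf.barotropic hT hlam hlam_pos hgeo hbar
  refine ⟨⟨hf.smoothFun_density hS, hf.smoothField_velocity hS, fun t ht x =>
    ⟨hf.density_pos h0 ht x, hf.hasDerivAt_density h0 ht x,
      hf.hasDerivAt_velocity hlam hlam_pos hgeo hk' h0 ht x⟩⟩,
    fun t x => j 0 t x, funVariation F, funPerturbation lam (ρ 0) (funVariation ρ) (j 0),
    funVariation ρ, fieldVariation u, hf.smoothField_variation hS,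
    smoothFun_funVariation_param hS hF, hf.smoothFun_funPerturbation hS hlam hlam_pos,
    hf.smoothFun_funVariation hS, hf.smoothField_fieldVariation hS, fun t ht p =>
    ⟨hj 0 h0 t ht p, hasDerivAt_funVariation_param hS hF ht p,
      hf.hasDerivAt_funVariation_time hS hlam hlam_pos hk' ht p⟩, fun t ht x =>
    ⟨hasDerivAt_funVariation ht (hf.contDiffOn_density x) hS,
      hasDerivAt_fieldVariation ht (hf.contDiffOn_field x) hS,
      hf.funVariation_density hS ht x, rfl, hf.hasDerivAt_variation hS ht x,
      hf.linearized_continuity hS ht x,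
      hf.linearized_euler hlam hlam_pos hh hgeo hk' hS ht x⟩⟩
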